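/- Let $\mathbf H=\mathbf R^4$ be the quaternions, and let $h:S^7\to S^4$, $h(u,v)=(2u\bar v,|u|^2-|v|^2)$, be the Hopf fibration of the unit sphere $S^7\subset\mathbf R^8=\mathbf H\times\mathbf H$ over the unit sphere $S^4\subset\mathbf R^5=\mathbf H\times\mathbf R$. A compact connected embedded smooth submanifold $V\subset S^n$ is called taut if, for every $p\in S^n$ for which the spherical distance function $d_p(x)=\arccos(p\cdot x)$ is nondegenerate on $V$ (all its critical points on $V$ are nondegenerate), the number of its critical points on $V$ equals $\beta(V;\mathbf Z_2)$, the sum of the $\mathbf Z_2$-Betti numbers of $V$ (the minimum allowed by the Morse inequalities); the points $\pm p$, if they lie on $V$, are counted as nondegenerate critical points of $d_p$. Let $M\subset S^4$ be a compact connected embedded smooth submanifold of dimension $d$. Then: (1) If $M$ is taut in $S^4$, then $h^{-1}(M)$ is a compact connected embedded smooth submanifold of $S^7$ of dimension $d+3$ and is taut in $S^7$. (2) For $q=(\bar a,\bar b)\in S^7$ let $f_{ab}(x)=q\cdot x$ be the linear height function on $h^{-1}(M)$ in the direction $q$, and $\ell_{ab}(x)=h(q)\cdot x$ the linear height function on $M$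 in the direction $h(q)$. If $-h(q)\notin M$, then $f_{ab}$ has exactly twice as many critical points on $h^{-1}(M)$ as $\ell_{ab}$ has on $M$. If $M\neq S^4$, the set of $q\in S^7$ with $-h(q)\in M$ has measure zero. (3) $\beta(M\times S^3;\mathbf Z_2)=2\,\beta(M;\mathbf Z_2)$. -/

import Mathlib

open Set Metric MeasureTheory
open scoped Quaternion ContDiff

noncomputable section

namespace HopfTaut

/-! ## Submanifolds of a Euclidean space and critical points of functions on them -/

section Submanifolds

variable {E : Type} [NormedAddCommGroup E] [InnerProductSpace ℝ E]

/-- `c`, restricted to the open set `U ⊆ ℝᵈ`, is a smooth local parametrization of the set `M`: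
a `C^∞` immersion that is a homeomorphism of `U` onto an open subset of `M`. -/
structure IsLocalParam (d : ℕ) (M : Set E) (U : Set (EuclideanSpace ℝ (Fin d)))
    (c : EuclideanSpace ℝ (Fin d) → E) : Prop where
  isOpen : IsOpen U
  contDiffOn : ContDiffOn ℝ ∞ c U
  immersion : ∀ u ∈ U, Function.Injective (fderiv ℝ c u)
  isOpenEmbedding : ∃ h : MapsTo c U M, Topology.IsOpenEmbedding (h.restrict c U M)

/-- `M` is an embedded smooth submanifold of dimension `d`: every point of `M` lies in the image
of a smooth local parametrization.  When `M` is contained in the unit sphere, this says that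
`M` is an embedded smooth `d`-dimensional submanifold of that sphere. -/
def IsSubmanifold (d : ℕ) (M : Set E) : Prop :=
  ∀ x ∈ M, ∃ U c, IsLocalParam d M U c ∧ x ∈ c '' U

/-- `x` is a critical point of the restriction of `g` to the `d`-dimensional submanifold `M`: in
local coordinates on `M` around `x` the function is differentiable with derivative zero.  (For
smooth `g` this does not depend on the parametrization.) -/
def IsCriticalPt (d : ℕ) (M : Set E) (g : E → ℝ) (x : E) : Prop :=
  ∃ U c, IsLocalParam d M U c ∧ ∃ u ∈ U, c u = x ∧
    HasFDerivAt (g ∘ c) (0 : EuclideanSpace ℝ (Fin d) →L[ℝ] ℝ) u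

/-- `x` is a nondegenerate critical point of the restriction of `g` to the `d`-dimensional
submanifold `M`: in local coordinates on `M` around `x`, the derivative vanishes and the Hessian
is a nondegenerate bilinear form. -/
def IsNondegCriticalPt (d : ℕ) (M : Set E) (g : E → ℝ) (x : E) : Prop :=
  ∃ U c, IsLocalParam d M U c ∧ ∃ u ∈ U, c u = x ∧
    HasFDerivAt (g ∘ c) (0 : EuclideanSpace ℝ (Fin d) →L[ℝ] ℝ) u ∧
    ∀ v, (∀ w, fderiv ℝ (fderiv ℝ (g ∘ c)) u v w = 0) → v = 0

end Submanifolds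

/-! ## Betti numbers -/

/-- The `k`-th singular homology of `X` with coefficients in `ℤ/2`. -/
abbrev H (k : ℕ) (X : Type) [TopologicalSpace X] : ModuleCat.{0} (ZMod 2) :=
  ((AlgebraicTopology.singularHomologyFunctor (ModuleCat.{0} (ZMod 2)) k).obj
    (ModuleCat.of (ZMod 2) (ZMod 2))).obj (TopCat.of X)

/-- The `k`-th `ℤ/2`-Betti number (possibly infinite). -/
def betti (k : ℕ) (X : Type) [TopologicalSpace X] : ℕ∞ :=
  Cardinal.toENat (Module.rank (ZMod 2) (H k X))

/-- The sum over all `k` of the `ℤ/2`-Betti numbers (possibly infinite), as the supremum of the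
partial sums. -/
def bettiSum (X : Type) [TopologicalSpace X] : ℕ∞ :=
  ⨆ n : ℕ, ∑ k ∈ Finset.range n, betti k X

/-! ## Taut submanifolds of spheres -/

section Taut

variable {E : Type} [NormedAddCommGroup E] [InnerProductSpace ℝ E]

/-- The spherical (great circle) distance from `p`, for points of the unit sphere. -/
def sphDist (p x : E) : ℝ := Real.arccos (inner ℝ p x)

/-- The critical points of the spherical distance function `d_p` on the submanifold `M` of the
unit sphere.  At `p` and `-p`, where it takes its absolute minimum `0` and maximum `π`, the
function `d_p` is not differentiable; there `d_p ^ 2` and `(π - d_p) ^ 2` (and `cos d_p`) are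
smooth with a nondegenerate critical point on any submanifold through it, and so these points,
if they lie on `M`, are counted as (nondegenerate) critical points of `d_p`. -/
def sphDistCriticalSet (d : ℕ) (M : Set E) (p : E) : Set E :=
  {x ∈ M | x = p ∨ x = -p ∨ IsCriticalPt d M (sphDist p) x}

/-- The spherical distance function `d_p` is nondegenerate (a Morse function) on `M`: all of its
critical points are nondegenerate (the points `p` and `-p` always are, see above). -/
def IsNondegSphDist (d : ℕ) (M : Set E) (p : E) : Prop :=
  ∀ x ∈ M, x ≠ p → x ≠ -p → IsCriticalPt d M (sphDist p) x →
    IsNondegCriticalPt d M (sphDist p) x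

/-- The compact connected `d`-dimensional submanifold `M` of the unit sphere of `E` is taut:
every nondegenerate spherical distance function `d_p` has on `M` the minimum number of critical
points required by the Morse inequalities, the sum of the `ℤ/2`-Betti numbers of `M`. -/
structure IsTaut (d : ℕ) (M : Set E) : Prop where
  subset_sphere : M ⊆ sphere 0 1
  isCompact : IsCompact M
  isConnected : IsConnected M
  isSubmanifold : IsSubmanifold d M
  perfect : ∀ p ∈ sphere (0 : E) 1, IsNondegSphDist d M p →
    (sphDistCriticalSet d M p).encard = bettiSum M

/-- The linear height function in the direction `q`. -/
def height (q x : E) : ℝ := inner ℝ q x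

/-- The critical points on `M` of the linear height function in the direction `q`. -/
def heightCriticalSet (d : ℕ) (M : Set E) (q : E) : Set E :=
  {x ∈ M | IsCriticalPt d M (height q) x}

end Taut

/-! ## The quaternionic Hopf fibration -/

/-- The Euclidean space `ℝ⁸ = ℍ × ℍ`. -/
abbrev R8 : Type := WithLp 2 (ℍ[ℝ] × ℍ[ℝ])

/-- The Euclidean space `ℝ⁵ = ℍ × ℝ`. -/
abbrev R5 : Type := WithLp 2 (ℍ[ℝ] × ℝ)

/-- The map `h (u, v) = (2 u v̄, |u|² - |v|²)`. -/
def hopf (x : R8) : R5 :=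
  WithLp.toLp 2 ((2 : ℝ) • (x.fst * star x.snd), ‖x.fst‖ ^ 2 - ‖x.snd‖ ^ 2)

/-- The map `h` takes the unit sphere `S⁷` to the unit sphere `S⁴`. -/
theorem hopf_mem_sphere {x : R8} (hx : x ∈ sphere (0 : R8) 1) : hopf x ∈ sphere (0 : R5) 1 := by
  rw [mem_sphere_zero_iff_norm] at hx ⊢
  have h1 : ‖x.fst‖ ^ 2 + ‖x.snd‖ ^ 2 = 1 := by
    rw [← WithLp.prod_norm_sq_eq_of_L2, hx]; norm_num
  have h2 : ‖hopf x‖ ^ 2 = 1 := by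
    rw [WithLp.prod_norm_sq_eq_of_L2]
    change ‖(2 : ℝ) • (x.fst * star x.snd)‖ ^ 2 + ‖‖x.fst‖ ^ 2 - ‖x.snd‖ ^ 2‖ ^ 2 = 1
    rw [norm_smul, norm_mul, norm_star, Real.norm_eq_abs, Real.norm_eq_abs, sq_abs, mul_pow,
      sq_abs]
    linear_combination (‖x.fst‖ ^ 2 + ‖x.snd‖ ^ 2 + 1) * h1
  exact (sq_eq_sq₀ (norm_nonneg _) zero_le_one).1 (by rw [h2]; norm_num)

/-- The inverse image `h⁻¹(M) ⊆ S⁷` of a set `M ⊆ S⁴` under `h : S⁷ → S⁴`. -/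
def hopfPreimage (M : Set R5) : Set R8 := {x | x ∈ sphere (0 : R8) 1 ∧ hopf x ∈ M}

instance : MeasurableSpace R8 := borel R8

instance : BorelSpace R8 := ⟨rfl⟩

/-- The standard (surface area) measure on the unit sphere `S⁷`. -/
def sphereMeasure : Measure (sphere (0 : R8) 1) := (volume : Measure R8).toSphere

end HopfTaut

end

/-! A vector y of ℝ⁵ acts on ℍ² by a symmetric operator `cl y` with square |y|², which commutes with
right multiplication by quaternions and satisfies ⟨`cl y x`, x⟩ = ⟨y, h(x)⟩. For unit vectors, h(x)
= y therefore means `cl y x = x`: the fibre over y is the unit 3-sphere of a 4-dimensional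
eigenspace. The orthogonal projection of a unit vector p to this eigenspace is (p + `cl y p`)/2. It
is nonzero exactly when y ≠ -h(p), and normalizing it gives a local section `sec p` with ⟨p, `sec p
y`⟩ = √(2(1 + ⟨h(p), y⟩))/2.

Over y ≠ -h(p), the height in direction p restricted to the fibre has only the critical points ±`sec
p y`, and along the section it is a smooth function, with nonzero derivative, of the height in
direction h(p). So the critical points upstairs are the ±`sec p y` with y critical downstairs
(`isCriticalPt_hopfPreimage_iff`), and their number doubles. The excluded directions form h⁻¹(-M), a
submanifold of dimension d + 3. If M ≠ S⁴ then d < 4, and this set is null because the cone over it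
has Hausdorff dimension below 8.

For tautness, d_p is the arccosine of the height in direction p, so both have the same critical
points (the poles included) and the same nondegeneracy off the poles. If M = S⁴, the preimage is S⁷,
with two critical points and Betti sum 2. Otherwise nondegeneracy of d_p upstairs descends to
d_{h(p)} on M (`isNondegSphDist_hopf`). If -h(p) lies in M, the critical points over it form the
unit sphere of a subspace of dimension 4 - d ≥ 1 (`exists_fibre_criticalSet`). Nondegenerate
critical points are isolated, so this dimension is 1 and there are two such points, twice the single
critical point -h(p) of M. Hence the count doubles for every nondegenerate d_p
(`encard_heightCriticalSet_of_nondeg`). The Betti sum doubles too: M misses a point, so a section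
trivializes h over M and h⁻¹(M) is homeomorphic to M × S³.

For the Betti sum of X × Sᵐ, the projection to X has a section, so the homology is that of X plus
the kernel of the projection. The sphere is replaced by a punctured vector space. The product of X
with E × ℝ minus its origin is covered by two open slit sets, each retracting to a copy of X, whose
intersection is homotopy equivalent to X × (E minus 0). A Mayer–Vietoris argument then shifts the
kernel by one degree (`rkK_succ_eq`), and the induction ends at the punctured line, which gives two
copies of X. So the kernel in degree k is the homology of X in degree k - m. The required passage to
small chains is barycentric subdivision, carried out modulo 2 so that boundaries carry no signs. -/

noncomputable section

/-! ### Singular chains modulo two, with an explicit boundary -/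

namespace SingChain

open CategoryTheory Limits AlgebraicTopology

/-- Singular simplices. -/
abbrev Smp (n : ℕ) (X : Type) [TopologicalSpace X] : Type :=
  C(stdSimplex ℝ (Fin (n + 1)), X)

/-- Singular chains modulo two. -/
abbrev Ch (n : ℕ) (X : Type) [TopologicalSpace X] : Type := Smp n X →₀ ZMod 2

/-- The inclusion of the `i`-th face of the standard simplex. -/
def face (n : ℕ) (i : Fin (n + 2)) :
    C(stdSimplex ℝ (Fin (n + 1)), stdSimplex ℝ (Fin (n + 2))) :=
  ⟨stdSimplex.map i.succAbove, stdSimplex.continuous_map _⟩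

variable {X Y W : Type} [TopologicalSpace X] [TopologicalSpace Y] [TopologicalSpace W]

/-- The boundary of singular chains modulo two. -/
def bd (n : ℕ) : Ch (n + 1) X →ₗ[ZMod 2] Ch n X :=
  ∑ i : Fin (n + 2), Finsupp.lmapDomain _ _ fun σ : Smp (n + 1) X ↦ σ.comp (face n i)

/-- The map of chains induced by a continuous map. -/
def push (n : ℕ) (f : C(X, Y)) : Ch n X →ₗ[ZMod 2] Ch n Y :=
  Finsupp.lmapDomain _ _ fun σ ↦ f.comp σ

@[simp]
lemma bd_single (n : ℕ) (σ : Smp (n + 1) X) (r : ZMod 2) :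
    bd n (Finsupp.single σ r) = ∑ i : Fin (n + 2), Finsupp.single (σ.comp (face n i)) r := by
  simp [bd, LinearMap.sum_apply, Finsupp.mapDomain_single]

@[simp]
lemma push_single (n : ℕ) (f : C(X, Y)) (σ : Smp n X) (r : ZMod 2) :
    push n f (Finsupp.single σ r) = Finsupp.single (f.comp σ) r := by
  simp [push, Finsupp.mapDomain_single]

lemma push_push (n : ℕ) (g : C(Y, W)) (f : C(X, Y)) (c : Ch n X) :
    push n g (push n f c) = push n (g.comp f) c := by
  have : push n g ∘ₗ push n f = push n (g.comp f) := by
    ext σ : 1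
    ext1
    simp [ContinuousMap.comp_assoc]
  exact LinearMap.congr_fun this c

lemma push_id (n : ℕ) (c : Ch n X) : push n (ContinuousMap.id X) c = c := by
  have : push n (ContinuousMap.id X) = LinearMap.id := by
    ext σ : 1
    ext1
    simp
  exact LinearMap.congr_fun this c

lemma bd_push (n : ℕ) (f : C(X, Y)) (c : Ch (n + 1) X) :
    bd n (push (n + 1) f c) = push n f (bd n c) := by
  have : bd n ∘ₗ push (n + 1) f = push n f ∘ₗ bd n := by
    ext σ : 1
    ext1
    simp [ContinuousMap.comp_assoc]
  exact LinearMap.congr_fun this c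

/-- The cycles. -/
def Z (X : Type) [TopologicalSpace X] : (n : ℕ) → Submodule (ZMod 2) (Ch n X)
  | 0 => ⊤
  | n + 1 => LinearMap.ker (bd n)

/-- The boundaries. -/
def B (X : Type) [TopologicalSpace X] (n : ℕ) : Submodule (ZMod 2) (Ch n X) :=
  LinearMap.range (bd n)

/-- Each codimension-two face is reached by two orders of deletion. The simplicial identity is a
fixed-point-free involution exchanging them, and equal terms cancel modulo 2. Both ∂∂ = 0
statements, for singular and for affine chains, come from here. -/
lemma sum_sum_succAbove {M : Type*} [AddCommGroup M] [Module (ZMod 2) M] (n : ℕ)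
    (F : (Fin (n + 1) → Fin (n + 3)) → M) :
    ∑ i : Fin (n + 3), ∑ j : Fin (n + 2), F (fun k ↦ i.succAbove (j.succAbove k)) = 0 := by
  rw [← Finset.sum_product']
  have h2 (m : M) : m + m = 0 := by
    rw [← two_smul (ZMod 2) m]
    exact (show (2 : ZMod 2) = 0 from rfl) ▸ zero_smul _ m
  refine Finset.sum_involution
    (fun p _ ↦ (p.1.succAbove p.2, p.2.predAbove p.1)) ?_ ?_ ?_ ?_
  · intro p _
    simp only [Fin.succAbove_succAbove_succAbove_predAbove]
    exact h2 _
  · rintro ⟨i, j⟩ _ _ h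
    exact Fin.succAbove_ne i j (congrArg Prod.fst h)
  · simp
  · rintro ⟨i, j⟩ _
    simp [Fin.succAbove_succAbove_predAbove, Fin.predAbove_predAbove_succAbove]

lemma bd_bd (n : ℕ) (c : Ch (n + 2) X) : bd n (bd (n + 1) c) = 0 := by
  have : bd n ∘ₗ bd (n + 1) = (0 : Ch (n + 2) X →ₗ[ZMod 2] _) := by
    ext σ : 1
    ext1
    simp only [LinearMap.comp_apply, Finsupp.lsingle_apply, bd_single, map_sum]
    have hh := sum_sum_succAbove (M := Ch n X) n fun θ ↦ Finsupp.single
      (σ.comp (⟨stdSimplex.map θ, stdSimplex.continuous_map _⟩ :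
        C(stdSimplex ℝ (Fin (n + 1)), stdSimplex ℝ (Fin (n + 3))))) (1 : ZMod 2)
    refine Eq.trans ?_ hh
    refine Finset.sum_congr rfl fun i _ ↦ Finset.sum_congr rfl fun j _ ↦ ?_
    congr 1
    ext x
    simp only [ContinuousMap.comp_apply, face, ContinuousMap.coe_mk, stdSimplex.map_comp_apply]
    rfl
  exact LinearMap.congr_fun this c

lemma bd_mem_Z (n : ℕ) (c : Ch (n + 1) X) : bd n c ∈ Z X n := by
  cases n with
  | zero => trivial
  | succ n => exact bd_bd n c

lemma push_mem_Z {n : ℕ} (f : C(X, Y)) {c : Ch n X} (hc : c ∈ Z X n) : push n f c ∈ Z Y n := by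
  cases n with
  | zero => trivial
  | succ n =>
    change bd n _ = 0
    rw [bd_push, show bd n c = 0 from hc, map_zero]

lemma push_mem_B {n : ℕ} (f : C(X, Y)) {c : Ch n X} (hc : c ∈ B X n) : push n f c ∈ B Y n := by
  obtain ⟨e, rfl⟩ := hc
  exact ⟨push _ f e, bd_push n f e⟩

open scoped Simplicial

/-! ### Comparison with the singular homology of Mathlib -/

/-- The coefficients. -/
abbrev coeff : ModuleCat.{0} (ZMod 2) := ModuleCat.of (ZMod 2) (ZMod 2)

/-- The singular chain complex of Mathlib. -/
abbrev cplx (X : Type) [TopologicalSpace X] : ChainComplex (ModuleCat.{0} (ZMod 2)) ℕ :=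
  (TopCat.toSSet.obj (TopCat.of X)).chainComplex coeff

/-- Singular simplices as simplices of the singular simplicial set. -/
def toS (n : ℕ) : Smp n X ≃ (TopCat.toSSet.obj (TopCat.of X)) _⦋n⦌ :=
  (TopCat.toSSetObjEquiv (TopCat.of X) (Opposite.op ⦋n⦌)).symm

lemma δ_toS (n : ℕ) (i : Fin (n + 2)) (σ : Smp (n + 1) X) :
    (TopCat.toSSet.obj (TopCat.of X)).δ i (toS (n + 1) σ) = toS n (σ.comp (face n i)) := rfl

/-- The comparison map. -/
def cmp (n : ℕ) : Ch n X →ₗ[ZMod 2] (cplx X).X n :=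
  Finsupp.lsum ℕ fun σ ↦ ((TopCat.toSSet.obj (TopCat.of X)).ιChainComplex (R := coeff)
    (toS n σ)).hom

lemma cmp_single (n : ℕ) (σ : Smp n X) (r : ZMod 2) :
    cmp n (Finsupp.single σ r) =
      ((TopCat.toSSet.obj (TopCat.of X)).ιChainComplex (R := coeff) (toS n σ)).hom r := by
  simp [cmp]

/-- The inverse of the comparison map. -/
def cmpInv (n : ℕ) : (cplx X).X n ⟶ ModuleCat.of (ZMod 2) (Ch n X) :=
  Cofan.IsColimit.desc
    ((TopCat.toSSet.obj (TopCat.of X)).isColimitChainComplexXCofan coeff n)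
    fun x ↦ ModuleCat.ofHom (Finsupp.lsingle ((toS n).symm x))

lemma ι_cmpInv (n : ℕ) (x : (TopCat.toSSet.obj (TopCat.of X)) _⦋n⦌) :
    (TopCat.toSSet.obj (TopCat.of X)).ιChainComplex (R := coeff) x ≫ cmpInv n =
      ModuleCat.ofHom (Finsupp.lsingle ((toS n).symm x)) :=
  Cofan.IsColimit.fac _ _ x

/-- Chains are the chains of Mathlib. -/
def cmpEquiv (n : ℕ) : Ch n X ≃ₗ[ZMod 2] (cplx X).X n :=
  LinearEquiv.ofLinearMap (cmp n) (cmpInv n).hom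
    (by
      have : cmpInv (X := X) n ≫ ModuleCat.ofHom (cmp n) = 𝟙 _ := by
        refine SSet.chainComplex_hom_ext fun x ↦ ?_
        rw [← Category.assoc, ι_cmpInv]
        ext
        simp [cmp_single]
      exact congrArg ModuleCat.Hom.hom this)
    (by
      ext σ : 1
      ext1
      have := congrArg (fun f ↦ ModuleCat.Hom.hom f (1 : ZMod 2)) (ι_cmpInv n (toS n σ))
      simpa [cmp_single] using this)

lemma cmpEquiv_apply (n : ℕ) (c : Ch n X) : cmpEquiv n c = cmp n c := rfl

lemma cmp_bd (n : ℕ) (c : Ch (n + 1) X) :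
    cmp n (bd n c) = ((cplx X).d (n + 1) n).hom (cmp (n + 1) c) := by
  have : cmp n ∘ₗ bd n = ((cplx X).d (n + 1) n).hom ∘ₗ cmp (n + 1) := by
    ext σ : 1
    ext1
    have := congrArg (fun f ↦ ModuleCat.Hom.hom f (1 : ZMod 2))
      (SSet.ιChainComplex_d (TopCat.toSSet.obj (TopCat.of X)) coeff (toS (n + 1) σ))
    simp only [LinearMap.comp_apply, Finsupp.lsingle_apply, bd_single, map_sum, cmp_single]
    simp only [ModuleCat.hom_comp, LinearMap.comp_apply] at this
    rw [this]
    simp only [ModuleCat.hom_sum, LinearMap.sum_apply, δ_toS]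
    refine Finset.sum_congr rfl fun i _ ↦ ?_
    -- The alternating signs of the simplicial differential act trivially modulo 2.
    have h1 (j : ℕ) (m : (cplx X).X n) : ((-1 : ℤ) ^ j) • m = m := by
      rcases neg_one_pow_eq_or ℤ j with h | h
      · rw [h, one_smul]
      · rw [h, neg_one_smul, neg_eq_iff_add_eq_zero, ← two_smul (ZMod 2) m]
        exact (show (2 : ZMod 2) = 0 from rfl) ▸ zero_smul _ m
    exact (h1 _ _).symm
  exact LinearMap.congr_fun this c

lemma cmp_push (n : ℕ) (f : C(X, Y)) (c : Ch n X) :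
    cmp n (push n f c) =
      ((SSet.chainComplexMap (TopCat.toSSet.map (TopCat.ofHom f)) coeff).f n).hom (cmp n c) := by
  have : cmp n ∘ₗ push n f =
      ((SSet.chainComplexMap (TopCat.toSSet.map (TopCat.ofHom f)) coeff).f n).hom ∘ₗ cmp n := by
    ext σ : 1
    ext1
    have := congrArg (fun f ↦ ModuleCat.Hom.hom f (1 : ZMod 2))
      (SSet.ι_chainComplexMap_f _ _ (TopCat.toSSet.map (TopCat.ofHom f)) coeff (toS n σ))
    simp only [LinearMap.comp_apply, Finsupp.lsingle_apply, push_single, cmp_single]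
    exact this.symm
  exact LinearMap.congr_fun this c

/-- Homotopic maps induce the same map in homology. -/
lemma push_add_push_mem_B {f g : C(X, Y)} (h : f.Homotopic g) {n : ℕ} {c : Ch n X}
    (hc : c ∈ Z X n) : push n f c + push n g c ∈ B Y n := by
  obtain ⟨F⟩ := h
  have G : Homotopy (SSet.chainComplexMap (TopCat.toSSet.map (TopCat.ofHom f)) coeff)
      (SSet.chainComplexMap (TopCat.toSSet.map (TopCat.ofHom g)) coeff) :=
    TopCat.Homotopy.singularChainComplexFunctorObjMap (f := TopCat.ofHom f)
      (g := TopCat.ofHom g) F coeff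
  -- The chain homotopy identity is evaluated at the cycle; the summand that first applies the
  -- differential to it vanishes.
  have hcomm := congrArg (fun φ ↦ ModuleCat.Hom.hom φ (cmp n c)) (G.comm n)
  have hd : ((dNext n) G.hom).hom (cmp n c) = 0 := by
    cases n with
    | zero => simp
    | succ n =>
      rw [dNext_eq G.hom (show (ComplexShape.down ℕ).Rel (n + 1) n from rfl)]
      have : ((cplx X).d (n + 1) n).hom (cmp (n + 1) c) = 0 := by
        rw [← cmp_bd, show bd n c = 0 from hc, map_zero]
      rw [ModuleCat.hom_comp, LinearMap.comp_apply, this, map_zero]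
  rw [prevD_eq G.hom (show (ComplexShape.down ℕ).Rel (n + 1) n from rfl)] at hcomm
  obtain ⟨e, he⟩ := (cmpEquiv (X := Y) (n + 1)).surjective
    ((G.hom n (n + 1)).hom (cmp n c))
  refine ⟨e, (cmpEquiv (X := Y) n).injective ?_⟩
  simp only [ModuleCat.hom_add, LinearMap.add_apply, hd, zero_add, ModuleCat.hom_comp,
    LinearMap.comp_apply] at hcomm
  rw [← he, cmpEquiv_apply, ← cmp_push, ← cmp_bd, ← cmp_push, ← map_add] at hcomm
  have := (cmpEquiv (X := Y) n).injective hcomm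
  rw [this, add_assoc, ← two_smul (ZMod 2) (push n g c)]
  simp [show (2 : ZMod 2) = 0 from rfl]

/-- The dimension of the subquotient `P / (P ∩ Q)`. -/
def qrank {V : Type} [AddCommGroup V] [Module (ZMod 2) V] (P Q : Submodule (ZMod 2) V) :
    Cardinal := Module.rank (ZMod 2) (P ⧸ Q.submoduleOf P)

/-- Transfers homology to an explicit model `V` of the middle term, so that afterwards only cycles
and boundaries inside `V` matter. -/
lemma rank_homology_eq_qrank (S : ShortComplex (ModuleCat.{0} (ZMod 2))) {V : Type}
    [AddCommGroup V] [Module (ZMod 2) V] (e : V ≃ₗ[ZMod 2] S.X₂) (P Q : Submodule (ZMod 2) V)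
    (hP : ∀ v, v ∈ P ↔ S.g.hom (e v) = 0) (hQ : ∀ v, v ∈ Q ↔ ∃ x, S.f.hom x = e v) :
    Module.rank (ZMod 2) S.homology = qrank P Q := by
  let E : P ≃ₗ[ZMod 2] LinearMap.ker S.g.hom :=
    e.submoduleMap P ≪≫ₗ LinearEquiv.ofEq _ _ (by
      ext x
      obtain ⟨v, rfl⟩ := e.surjective x
      simp [hP])
  have hE (v : P) : (E v : S.X₂) = e v := rfl
  refine (S.moduleCatHomologyIso.toLinearEquiv ≪≫ₗ
    (Submodule.Quotient.equiv _ _ E.symm ?_)).rank_eq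
  ext v
  rw [Submodule.mem_map_equiv, LinearEquiv.symm_symm, Submodule.submoduleOf, Submodule.mem_comap,
    hQ, LinearMap.mem_range]
  refine exists_congr fun x ↦ ?_
  rw [Submodule.subtype_apply, ← hE, Subtype.ext_iff]
  rfl

lemma rank_H (n : ℕ) (X : Type) [TopologicalSpace X] :
    Module.rank (ZMod 2) (HopfTaut.H n X) = qrank (Z X n) (B X n) := by
  have hQ (v : Ch n X) : v ∈ B X n ↔ ∃ x, ((cplx X).d (n + 1) n).hom x = cmpEquiv n v := by
    constructor
    · rintro ⟨c, rfl⟩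
      exact ⟨cmp (n + 1) c, (cmp_bd n c).symm⟩
    · rintro ⟨x, hx⟩
      obtain ⟨c, rfl⟩ := (cmpEquiv (X := X) (n + 1)).surjective x
      refine ⟨c, (cmpEquiv n).injective ?_⟩
      rw [← hx, cmpEquiv_apply, cmpEquiv_apply, cmp_bd]
  cases n with
  | zero =>
    -- In degree 0 the successor index is 0 itself and the differential from 0 to 0 vanishes, so
    -- every chain is a cycle.
    rw [← rank_homology_eq_qrank ((cplx X).sc' 1 0 0) (cmpEquiv 0) (Z X 0) (B X 0)
      (fun v ↦ by
        rw [show ((cplx X).sc' 1 0 0).g = 0 from (cplx X).shape _ _ (by simp)]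
        simp [Z]) hQ]
    exact ((cplx X).homologyIsoSc' 1 0 0 (by simp) (by simp)).toLinearEquiv.rank_eq
  | succ n =>
    rw [← rank_homology_eq_qrank ((cplx X).sc' (n + 2) (n + 1) n) (cmpEquiv (n + 1))
      (Z X (n + 1)) (B X (n + 1)) (fun v ↦ by
        change bd n v = 0 ↔ ((cplx X).d (n + 1) n).hom (cmp (n + 1) v) = 0
        rw [← cmp_bd, ← cmpEquiv_apply, LinearEquiv.map_eq_zero_iff]) hQ]
    exact ((cplx X).homologyIsoSc' (n + 2) (n + 1) n (by simp) (by simp)).toLinearEquiv.rank_eq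

end SingChain
end

noncomputable section

namespace SingChain

variable {X Y W : Type} [TopologicalSpace X] [TopologicalSpace Y] [TopologicalSpace W]

lemma add_self_eq_zero' {M : Type*} [AddCommGroup M] [Module (ZMod 2) M] (m : M) : m + m = 0 := by
  rw [← two_smul (ZMod 2) m]
  exact (show (2 : ZMod 2) = 0 from rfl) ▸ zero_smul _ m

/-! ### Affine chains in a standard simplex and their barycentric subdivision -/

/-- The standard simplex. -/
abbrev Δ (n : ℕ) : Type := stdSimplex ℝ (Fin (n + 1))

/-- The affine map of standard simplices with given vertices. -/
def comb {k N : ℕ} (v : Fin (k + 1) → Δ N) : C(Δ k, Δ N) where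
  toFun t := ⟨fun j ↦ ∑ i, t i * v i j, fun j ↦ Finset.sum_nonneg fun i _ ↦
    mul_nonneg (t.2.1 i) ((v i).2.1 j), by
      rw [Finset.sum_comm]
      simp [← Finset.mul_sum]⟩
  continuous_toFun := by
    refine Continuous.subtype_mk (continuous_pi fun j ↦ continuous_finsetSum _ fun i _ ↦ ?_) _
    exact ((continuous_apply i).comp continuous_subtype_val).mul continuous_const

lemma comb_apply {k N : ℕ} (v : Fin (k + 1) → Δ N) (t : Δ k) (j : Fin (N + 1)) :
    comb v t j = ∑ i, t i * v i j := rfl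

lemma comb_comb {k M N : ℕ} (w : Fin (M + 1) → Δ N) (v : Fin (k + 1) → Δ M) (t : Δ k) :
    comb w (comb v t) = comb (fun i ↦ comb w (v i)) t := by
  ext j
  simp only [comb_apply, Finset.sum_mul, Finset.mul_sum]
  rw [Finset.sum_comm]
  exact Finset.sum_congr rfl fun i _ ↦ Finset.sum_congr rfl fun l _ ↦ mul_assoc _ _ _

lemma comb_face {k N : ℕ} (v : Fin (k + 2) → Δ N) (i : Fin (k + 2)) :
    (comb v).comp (face k i) = comb (v ∘ i.succAbove) := by
  ext t j
  simp only [ContinuousMap.comp_apply, comb_apply, face, ContinuousMap.coe_mk, stdSimplex.map_coe,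
    FunOnFinite.linearMap_apply_apply, Function.comp_apply]
  rw [Fin.sum_univ_succAbove _ i]
  have h1 : ∑ l with i.succAbove l = i, t l = 0 := by
    rw [Finset.filter_false_of_mem (fun l _ ↦ Fin.succAbove_ne i l), Finset.sum_empty]
  rw [h1, zero_mul, zero_add]
  refine Finset.sum_congr rfl fun l _ ↦ ?_
  congr 1
  rw [Finset.sum_eq_single l]
  · intro b hb hbl
    exact absurd (Fin.succAbove_right_injective (Finset.mem_filter.1 hb).2) hbl
  · simp

/-- The vertices of the standard simplex. -/
def vert (n : ℕ) : Fin (n + 1) → Δ n := fun i ↦ stdSimplex.vertex i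

lemma comb_vert (n : ℕ) : comb (vert n) = ContinuousMap.id _ := by
  ext t j
  simp [comb_apply, vert, Pi.single_apply]

lemma comb_vertex {k N : ℕ} (v : Fin (k + 1) → Δ N) (i : Fin (k + 1)) : comb v (vert k i) = v i := by
  ext j
  simp [comb_apply, vert, Pi.single_apply]

/-- The barycenter of the standard simplex. -/
def center (k : ℕ) : Δ k := ⟨fun _ ↦ ((k : ℝ) + 1)⁻¹, fun _ ↦ by positivity, by
  simp
  field_simp⟩

/-- The barycenter of an affine simplex. -/
def bary {k N : ℕ} (v : Fin (k + 1) → Δ N) : Δ N := comb v (center k)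

lemma bary_comb {k M N : ℕ} (w : Fin (M + 1) → Δ N) (v : Fin (k + 1) → Δ M) :
    comb w (bary v) = bary (fun i ↦ comb w (v i)) := comb_comb w v _

/-- Affine chains modulo two. -/
abbrev ACh (k N : ℕ) : Type := (Fin (k + 1) → Δ N) →₀ ZMod 2

/-- The boundary of affine chains. -/
def abd {N : ℕ} (k : ℕ) : ACh (k + 1) N →ₗ[ZMod 2] ACh k N :=
  ∑ i : Fin (k + 2), Finsupp.lmapDomain _ _ fun v : Fin (k + 2) → Δ N ↦ v ∘ i.succAbove

lemma abd_single {N : ℕ} (k : ℕ) (v : Fin (k + 2) → Δ N) (r : ZMod 2) :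
    abd k (Finsupp.single v r) = ∑ i : Fin (k + 2), Finsupp.single (v ∘ i.succAbove) r := by
  simp [abd, LinearMap.sum_apply, Finsupp.mapDomain_single]

lemma abd_abd {N : ℕ} (k : ℕ) (c : ACh (k + 2) N) : abd k (abd (k + 1) c) = 0 := by
  have : abd k ∘ₗ abd (k + 1) = (0 : ACh (k + 2) N →ₗ[ZMod 2] _) := by
    ext v : 1
    ext1
    simp only [LinearMap.comp_apply, Finsupp.lsingle_apply, abd_single, map_sum]
    exact sum_sum_succAbove (M := ACh k N) k fun θ ↦ Finsupp.single (v ∘ θ) (1 : ZMod 2)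
  exact LinearMap.congr_fun this c

/-- The cone over an affine chain. -/
def cone {N : ℕ} (b : Δ N) (k : ℕ) : ACh k N →ₗ[ZMod 2] ACh (k + 1) N :=
  Finsupp.lmapDomain _ _ fun v : Fin (k + 1) → Δ N ↦ (Fin.cons b v : Fin (k + 2) → Δ N)

lemma cone_single {N : ℕ} (b : Δ N) (k : ℕ) (v : Fin (k + 1) → Δ N) (r : ZMod 2) :
    cone b k (Finsupp.single v r) = Finsupp.single (Fin.cons b v : Fin (k + 2) → Δ N) r := by
  simp [cone, Finsupp.mapDomain_single]

lemma cons_comp_succAbove_zero {α : Type*} {k : ℕ} (b : α) (v : Fin k → α) :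
    (Fin.cons b v : Fin (k + 1) → α) ∘ (0 : Fin (k + 1)).succAbove = v := by
  ext j
  simp

lemma cons_comp_succAbove_succ {α : Type*} {k : ℕ} (b : α) (v : Fin (k + 1) → α)
    (i : Fin (k + 1)) :
    (Fin.cons b v : Fin (k + 2) → α) ∘ i.succ.succAbove = Fin.cons b (v ∘ i.succAbove) := by
  ext j
  refine Fin.cases ?_ (fun j ↦ ?_) j <;> simp

/-- Deleting the apex returns the base, and deleting a base vertex gives the cone over a face. This
needs positive degree: over a point, deleting the base vertex leaves the apex, an extra term. -/
lemma abd_cone {N : ℕ} (b : Δ N) (k : ℕ) (c : ACh (k + 1) N) :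
    abd (k + 1) (cone b (k + 1) c) = c + cone b k (abd k c) := by
  have : abd (k + 1) ∘ₗ cone b (k + 1) = LinearMap.id + cone b k ∘ₗ abd k := by
    ext v : 1
    ext1
    simp only [LinearMap.comp_apply, Finsupp.lsingle_apply, cone_single, abd_single,
      LinearMap.add_apply, LinearMap.id_apply, map_sum]
    rw [Fin.sum_univ_succ, cons_comp_succAbove_zero]
    simp only [cons_comp_succAbove_succ]
  exact LinearMap.congr_fun this c

lemma abd_cone_zero {N : ℕ} (b : Δ N) (v : Fin 1 → Δ N) :
    abd 0 (cone b 0 (Finsupp.single v 1)) = Finsupp.single v 1 + Finsupp.single (fun _ ↦ b) 1 := by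
  rw [cone_single, abd_single, Fin.sum_univ_two, cons_comp_succAbove_zero]
  congr 2
  ext1 j
  obtain rfl : j = (0 : Fin 1) := Subsingleton.elim (α := Fin 1) j 0
  rfl

/-- The two endpoints of an edge contribute the apex twice, so the extra term of degree 0 cancels.
This is the start of the induction for `abd_asd`. -/
lemma abd_cone_abd_zero {N : ℕ} (b : Δ N) (v : Fin 2 → Δ N) :
    abd 0 (cone b 0 (abd 0 (Finsupp.single v 1))) = abd 0 (Finsupp.single v 1) := by
  simp only [abd_single 0 v, map_sum, abd_cone_zero, Finset.sum_add_distrib]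
  rw [Fin.sum_univ_two (f := fun _ ↦ Finsupp.single (fun _ ↦ b) 1), add_self_eq_zero', add_zero]

/-- Barycentric subdivision of affine chains. -/
def asd {N : ℕ} : (k : ℕ) → ACh k N →ₗ[ZMod 2] ACh k N
  | 0 => LinearMap.id
  | k + 1 => Finsupp.linearCombination (ZMod 2) fun v ↦
      cone (bary v) k (asd k (abd k (Finsupp.single v 1)))

/-- The homotopy between barycentric subdivision and the identity. -/
def ath {N : ℕ} : (k : ℕ) → ACh k N →ₗ[ZMod 2] ACh (k + 1) N
  -- A point is its own barycenter, so this is a degenerate edge, whose boundary is zero modulo 2.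
  | 0 => Finsupp.linearCombination (ZMod 2) fun v ↦ cone (bary v) 0 (Finsupp.single v 1)
  | k + 1 => Finsupp.linearCombination (ZMod 2) fun v ↦
      cone (bary v) (k + 1) (Finsupp.single v 1 + ath k (abd k (Finsupp.single v 1)))

lemma asd_single {N : ℕ} (k : ℕ) (v : Fin (k + 2) → Δ N) :
    asd (k + 1) (Finsupp.single v 1) = cone (bary v) k (asd k (abd k (Finsupp.single v 1))) := by
  simp [asd]

lemma ath_single {N : ℕ} (k : ℕ) (v : Fin (k + 2) → Δ N) :
    ath (k + 1) (Finsupp.single v 1) = cone (bary v) (k + 1)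
      (Finsupp.single v 1 + ath k (abd k (Finsupp.single v 1))) := by
  simp [ath]

lemma ath_single_zero {N : ℕ} (v : Fin 1 → Δ N) :
    ath 0 (Finsupp.single v 1) = cone (bary v) 0 (Finsupp.single v 1) := by
  simp [ath]

/-- The cone formula gives the wanted term plus a cone over the boundary of a subdivided boundary;
by induction the latter is the subdivision of ∂∂ = 0. -/
lemma abd_asd {N : ℕ} (k : ℕ) (c : ACh (k + 1) N) : abd k (asd (k + 1) c) = asd k (abd k c) := by
  induction k with
  | zero =>
    have : abd 0 ∘ₗ asd 1 = asd 0 ∘ₗ abd (N := N) 0 := by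
      ext v : 1
      ext1
      simp only [LinearMap.comp_apply, Finsupp.lsingle_apply, asd_single]
      exact abd_cone_abd_zero _ v
    exact LinearMap.congr_fun this c
  | succ k ih =>
    have : abd (k + 1) ∘ₗ asd (k + 2) = asd (k + 1) ∘ₗ abd (N := N) (k + 1) := by
      ext v : 1
      ext1
      simp only [LinearMap.comp_apply, Finsupp.lsingle_apply, asd_single]
      rw [abd_cone, ih, abd_abd, map_zero, map_zero, add_zero]
    exact LinearMap.congr_fun this c

lemma bary_const {N : ℕ} (v : Fin 1 → Δ N) : (fun _ ↦ bary v) = v := by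
  ext i j
  rw [Subsingleton.elim i 0, bary, comb_apply, Fin.sum_univ_one]
  change ((0 : ℕ) + 1 : ℝ)⁻¹ * v 0 j = v 0 j
  simp

lemma abd_ath_zero {N : ℕ} (c : ACh 0 N) : abd 0 (ath 0 c) = 0 := by
  have : abd 0 ∘ₗ ath (N := N) 0 = 0 := by
    ext v : 1
    ext1
    simp only [LinearMap.comp_apply, Finsupp.lsingle_apply, ath_single_zero]
    rw [abd_cone_zero, bary_const, add_self_eq_zero']
    rfl
  exact LinearMap.congr_fun this c

lemma abd_ath {N : ℕ} (k : ℕ) (c : ACh (k + 1) N) :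
    abd (k + 1) (ath (k + 1) c) + ath k (abd k c) = c + asd (k + 1) c := by
  -- The inductive step uses the homotopy formula one degree lower only at the cycle ∂v, where the
  -- term containing ∂∂v drops out.
  have key (k : ℕ) (h : ∀ v : Fin (k + 2) → Δ N,
      abd k (ath k (abd k (Finsupp.single v 1))) =
        abd k (Finsupp.single v 1) + asd k (abd k (Finsupp.single v 1))) (c : ACh (k + 1) N) :
      abd (k + 1) (ath (k + 1) c) + ath k (abd k c) = c + asd (k + 1) c := by
    have : abd (k + 1) ∘ₗ ath (k + 1) + ath k ∘ₗ abd k = LinearMap.id + asd (N := N) (k + 1) := by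
      ext v : 1
      ext1
      simp only [LinearMap.comp_apply, Finsupp.lsingle_apply, LinearMap.add_apply,
        LinearMap.id_apply, asd_single, ath_single]
      rw [abd_cone, map_add, h v, ← add_assoc, add_self_eq_zero', zero_add, add_right_comm,
        add_assoc (Finsupp.single v 1), add_self_eq_zero', add_zero]
    exact LinearMap.congr_fun this c
  induction k with
  | zero =>
    refine key 0 (fun v ↦ ?_) c
    rw [abd_ath_zero]
    exact (add_self_eq_zero' _).symm
  | succ k ih =>
    refine key (k + 1) (fun v ↦ ?_) c
    have := ih (abd (k + 1) (Finsupp.single v 1))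
    rwa [abd_abd, map_zero, add_zero] at this

/-- The image of an affine chain under a map of vertices. -/
def amap {M N : ℕ} (k : ℕ) (u : Δ M → Δ N) : ACh k M →ₗ[ZMod 2] ACh k N :=
  Finsupp.lmapDomain _ _ fun v ↦ u ∘ v

lemma amap_single {M N : ℕ} (k : ℕ) (u : Δ M → Δ N) (v : Fin (k + 1) → Δ M) (r : ZMod 2) :
    amap k u (Finsupp.single v r) = Finsupp.single (u ∘ v) r := by
  simp [amap, Finsupp.mapDomain_single]

lemma abd_amap {M N : ℕ} (k : ℕ) (u : Δ M → Δ N) (c : ACh (k + 1) M) :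
    abd k (amap (k + 1) u c) = amap k u (abd k c) := by
  have : abd k ∘ₗ amap (k + 1) u = amap k u ∘ₗ abd k := by
    ext v : 1
    ext1
    simp [abd_single, amap_single, Function.comp_assoc]
  exact LinearMap.congr_fun this c

lemma amap_cone {M N : ℕ} (k : ℕ) (u : Δ M → Δ N) (b : Δ M) (c : ACh k M) :
    amap (k + 1) u (cone b k c) = cone (u b) k (amap k u c) := by
  have : amap (k + 1) u ∘ₗ cone b k = cone (u b) k ∘ₗ amap k u := by
    ext v : 1
    ext1
    simp only [LinearMap.comp_apply, Finsupp.lsingle_apply, cone_single, amap_single]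
    congr 1
    ext1 j
    refine Fin.cases ?_ (fun j ↦ ?_) j <;> simp
  exact LinearMap.congr_fun this c

/-- Naturality holds for affine maps, because these preserve barycenters. -/
lemma amap_asd {M N : ℕ} (k : ℕ) (w : Fin (M + 1) → Δ N) (c : ACh k M) :
    amap k (comb w) (asd k c) = asd k (amap k (comb w) c) := by
  induction k with
  | zero => rfl
  | succ k ih =>
    have : amap (k + 1) (comb w) ∘ₗ asd (k + 1) = asd (k + 1) ∘ₗ amap (k + 1) (comb w) := by
      ext v : 1
      ext1
      simp only [LinearMap.comp_apply, Finsupp.lsingle_apply, amap_single, asd_single]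
      rw [amap_cone, ih, ← abd_amap, amap_single, bary_comb]
      rfl
    exact LinearMap.congr_fun this c

lemma amap_ath {M N : ℕ} (k : ℕ) (w : Fin (M + 1) → Δ N) (c : ACh k M) :
    amap (k + 1) (comb w) (ath k c) = ath k (amap k (comb w) c) := by
  induction k with
  | zero =>
    have : amap 1 (comb w) ∘ₗ ath 0 = ath 0 ∘ₗ amap 0 (comb w) := by
      ext v : 1
      ext1
      simp only [LinearMap.comp_apply, Finsupp.lsingle_apply, amap_single, ath_single_zero]
      rw [amap_cone, amap_single, bary_comb]
      rfl
    exact LinearMap.congr_fun this c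
  | succ k ih =>
    have : amap (k + 2) (comb w) ∘ₗ ath (k + 1) = ath (k + 1) ∘ₗ amap (k + 1) (comb w) := by
      ext v : 1
      ext1
      simp only [LinearMap.comp_apply, Finsupp.lsingle_apply, amap_single, ath_single]
      rw [amap_cone, map_add, ih, ← abd_amap, amap_single, bary_comb]
      rfl
    exact LinearMap.congr_fun this c

/-! ### Diameters -/

/-- Chains all of whose simplices have a given property. -/
abbrev spt {α : Type} (P : Set α) : Submodule (ZMod 2) (α →₀ ZMod 2) :=
  Finsupp.supported (ZMod 2) (ZMod 2) P

lemma map_mem_of_mem_spt {α V : Type} [AddCommGroup V] [Module (ZMod 2) V]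
    {P : Set α} {Q : Submodule (ZMod 2) V} (L : (α →₀ ZMod 2) →ₗ[ZMod 2] V)
    (h : ∀ a ∈ P, L (Finsupp.single a 1) ∈ Q) {c : α →₀ ZMod 2} (hc : c ∈ spt P) : L c ∈ Q := by
  rw [spt, Finsupp.supported_eq_span_single] at hc
  have : Submodule.span (ZMod 2) ((fun i ↦ Finsupp.single i 1) '' P) ≤ Q.comap L := by
    rw [Submodule.span_le]
    rintro _ ⟨a, ha, rfl⟩
    exact h a ha
  exact this hc

lemma single_mem_spt {α : Type} {P : Set α} {a : α} (ha : a ∈ P) (r : ZMod 2) :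
    Finsupp.single a r ∈ spt P :=
  Finsupp.single_mem_supported _ _ ha

lemma abd_mem_spt {N k : ℕ} {P : Set (Fin (k + 2) → Δ N)} {Q : Set (Fin (k + 1) → Δ N)}
    (h : ∀ v ∈ P, ∀ i : Fin (k + 2), v ∘ i.succAbove ∈ Q) {c : ACh (k + 1) N} (hc : c ∈ spt P) :
    abd k c ∈ spt Q :=
  map_mem_of_mem_spt _ (fun v hv ↦ by
    rw [abd_single]
    exact Submodule.sum_mem _ fun i _ ↦ single_mem_spt (h v hv i) _) hc

lemma cone_mem_spt {N k : ℕ} {P : Set (Fin (k + 1) → Δ N)} {Q : Set (Fin (k + 2) → Δ N)} (b : Δ N)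
    (h : ∀ v ∈ P, (Fin.cons b v : Fin (k + 2) → Δ N) ∈ Q) {c : ACh k N} (hc : c ∈ spt P) :
    cone b k c ∈ spt Q :=
  map_mem_of_mem_spt _ (fun v hv ↦ by
    rw [cone_single]
    exact single_mem_spt (h v hv) _) hc

/-- Every new vertex is a barycenter of old ones. It is applied to closed balls. -/
lemma asd_mem_spt {N : ℕ} {C : Set (Δ N)}
    (hC : ∀ (k : ℕ) (v : Fin (k + 1) → Δ N), (∀ i, v i ∈ C) → bary v ∈ C) (k : ℕ)
    {c : ACh k N} (hc : c ∈ spt {v | ∀ i, v i ∈ C}) : asd k c ∈ spt {v | ∀ i, v i ∈ C} := by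
  induction k with
  | zero => exact hc
  | succ k ih =>
    refine map_mem_of_mem_spt _ (fun v hv ↦ ?_) hc
    rw [asd_single]
    refine cone_mem_spt (P := {v | ∀ i, v i ∈ C}) _ (fun w hw i ↦ ?_)
      (ih (abd_mem_spt (P := {v | ∀ i, v i ∈ C}) (Q := {v | ∀ i, v i ∈ C}) (fun w hw i j ↦ hw _) (single_mem_spt hv _)))
    refine Fin.cases ?_ (fun j ↦ ?_) i
    · exact hC _ v hv
    · exact hw j

lemma dist_comb_le {k N : ℕ} (v : Fin (k + 1) → Δ N) (t : Δ k) (x : Δ N) {r : Fin (k + 1) → ℝ}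
    (h : ∀ i, dist x (v i) ≤ r i) : dist x (comb v t) ≤ ∑ i, t i * r i := by
  have hr (i) : 0 ≤ r i := dist_nonneg.trans (h i)
  have h0 : 0 ≤ ∑ i, t i * r i := Finset.sum_nonneg fun i _ ↦ mul_nonneg (t.2.1 i) (hr i)
  rw [Subtype.dist_eq, dist_pi_le_iff h0]
  intro j
  have h2 (i) : |x j - v i j| ≤ r i := by
    refine le_trans ?_ (h i)
    rw [Subtype.dist_eq, ← Real.dist_eq]
    exact dist_le_pi_dist x.1 (v i).1 j
  have h1 : x j - comb v t j = ∑ i, t i * (x j - v i j) := by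
    simp only [mul_sub, Finset.sum_sub_distrib, ← Finset.sum_mul, stdSimplex.sum_eq_one, one_mul,
      comb_apply]
  rw [Real.dist_eq]
  change |x j - comb v t j| ≤ _
  rw [h1]
  refine (Finset.abs_sum_le_sum_abs _ _).trans (Finset.sum_le_sum fun i _ ↦ ?_)
  rw [abs_mul, abs_of_nonneg (stdSimplex.zero_le t i)]
  exact mul_le_mul_of_nonneg_left (h2 i) (t.2.1 i)

lemma bary_mem_closedBall {N k : ℕ} (x : Δ N) (r : ℝ) (v : Fin (k + 1) → Δ N)
    (h : ∀ i, v i ∈ {z | dist x z ≤ r}) : bary v ∈ {z | dist x z ≤ r} := by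
  have := dist_comb_le v (center k) x (r := fun _ ↦ r) h
  rwa [← Finset.sum_mul, stdSimplex.sum_eq_one, one_mul] at this

/-- The vertex is at distance 0 from itself, so only k of the k + 1 equal weights contribute; this
is the source of the contraction factor. -/
lemma dist_bary_le {N k : ℕ} (v : Fin (k + 1) → Δ N) {D : ℝ} (h : ∀ i j, dist (v i) (v j) ≤ D)
    (i : Fin (k + 1)) : dist (v i) (bary v) ≤ k / (k + 1) * D := by
  have hc (j : Fin (k + 1)) : center k j = ((k : ℝ) + 1)⁻¹ := rfl
  refine (dist_comb_le v (center k) (v i) (r := fun j ↦ if j = i then 0 else D) fun j ↦ ?_).trans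
    (le_of_eq ?_)
  · split_ifs with hj
    · rw [hj, dist_self]
    · exact h i j
  · simp only [hc, ← Finset.mul_sum]
    rw [Finset.sum_ite, Finset.sum_const_zero, Finset.sum_const, zero_add,
      Finset.filter_ne' Finset.univ i, Finset.card_erase_of_mem (Finset.mem_univ i)]
    simp
    ring

/-- A simplex of the subdivision is a cone from the barycenter. Edges of its base are bounded by
induction with the smaller factor k/(k+1); edges at the apex are bounded by `dist_bary_le`, since a
ball about the apex containing all original vertices is closed under taking barycenters. -/
lemma asd_mem_spt_dist {N : ℕ} (k : ℕ) {D : ℝ} (hD : 0 ≤ D) {c : ACh k N}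
    (hc : c ∈ spt {v | ∀ i j, dist (v i) (v j) ≤ D}) :
    asd k c ∈ spt {v | ∀ i j, dist (v i) (v j) ≤ k / (k + 1) * D} := by
  induction k with
  | zero =>
    refine map_mem_of_mem_spt _ (fun v _ ↦ single_mem_spt (fun i j ↦ ?_) _) hc
    rw [Subsingleton.elim (α := Fin 1) i j, dist_self]
    simp
  | succ k ih =>
    refine map_mem_of_mem_spt _ (fun v hv ↦ ?_) hc
    rw [asd_single]
    set r : ℝ := (k + 1 : ℕ) / ((k + 1 : ℕ) + 1) * D with hr
    have hr0 : 0 ≤ r := by positivity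
    have h1 := ih (abd_mem_spt (P := {v | ∀ i j, dist (v i) (v j) ≤ D})
      (Q := {v | ∀ i j, dist (v i) (v j) ≤ D})
      (fun w hw i j l ↦ hw _ _) (single_mem_spt hv 1))
    have h2 : asd k (abd k (Finsupp.single v 1)) ∈ spt {w | ∀ i, w i ∈ {z | dist (bary v) z ≤ r}} := by
      refine asd_mem_spt (fun k v h ↦ bary_mem_closedBall _ _ v h) k ?_
      rw [abd_single]
      refine Submodule.sum_mem _ fun i _ ↦ single_mem_spt (fun j ↦ ?_) _
      change dist (bary v) (v (i.succAbove j)) ≤ r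
      rw [dist_comm]
      exact dist_bary_le v hv _
    have h3 : asd k (abd k (Finsupp.single v 1)) ∈
        spt ({w | ∀ i j, dist (w i) (w j) ≤ k / (k + 1) * D} ∩
          {w | ∀ i, w i ∈ {z | dist (bary v) z ≤ r}}) := by
      rw [spt, Finsupp.supported_inter]
      exact ⟨h1, h2⟩
    refine cone_mem_spt _ (fun w hw i j ↦ ?_) h3
    have hle : (k : ℝ) / (k + 1) * D ≤ r := by
      refine mul_le_mul_of_nonneg_right ?_ hD
      rw [div_le_div_iff₀ (by positivity) (by positivity)]
      push_cast
      nlinarith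
    refine Fin.cases ?_ (fun i ↦ ?_) i <;> refine Fin.cases ?_ (fun j ↦ ?_) j
    · simpa using hr0
    · exact hw.2 j
    · rw [dist_comm]
      exact hw.2 i
    · exact (hw.1 i j).trans hle

end SingChain
end

noncomputable section

namespace SingChain

variable {X Y W : Type} [TopologicalSpace X] [TopologicalSpace Y] [TopologicalSpace W]

/-! ### Barycentric subdivision of singular chains -/

/-- The singular chain of an affine chain. -/
def real {N : ℕ} (k : ℕ) : ACh k N →ₗ[ZMod 2] Ch k (Δ N) :=
  Finsupp.lmapDomain _ _ comb

lemma real_single {N : ℕ} (k : ℕ) (v : Fin (k + 1) → Δ N) (r : ZMod 2) :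
    real k (Finsupp.single v r) = Finsupp.single (comb v) r := by
  simp [real, Finsupp.mapDomain_single]

lemma bd_real {N : ℕ} (k : ℕ) (c : ACh (k + 1) N) : bd k (real (k + 1) c) = real k (abd k c) := by
  have : bd k ∘ₗ real (k + 1) = real k ∘ₗ abd (N := N) k := by
    ext v : 1
    ext1
    simp [real_single, abd_single, comb_face]
  exact LinearMap.congr_fun this c

lemma push_comb_real {M N : ℕ} (k : ℕ) (w : Fin (M + 1) → Δ N) (c : ACh k M) :
    push k (comb w) (real k c) = real k (amap k (comb w) c) := by
  have : push k (comb w) ∘ₗ real k = real k ∘ₗ amap k (comb w) := by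
    ext v : 1
    ext1
    simp only [LinearMap.comp_apply, Finsupp.lsingle_apply, amap_single, real_single, push_single]
    congr 1
    ext1 t
    exact comb_comb w v t
  exact LinearMap.congr_fun this c

/-- The fundamental affine simplex. -/
def fund (n : ℕ) : ACh n n := Finsupp.single (vert n) 1

lemma amap_fund {k N : ℕ} (v : Fin (k + 1) → Δ N) :
    amap k (comb v) (fund k) = Finsupp.single v 1 := by
  rw [fund, amap_single]
  congr 1
  ext1 i
  exact comb_vertex v i

/-- Every singular simplex is the image of the fundamental affine one, so natural identities need
checking only on affine chains. -/
lemma push_real_fund (n : ℕ) (σ : Smp n X) :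
    push n σ (real n (fund n)) = Finsupp.single σ 1 := by
  rw [fund, real_single, push_single, comb_vert, ContinuousMap.comp_id]

/-- Barycentric subdivision of singular chains. -/
def sd (n : ℕ) : Ch n X →ₗ[ZMod 2] Ch n X :=
  Finsupp.linearCombination (ZMod 2) fun σ ↦ push n σ (real n (asd n (fund n)))

/-- The homotopy between barycentric subdivision and the identity. -/
def th (n : ℕ) : Ch n X →ₗ[ZMod 2] Ch (n + 1) X :=
  Finsupp.linearCombination (ZMod 2) fun σ ↦ push (n + 1) σ (real (n + 1) (ath n (fund n)))

lemma sd_single (n : ℕ) (σ : Smp n X) :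
    sd n (Finsupp.single σ 1) = push n σ (real n (asd n (fund n))) := by
  simp [sd]

lemma th_single (n : ℕ) (σ : Smp n X) :
    th n (Finsupp.single σ 1) = push (n + 1) σ (real (n + 1) (ath n (fund n))) := by
  simp [th]

lemma sd_push (n : ℕ) (f : C(X, Y)) (c : Ch n X) : sd n (push n f c) = push n f (sd n c) := by
  have : sd n ∘ₗ push n f = push n f ∘ₗ sd n := by
    ext σ : 1
    ext1
    simp [sd_single, push_push]
  exact LinearMap.congr_fun this c

lemma th_push (n : ℕ) (f : C(X, Y)) (c : Ch n X) : th n (push n f c) = push (n + 1) f (th n c) := by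
  have : th n ∘ₗ push n f = push (n + 1) f ∘ₗ th n := by
    ext σ : 1
    ext1
    simp [th_single, push_push]
  exact LinearMap.congr_fun this c

lemma sd_real {N : ℕ} (n : ℕ) (c : ACh n N) : sd n (real n c) = real n (asd n c) := by
  have : sd n ∘ₗ real n = real n ∘ₗ asd (N := N) n := by
    ext v : 1
    ext1
    simp only [LinearMap.comp_apply, Finsupp.lsingle_apply, real_single, sd_single]
    rw [push_comb_real, amap_asd, amap_fund]
  exact LinearMap.congr_fun this c

lemma th_real {N : ℕ} (n : ℕ) (c : ACh n N) : th n (real n c) = real (n + 1) (ath n c) := by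
  have : th n ∘ₗ real n = real (n + 1) ∘ₗ ath (N := N) n := by
    ext v : 1
    ext1
    simp only [LinearMap.comp_apply, Finsupp.lsingle_apply, real_single, th_single]
    rw [push_comb_real, amap_ath, amap_fund]
  exact LinearMap.congr_fun this c

lemma bd_sd (n : ℕ) (c : Ch (n + 1) X) : bd n (sd (n + 1) c) = sd n (bd n c) := by
  have : bd n ∘ₗ sd (n + 1) = sd n ∘ₗ bd (X := X) n := by
    ext σ : 1
    ext1
    simp only [LinearMap.comp_apply, Finsupp.lsingle_apply]
    rw [← push_real_fund, sd_push, bd_push, bd_push, sd_push, sd_real, bd_real, bd_real, sd_real,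
      abd_asd]
  exact LinearMap.congr_fun this c

lemma bd_th (n : ℕ) (c : Ch (n + 1) X) :
    bd (n + 1) (th (n + 1) c) + th n (bd n c) = c + sd (n + 1) c := by
  have : bd (n + 1) ∘ₗ th (n + 1) + th n ∘ₗ bd (X := X) n = LinearMap.id + sd (n + 1) := by
    ext σ : 1
    ext1
    simp only [LinearMap.comp_apply, Finsupp.lsingle_apply, LinearMap.add_apply, LinearMap.id_apply]
    rw [← push_real_fund, sd_push, bd_push, th_push, bd_push, th_push, sd_real, bd_real, th_real,
      th_real, bd_real, ← map_add, ← map_add, abd_ath, map_add, map_add]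
  exact LinearMap.congr_fun this c

/-- Iterated barycentric subdivision. -/
def sdIter (n : ℕ) : ℕ → Ch n X →ₗ[ZMod 2] Ch n X
  | 0 => LinearMap.id
  | m + 1 => sdIter n m ∘ₗ sd n

/-- The homotopy between iterated barycentric subdivision and the identity. -/
def thIter (n : ℕ) : ℕ → Ch n X →ₗ[ZMod 2] Ch (n + 1) X
  | 0 => 0
  | m + 1 => th n + thIter n m ∘ₗ sd n

lemma bd_sdIter (n m : ℕ) (c : Ch (n + 1) X) :
    bd n (sdIter (n + 1) m c) = sdIter n m (bd n c) := by
  induction m generalizing c with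
  | zero => rfl
  | succ m ih =>
    change bd n (sdIter (n + 1) m (sd (n + 1) c)) = sdIter n m (sd n (bd n c))
    rw [ih, bd_sd]

lemma bd_thIter (n m : ℕ) (c : Ch (n + 1) X) :
    bd (n + 1) (thIter (n + 1) m c) + thIter n m (bd n c) = c + sdIter (n + 1) m c := by
  induction m generalizing c with
  | zero =>
    change bd (n + 1) 0 + 0 = c + c
    rw [map_zero, add_zero, add_self_eq_zero']
  | succ m ih =>
    change bd (n + 1) (th (n + 1) c + thIter (n + 1) m (sd (n + 1) c)) +
      (th n (bd n c) + thIter n m (sd n (bd n c))) = c + sdIter (n + 1) m (sd (n + 1) c)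
    rw [map_add, add_add_add_comm, bd_th, ← bd_sd, ih, add_assoc, ← add_assoc (sd (n + 1) c),
      add_self_eq_zero', zero_add]

/-- The chains in a subset. -/
def sub (n : ℕ) (A : Set X) : Submodule (ZMod 2) (Ch n X) :=
  spt {σ : Smp n X | range σ ⊆ A}

lemma single_mem_sub {n : ℕ} {A : Set X} {σ : Smp n X} (h : range σ ⊆ A) (r : ZMod 2) :
    Finsupp.single σ r ∈ sub n A := single_mem_spt h r

lemma push_mem_sub {n : ℕ} {A : Set Y} (f : C(X, Y)) (h : range f ⊆ A) (c : Ch n X) :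
    push n f c ∈ sub n A := by
  refine map_mem_of_mem_spt (P := univ) (push n f) (fun σ _ ↦ ?_)
    (by rw [spt, Finsupp.supported_univ]; trivial)
  rw [push_single]
  refine single_mem_sub ?_ _
  rintro _ ⟨t, rfl⟩
  exact h ⟨σ t, rfl⟩

lemma bd_mem_sub {n : ℕ} {A : Set X} {c : Ch (n + 1) X} (hc : c ∈ sub (n + 1) A) :
    bd n c ∈ sub n A :=
  map_mem_of_mem_spt _ (fun σ hσ ↦ by
    rw [bd_single]
    exact Submodule.sum_mem _ fun i _ ↦ single_mem_sub
      (by rintro _ ⟨t, rfl⟩; exact hσ ⟨_, rfl⟩) _) hc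

lemma sd_mem_sub {n : ℕ} {A : Set X} {c : Ch n X} (hc : c ∈ sub n A) : sd n c ∈ sub n A :=
  map_mem_of_mem_spt _ (fun σ hσ ↦ by
    rw [sd_single]
    exact push_mem_sub _ hσ _) hc

lemma th_mem_sub {n : ℕ} {A : Set X} {c : Ch n X} (hc : c ∈ sub n A) : th n c ∈ sub (n + 1) A :=
  map_mem_of_mem_spt _ (fun σ hσ ↦ by
    rw [th_single]
    exact push_mem_sub _ hσ _) hc

lemma sdIter_mem_sub {n : ℕ} (m : ℕ) {A : Set X} {c : Ch n X} (hc : c ∈ sub n A) :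
    sdIter n m c ∈ sub n A := by
  induction m generalizing c with
  | zero => exact hc
  | succ m ih => exact ih (sd_mem_sub hc)

lemma thIter_mem_sub {n : ℕ} (m : ℕ) {A : Set X} {c : Ch n X} (hc : c ∈ sub n A) :
    thIter n m c ∈ sub (n + 1) A := by
  induction m generalizing c with
  | zero => exact Submodule.zero_mem _
  | succ m ih => exact Submodule.add_mem _ (th_mem_sub hc) (ih (sd_mem_sub hc))

lemma sub_inter (n : ℕ) (A B : Set X) : sub n (A ∩ B) = sub n A ⊓ sub n B := by
  rw [sub, sub, sub, ← Finsupp.supported_inter]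
  congr 1
  ext σ
  exact subset_inter_iff

lemma sdIter_push (n m : ℕ) (f : C(X, Y)) (c : Ch n X) :
    sdIter n m (push n f c) = push n f (sdIter n m c) := by
  induction m generalizing c with
  | zero => rfl
  | succ m ih =>
    change sdIter n m (sd n (push n f c)) = push n f (sdIter n m (sd n c))
    rw [sd_push, ih]

lemma sdIter_add (n l m : ℕ) (c : Ch n X) : sdIter n (l + m) c = sdIter n l (sdIter n m c) := by
  induction m generalizing c with
  | zero => rfl
  | succ m ih => exact ih (sd n c)

/-- The trailing factor 1 bounds the initial diameter: coordinates lie in [0, 1] and the metric is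
the sup metric. -/
lemma sdIter_real_fund_mem (n m : ℕ) :
    sdIter n m (real n (fund n)) ∈ (spt {v : Fin (n + 1) → Δ n |
      ∀ i j, dist (v i) (v j) ≤ ((n : ℝ) / (n + 1)) ^ m * 1}).map (real n) := by
  have key (m : ℕ) (D : ℝ) (hD : 0 ≤ D) (c : ACh n n) 
      (hc : c ∈ spt {v | ∀ i j, dist (v i) (v j) ≤ D}) : sdIter n m (real n c) ∈
      (spt {v : Fin (n + 1) → Δ n |
        ∀ i j, dist (v i) (v j) ≤ ((n : ℝ) / (n + 1)) ^ m * D}).map (real n) := by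
    induction m generalizing c D with
    | zero => exact ⟨c, by simpa using hc, rfl⟩
    | succ m ih =>
      change sdIter n m (sd n (real n c)) ∈ _
      rw [sd_real, pow_succ, mul_assoc]
      exact ih _ (by positivity) _ (asd_mem_spt_dist n hD hc)
  refine key m 1 zero_le_one _ (single_mem_spt (fun i j ↦ ?_) _)
  rw [Subtype.dist_eq, dist_pi_le_iff zero_le_one]
  intro l
  rw [Real.dist_eq, abs_sub_le_iff]
  have h1 (i : Fin (n + 1)) := stdSimplex.zero_le (vert n i) l
  have h2 (i : Fin (n + 1)) := stdSimplex.le_one (vert n i) l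
  change vert n i l - vert n j l ≤ 1 ∧ vert n j l - vert n i l ≤ 1
  constructor <;> linarith [h1 i, h1 j, h2 i, h2 j]

/-- For one simplex, subdivide until the diameters fall below a Lebesgue number of the pulled-back
cover. -/
lemma exists_sdIter_mem {A B : Set X} (hA : IsOpen A) (hB : IsOpen B) (hAB : A ∪ B = univ)
    (n : ℕ) (c : Ch n X) : ∃ m, sdIter n m c ∈ sub n A ⊔ sub n B := by
  have mono (l : ℕ) (c : Ch n X) (hc : c ∈ sub n A ⊔ sub n B) :
      sdIter n l c ∈ sub n A ⊔ sub n B := by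
    obtain ⟨a, ha, b, hb, rfl⟩ := Submodule.mem_sup.1 hc
    rw [map_add]
    exact Submodule.add_mem_sup (sdIter_mem_sub l ha) (sdIter_mem_sub l hb)
  induction c using Finsupp.induction_linear with
  | zero => exact ⟨0, Submodule.zero_mem _⟩
  | add f g hf hg =>
    obtain ⟨m, hm⟩ := hf
    obtain ⟨l, hl⟩ := hg
    -- Small chains stay small under further subdivision, so the two exponents may be added.
    refine ⟨l + m, ?_⟩
    rw [map_add]
    refine Submodule.add_mem _ ?_ ?_
    · rw [sdIter_add]
      exact mono _ _ hm
    · rw [add_comm, sdIter_add]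
      exact mono _ _ hl
  | single σ r =>
    obtain ⟨δ, hδ, hleb⟩ := lebesgue_number_lemma_of_metric (s := (univ : Set (Δ n)))
      (c := fun b : Bool ↦ σ ⁻¹' (if b then A else B)) isCompact_univ
      (fun b ↦ (by cases b <;> simpa : IsOpen (if b then A else B)).preimage σ.continuous)
      (fun x _ ↦ by
        have : σ x ∈ A ∪ B := hAB ▸ mem_univ _
        rcases this with h | h
        · exact mem_iUnion.2 ⟨true, by simpa using h⟩
        · exact mem_iUnion.2 ⟨false, by simpa using h⟩)
    obtain ⟨m, hm⟩ := exists_pow_lt_of_lt_one hδ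
      (show (n : ℝ) / (n + 1) < 1 by rw [div_lt_one (by positivity)]; linarith)
    refine ⟨m, ?_⟩
    have hr : Finsupp.single σ r = r • Finsupp.single σ (1 : ZMod 2) := by simp
    rw [hr, map_smul]
    refine Submodule.smul_mem _ _ ?_
    rw [← push_real_fund, sdIter_push]
    obtain ⟨e, he, hee⟩ := sdIter_real_fund_mem n m
    rw [← hee]
    refine map_mem_of_mem_spt (push n σ ∘ₗ real n) (fun v hv ↦ ?_) he
    rw [LinearMap.comp_apply, real_single, push_single]
    obtain ⟨b, hb⟩ := hleb (v 0) trivial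
    have hsub : range (σ.comp (comb v)) ⊆ if b then A else B := by
      rintro _ ⟨t, rfl⟩
      refine hb ?_
      rw [mem_ball, dist_comm]
      have := dist_comb_le v t (v 0) (fun i ↦ hv 0 i)
      rw [← Finset.sum_mul, stdSimplex.sum_eq_one, one_mul, mul_one] at this
      exact this.trans_lt hm
    cases b with
    | true => exact Submodule.mem_sup_left (single_mem_sub (by simpa using hsub) _)
    | false => exact Submodule.mem_sup_right (single_mem_sub (by simpa using hsub) _)

end SingChain
end

noncomputable section

namespace SingChain

variable {X Y W : Type} [TopologicalSpace X] [TopologicalSpace Y] [TopologicalSpace W]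

/-! ### Dimensions of subquotients -/

section Subquotient

variable {V₁ V₂ : Type} [AddCommGroup V₁] [Module (ZMod 2) V₁] [AddCommGroup V₂] [Module (ZMod 2) V₂]

lemma rank_quotient_ker {V M : Type} [AddCommGroup V] [Module (ZMod 2) V] [AddCommGroup M]
    [Module (ZMod 2) M] (f : V →ₗ[ZMod 2] M) (hf : Function.Surjective f) (K : Submodule (ZMod 2) V)
    (hK : ∀ v, v ∈ K ↔ f v = 0) : Module.rank (ZMod 2) (V ⧸ K) = Module.rank (ZMod 2) M := by
  obtain rfl : K = LinearMap.ker f := by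
    ext v
    rw [hK, LinearMap.mem_ker]
  exact (f.quotKerEquivOfSurjective hf).rank_eq

lemma mk_eq_zero_iff {P Q : Submodule (ZMod 2) V₁} (v : P) :
    (Q.submoduleOf P).mkQ v = 0 ↔ (v : V₁) ∈ Q := by
  rw [Submodule.mkQ_apply, Submodule.Quotient.mk_eq_zero, Submodule.submoduleOf,
    Submodule.mem_comap, Submodule.subtype_apply]

/-- Subquotients matched by a linear relation have the same dimension. -/
lemma qrank_eq_of_rel {P₁ Q₁ : Submodule (ZMod 2) V₁} {P₂ Q₂ : Submodule (ZMod 2) V₂}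
    (R : Submodule (ZMod 2) (V₁ × V₂)) (h1 : ∀ z w, (z, w) ∈ R → z ∈ P₁ ∧ w ∈ P₂)
    (hl : ∀ z ∈ P₁, ∃ w, (z, w) ∈ R) (hr : ∀ w ∈ P₂, ∃ z, (z, w) ∈ R)
    (hQ : ∀ z w, (z, w) ∈ R → (z ∈ Q₁ ↔ w ∈ Q₂)) : qrank P₁ Q₁ = qrank P₂ Q₂ := by
  let f₁ : R →ₗ[ZMod 2] (P₁ ⧸ Q₁.submoduleOf P₁) := (Q₁.submoduleOf P₁).mkQ ∘ₗ
    (LinearMap.codRestrict P₁ (LinearMap.fst _ _ _ ∘ₗ R.subtype) fun c ↦ (h1 _ _ c.2).1)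
  let f₂ : R →ₗ[ZMod 2] (P₂ ⧸ Q₂.submoduleOf P₂) := (Q₂.submoduleOf P₂).mkQ ∘ₗ
    (LinearMap.codRestrict P₂ (LinearMap.snd _ _ _ ∘ₗ R.subtype) fun c ↦ (h1 _ _ c.2).2)
  have hs1 : Function.Surjective f₁ := by
    refine (Submodule.mkQ_surjective _).comp fun z ↦ ?_
    obtain ⟨w, hw⟩ := hl z z.2
    exact ⟨⟨_, hw⟩, rfl⟩
  have hs2 : Function.Surjective f₂ := by
    refine (Submodule.mkQ_surjective _).comp fun w ↦ ?_
    obtain ⟨z, hz⟩ := hr w w.2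
    exact ⟨⟨_, hz⟩, rfl⟩
  rw [qrank, qrank, ← rank_quotient_ker f₁ hs1 (LinearMap.ker f₁) fun v ↦ Iff.rfl]
  refine rank_quotient_ker f₂ hs2 (LinearMap.ker f₁) fun v ↦ ?_
  rw [LinearMap.mem_ker]
  have e1 : f₁ v = 0 ↔ v.1.1 ∈ Q₁ := mk_eq_zero_iff (P := P₁) ⟨v.1.1, (h1 _ _ v.2).1⟩
  have e2 : f₂ v = 0 ↔ v.1.2 ∈ Q₂ := mk_eq_zero_iff (P := P₂) ⟨v.1.2, (h1 _ _ v.2).2⟩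
  exact e1.trans ((hQ _ _ v.2).trans e2.symm)

/-- Rank–nullity for the surjection induced on subquotients. -/
lemma qrank_eq_add {P₁ Q₁ : Submodule (ZMod 2) V₁} {P₂ Q₂ : Submodule (ZMod 2) V₂}
    (L : V₁ →ₗ[ZMod 2] V₂) (hP : ∀ z ∈ P₁, L z ∈ P₂) (hQ : ∀ z ∈ Q₁, L z ∈ Q₂)
    (hs : ∀ w ∈ P₂, ∃ z ∈ P₁, L z = w) :
    qrank P₁ Q₁ = qrank P₂ Q₂ + qrank (P₁ ⊓ Q₂.comap L) Q₁ := by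
  let f₀ : P₁ →ₗ[ZMod 2] (P₂ ⧸ Q₂.submoduleOf P₂) :=
    (Q₂.submoduleOf P₂).mkQ ∘ₗ (L.restrict hP)
  have hf₀ (v : P₁) : f₀ v = 0 ↔ L v ∈ Q₂ := mk_eq_zero_iff _
  let f : (P₁ ⧸ Q₁.submoduleOf P₁) →ₗ[ZMod 2] (P₂ ⧸ Q₂.submoduleOf P₂) :=
    Submodule.liftQ _ f₀ fun v hv ↦ (hf₀ v).2 (hQ _ hv)
  have hf (v : P₁) : f ((Q₁.submoduleOf P₁).mkQ v) = f₀ v := Submodule.liftQ_apply _ _ _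
  have hsurj : Function.Surjective f := by
    intro w
    obtain ⟨w, rfl⟩ := Submodule.mkQ_surjective _ w
    obtain ⟨z, hz, hzw⟩ := hs w w.2
    refine ⟨(Q₁.submoduleOf P₁).mkQ ⟨z, hz⟩, ?_⟩
    rw [hf]
    exact congrArg (Q₂.submoduleOf P₂).mkQ (Subtype.ext hzw : L.restrict hP ⟨z, hz⟩ = w)
  rw [qrank, f.rank_eq_of_surjective hsurj]
  congr 1
  let g : ↥(P₁ ⊓ Q₂.comap L) →ₗ[ZMod 2] LinearMap.ker f :=
    LinearMap.codRestrict _ ((Q₁.submoduleOf P₁).mkQ ∘ₗ Submodule.inclusion inf_le_left) fun v ↦ by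
      rw [LinearMap.mem_ker, LinearMap.comp_apply, hf, hf₀]
      exact v.2.2
  refine (rank_quotient_ker g ?_ _ fun v ↦ ?_).symm
  · rintro ⟨w, hw⟩
    obtain ⟨w, rfl⟩ := Submodule.mkQ_surjective _ w
    rw [LinearMap.mem_ker, hf, hf₀] at hw
    exact ⟨⟨w, w.2, hw⟩, rfl⟩
  · rw [Subtype.ext_iff]
    exact (mk_eq_zero_iff (P := P₁) (Q := Q₁) ⟨v.1, v.2.1⟩).symm

end Subquotient

/-! ### The kernel in homology of a map with a section -/

/-- The cycles which become boundaries under `p`. -/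
def ZK (p : C(Y, X)) (n : ℕ) : Submodule (ZMod 2) (Ch n Y) := Z Y n ⊓ (B X n).comap (push n p)

/-- The dimension of the kernel of the map induced by `p` in homology. -/
def rkK (p : C(Y, X)) (n : ℕ) : Cardinal := qrank (ZK p n) (B Y n)

/-- The section makes p surjective on cycles. The kernel plays the part of reduced homology relative
to X. -/
lemma rank_eq_add_rkK (p : C(Y, X)) (s : C(X, Y)) (hps : p.comp s = ContinuousMap.id X) (n : ℕ) :
    qrank (Z Y n) (B Y n) = qrank (Z X n) (B X n) + rkK p n :=
  qrank_eq_add (push n p) (fun _ h ↦ push_mem_Z p h) (fun _ h ↦ push_mem_B p h) fun w hw ↦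
    ⟨push n s w, push_mem_Z s hw, by rw [push_push, hps, push_id]⟩

lemma push_sub_push_mem_B {f g : C(X, Y)} (h : f.Homotopic g) {n : ℕ} {c : Ch n X}
    (hc : c ∈ Z X n) : push n f c - push n g c ∈ B Y n := by
  have := push_add_push_mem_B h hc
  rwa [eq_neg_of_add_eq_zero_right (add_self_eq_zero' (push n g c)), ← sub_eq_add_neg] at this

/-- The two kernels are matched by the relation "the image of z under f is homologous to w". The
maps must lie over X, but the homotopies need not. -/
lemma rkK_eq_of_homotopyEquiv (p : C(Y, X)) (q : C(W, X)) (f : C(Y, W)) (g : C(W, Y))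
    (hf : q.comp f = p) (hg : p.comp g = q) (hgf : (g.comp f).Homotopic (ContinuousMap.id Y))
    (hfg : (f.comp g).Homotopic (ContinuousMap.id W)) (n : ℕ) : rkK p n = rkK q n := by
  let R : Submodule (ZMod 2) (Ch n Y × Ch n W) :=
    (ZK p n).prod (ZK q n) ⊓
      (B W n).comap (push n f ∘ₗ LinearMap.fst _ _ _ - LinearMap.snd _ _ _)
  have hR (z w) : (z, w) ∈ R ↔ (z ∈ ZK p n ∧ w ∈ ZK q n) ∧ push n f z - w ∈ B W n := Iff.rfl
  refine qrank_eq_of_rel R (fun z w h ↦ ((hR z w).1 h).1) (fun z hz ↦ ⟨push n f z, ?_⟩)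
    (fun w hw ↦ ⟨push n g w, ?_⟩) fun z w h ↦ ?_
  · refine (hR _ _).2 ⟨⟨hz, push_mem_Z f hz.1, ?_⟩, ?_⟩
    · rw [SetLike.mem_coe, Submodule.mem_comap, push_push, hf]
      exact hz.2
    · rw [sub_self]
      exact Submodule.zero_mem _
  · refine (hR _ _).2 ⟨⟨⟨push_mem_Z g hw.1, ?_⟩, hw⟩, ?_⟩
    · rw [SetLike.mem_coe, Submodule.mem_comap, push_push, hg]
      exact hw.2
    · have := push_sub_push_mem_B hfg hw.1
      rwa [push_id, ← push_push] at this
  · obtain ⟨⟨hz, hw⟩, h⟩ := (hR _ _).1 h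
    constructor
    · intro hzB
      exact (Submodule.sub_mem_iff_right _ (push_mem_B f hzB)).1 h
    · intro hwB
      have h1 := push_mem_B g ((Submodule.sub_mem_iff_left _ hwB).1 h)
      have h2 := push_sub_push_mem_B hgf hz.1
      rw [push_id, ← push_push] at h2
      exact (Submodule.sub_mem_iff_right _ h1).1 h2

/-! ### Chains in subsets -/

/-- The inclusion of a subset. -/
def incl (A : Set Y) : C(A, Y) := ⟨Subtype.val, continuous_subtype_val⟩

lemma push_incl_injective (A : Set Y) (n : ℕ) : Function.Injective (push n (incl A)) := by
  refine Finsupp.mapDomain_injective fun σ τ h ↦ ?_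
  ext1 t
  exact Subtype.ext (congrArg (fun φ : Smp n Y ↦ φ t) h)

lemma push_incl_mem_sub (A : Set Y) {n : ℕ} (c : Ch n A) : push n (incl A) c ∈ sub n A :=
  push_mem_sub _ (by rintro _ ⟨a, rfl⟩; exact a.2) c

lemma exists_push_incl {A : Set Y} {n : ℕ} {c : Ch n Y} (hc : c ∈ sub n A) :
    ∃ e : Ch n A, push n (incl A) e = c := by
  refine map_mem_of_mem_spt (Q := LinearMap.range (push n (incl A))) LinearMap.id
    (fun σ hσ ↦ ?_) hc
  refine ⟨Finsupp.single ⟨fun t ↦ ⟨σ t, hσ ⟨t, rfl⟩⟩, by fun_prop⟩ 1, ?_⟩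
  rw [push_single]
  rfl

lemma mem_Z_of_push_incl {A : Set Y} {n : ℕ} {c : Ch n A} (h : push n (incl A) c ∈ Z Y n) :
    c ∈ Z A n := by
  cases n with
  | zero => trivial
  | succ n =>
    refine push_incl_injective A n ?_
    rw [← bd_push, map_zero]
    exact h

/-- Cycles in `A` are homologous in `A` to their images under `r`. -/
def HomologousIn (A : Set Y) (r : C(Y, Y)) : Prop :=
  ∀ (n : ℕ), ∀ α ∈ Z Y n, α ∈ sub n A → ∃ e ∈ sub (n + 1) A, bd n e = α - push n r α

lemma homologousIn_of_homotopic (A : Set Y) (r : C(Y, Y)) (r' : C(A, A))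
    (hr : (incl A).comp r' = r.comp (incl A)) (h : (ContinuousMap.id A).Homotopic r') :
    HomologousIn A r := by
  intro n α hα hαA
  obtain ⟨c, rfl⟩ := exists_push_incl hαA
  obtain ⟨e, he⟩ := push_sub_push_mem_B h (mem_Z_of_push_incl hα)
  refine ⟨push (n + 1) (incl A) e, push_incl_mem_sub A e, ?_⟩
  rw [bd_push, he, map_sub, push_id, push_push, push_push, hr]

/-- The cycle is homologous in A to its image under s ∘ p, and the latter is filled by the image
under s of a filling in X, which also stays in A. -/
lemma HomologousIn.exists_bd_eq {A : Set Y} {p : C(Y, X)} {s : C(X, Y)}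
    (hA : HomologousIn A (s.comp p)) (hs : ∀ x, s x ∈ A) {n : ℕ} {α : Ch n Y} (h1 : α ∈ Z Y n)
    (h2 : α ∈ sub n A) (h3 : push n p α ∈ B X n) : ∃ e ∈ sub (n + 1) A, bd n e = α := by
  obtain ⟨e, he, hbd⟩ := hA n α h1 h2
  obtain ⟨x, hx⟩ := h3
  refine ⟨e + push (n + 1) s x, Submodule.add_mem _ he (push_mem_sub _ ?_ _), ?_⟩
  · rintro _ ⟨y, rfl⟩
    exact hs y
  · rw [map_add, hbd, bd_push, hx, push_push, sub_add_cancel]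

lemma exists_small {A A' : Set Y} (hA : IsOpen A) (hA' : IsOpen A') (hAA : A ∪ A' = univ)
    (n : ℕ) (c : Ch (n + 1) Y) : ∃ m, ∃ a ∈ sub (n + 1) A, ∃ b ∈ sub (n + 1) A',
      sdIter (n + 1) m c = a + b := by
  obtain ⟨m, hm⟩ := exists_sdIter_mem hA hA' hAA (n + 1) c
  obtain ⟨a, ha, b, hb, h⟩ := Submodule.mem_sup.1 hm
  exact ⟨m, a, ha, b, hb, h.symm⟩

lemma bd_thIter' (n m : ℕ) (c : Ch (n + 1) X) :
    bd (n + 1) (thIter (n + 1) m c) + thIter n m (bd n c) = c - sdIter (n + 1) m c := by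
  rw [bd_thIter, sub_eq_add_neg,
    ← eq_neg_of_add_eq_zero_right (add_self_eq_zero' (sdIter (n + 1) m c))]

/-- The suspension isomorphism for the kernels in homology. -/
lemma rkK_succ_eq (p : C(Y, X)) (s : C(X, Y)) (hps : p.comp s = ContinuousMap.id X) {A A' : Set Y}
    (hA : IsOpen A) (hA' : IsOpen A') (hAA : A ∪ A' = univ) (hs : ∀ x, s x ∈ A ∩ A')
    (hhA : HomologousIn A (s.comp p)) (hhA' : HomologousIn A' (s.comp p)) (n : ℕ) :
    rkK p (n + 1) = rkK (p.comp (incl (A ∩ A'))) n := by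
  set i := incl (A ∩ A') with hi
  -- The Mayer–Vietoris connecting map as a linear relation: z is homologous to a + b with a in A
  -- and b in A', and w is the boundary of a. A relation avoids choosing the decomposition.
  let R : Submodule (ZMod 2) (Ch (n + 1) Y × Ch n ↥(A ∩ A')) :=
    { carrier := {c | (c.1 ∈ ZK p (n + 1) ∧ c.2 ∈ ZK (p.comp i) n) ∧
        ∃ a ∈ sub (n + 1) A, ∃ b ∈ sub (n + 1) A', c.1 - (a + b) ∈ B Y (n + 1) ∧
          bd n a = push n i c.2}
      zero_mem' := ⟨⟨Submodule.zero_mem _, Submodule.zero_mem _⟩, 0, Submodule.zero_mem _, 0,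
        Submodule.zero_mem _, by simp, by simp⟩
      add_mem' := by
        rintro c c' ⟨⟨h1, h2⟩, a, ha, b, hb, h3, h4⟩ ⟨⟨h1', h2'⟩, a', ha', b', hb', h3', h4'⟩
        refine ⟨⟨Submodule.add_mem _ h1 h1', Submodule.add_mem _ h2 h2'⟩, a + a',
          Submodule.add_mem _ ha ha', b + b', Submodule.add_mem _ hb hb', ?_, ?_⟩
        · have := Submodule.add_mem _ h3 h3'
          convert this using 1
          simp only [Prod.fst_add]
          abel
        · rw [map_add, h4, h4', Prod.snd_add, map_add]
      smul_mem' := by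
        rintro t c ⟨⟨h1, h2⟩, a, ha, b, hb, h3, h4⟩
        refine ⟨⟨Submodule.smul_mem _ t h1, Submodule.smul_mem _ t h2⟩, t • a,
          Submodule.smul_mem _ t ha, t • b, Submodule.smul_mem _ t hb, ?_, ?_⟩
        · have := Submodule.smul_mem _ t h3
          rwa [smul_sub, smul_add] at this
        · rw [map_smul, h4, Prod.smul_snd, map_smul] }
  have hR (z w) : (z, w) ∈ R ↔ (z ∈ ZK p (n + 1) ∧ w ∈ ZK (p.comp i) n) ∧
        ∃ a ∈ sub (n + 1) A, ∃ b ∈ sub (n + 1) A', z - (a + b) ∈ B Y (n + 1) ∧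
          bd n a = push n i w := Iff.rfl
  have hspA (c : Ch (n + 1) Y) : push (n + 1) (s.comp p) c ∈ sub (n + 1) A :=
    push_mem_sub _ (by rintro _ ⟨y, rfl⟩; exact (hs _).1) c
  refine qrank_eq_of_rel R (fun z w h ↦ ((hR z w).1 h).1) (fun z hz ↦ ?_)
    (fun w hw ↦ ?_) fun z w h ↦ ?_
  · obtain ⟨m, a, ha, b, hb, hab⟩ := exists_small hA hA' hAA n z
    have hz0 : bd n z = 0 := hz.1
    -- The boundary of a is also a boundary of a chain in A', hence a chain in the intersection.
    have hbd : bd n a = - bd n b := by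
      rw [eq_neg_iff_add_eq_zero, ← map_add, ← hab, bd_sdIter, hz0, map_zero]
    have hmem : bd n a ∈ sub n (A ∩ A') := by
      rw [sub_inter]
      exact ⟨bd_mem_sub ha, hbd ▸ Submodule.neg_mem _ (bd_mem_sub hb)⟩
    obtain ⟨w, hw⟩ := exists_push_incl hmem
    refine ⟨w, (hR _ _).2 ⟨⟨hz, mem_Z_of_push_incl (hw ▸ bd_mem_Z _ _), ?_⟩, a, ha, b, hb, ?_,
      hw.symm⟩⟩
    · rw [SetLike.mem_coe, Submodule.mem_comap, ← push_push, hw, ← bd_push]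
      exact ⟨_, rfl⟩
    · have := bd_thIter' n m z
      rw [hz0, map_zero, add_zero, hab] at this
      exact ⟨_, this⟩
  · have hwZ : push n i w ∈ Z Y n := push_mem_Z i hw.1
    have hw2 : push n p (push n i w) ∈ B X n := by
      rw [push_push]
      exact hw.2
    have hwm : push n i w ∈ sub n A ⊓ sub n A' := by
      rw [← sub_inter]
      exact push_incl_mem_sub _ w
    obtain ⟨a, ha, hab⟩ := hhA.exists_bd_eq (fun x ↦ (hs x).1) hwZ hwm.1 hw2
    obtain ⟨b, hb, hbb⟩ := hhA'.exists_bd_eq (fun x ↦ (hs x).2) hwZ hwm.2 hw2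
    -- The two fillings glue to the cycle a - b. Subtracting its image under s ∘ p makes its
    -- projection to X vanish without changing the boundary of a.
    set a' := a - push (n + 1) (s.comp p) (a - b) with ha'
    have hba' : bd n a' = push n i w := by
      rw [ha', map_sub, bd_push, map_sub, hab, hbb, sub_self, map_zero, sub_zero]
    refine ⟨a' - b, (hR _ _).2 ⟨⟨⟨?_, ?_⟩, hw⟩, a', Submodule.sub_mem _ ha (hspA _), -b,
      Submodule.neg_mem _ hb, ?_, hba'⟩⟩
    · change bd n _ = 0
      rw [map_sub, hba', hbb, sub_self]
    · rw [SetLike.mem_coe, Submodule.mem_comap, ha']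
      have : push (n + 1) p (a - push (n + 1) (s.comp p) (a - b) - b) = 0 := by
        rw [map_sub, map_sub, push_push, ← ContinuousMap.comp_assoc, hps, ContinuousMap.id_comp,
          map_sub]
        abel
      rw [this]
      exact Submodule.zero_mem _
    · rw [← sub_eq_add_neg, sub_self]
      exact Submodule.zero_mem _
  · obtain ⟨⟨hz, hw⟩, a, ha, b, hb, hzab, hbda⟩ := (hR _ _).1 h
    constructor
    · intro hzB
      obtain ⟨y, hy⟩ : a + b ∈ B Y (n + 1) := (Submodule.sub_mem_iff_right _ hzB).1 hzab
      obtain ⟨m, a', ha', b', hb', hab'⟩ := exists_small hA hA' hAA (n + 1) y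
      have h1 := congrArg (bd (n + 1)) (bd_thIter' (n + 1) m y)
      rw [map_add, bd_bd, zero_add, hy, map_sub, hab', hy, map_add, map_add, map_add] at h1
      -- If a + b bounds y, subdividing y into a' + b' shows that this chain equals a chain of A' up
      -- to sign. So it lies in A ∩ A', and its boundary is still that of a.
      set u := a - bd (n + 1) a' - bd (n + 1) (thIter (n + 1) m a) with hu
      have hu' : u = -(b - bd (n + 1) b' - bd (n + 1) (thIter (n + 1) m b)) := by
        rw [hu, eq_neg_iff_add_eq_zero]
        rw [← sub_eq_zero, ← neg_eq_zero] at h1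
        rw [← h1]
        abel
      have hmem : u ∈ sub (n + 1) (A ∩ A') := by
        rw [sub_inter]
        refine ⟨?_, ?_⟩
        · exact Submodule.sub_mem _ (Submodule.sub_mem _ ha (bd_mem_sub ha'))
            (bd_mem_sub (thIter_mem_sub m ha))
        · rw [hu']
          exact Submodule.neg_mem _ (Submodule.sub_mem _ (Submodule.sub_mem _ hb (bd_mem_sub hb'))
            (bd_mem_sub (thIter_mem_sub m hb)))
      obtain ⟨v, hv⟩ := exists_push_incl hmem
      refine ⟨v, push_incl_injective _ n ?_⟩
      rw [← bd_push, hv, hu, map_sub, map_sub, bd_bd, bd_bd, sub_zero, sub_zero, hbda]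
    · rintro ⟨v, hv⟩
      have hvm : push (n + 1) i v ∈ sub (n + 1) A ⊓ sub (n + 1) A' := by
        rw [← sub_inter]
        exact push_incl_mem_sub _ v
      have hz0 : bd n z = 0 := hz.1
      have hbv : bd n (push (n + 1) i v) = bd n a := by rw [bd_push, hv, hbda]
      have hab : bd n a + bd n b = 0 := by
        obtain ⟨e, he⟩ := hzab
        have := congrArg (bd n) he
        rw [bd_bd, map_sub, hz0, zero_sub, map_add] at this
        exact neg_eq_zero.1 this.symm
      -- A filling v of w in A ∩ A' makes a - v and b + v cycles. Each is homologous to its image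
      -- under s ∘ p, and those images add up to a boundary since z is in the kernel.
      obtain ⟨e, -, he⟩ := hhA (n + 1) (a - push (n + 1) i v)
        (by change bd n _ = 0; rw [map_sub, hbv, sub_self]) (Submodule.sub_mem _ ha hvm.1)
      obtain ⟨e', -, he'⟩ := hhA' (n + 1) (b + push (n + 1) i v)
        (by change bd n _ = 0; rw [map_add, hbv, add_comm, hab]) (Submodule.add_mem _ hb hvm.2)
      have hsum : bd (n + 1) (e + e') = (a + b) - push (n + 1) (s.comp p) (a + b) := by
        rw [map_add, he, he', map_sub, map_add, map_add]
        abel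
      have h1 : push (n + 1) (s.comp p) z ∈ B Y (n + 1) := by
        rw [← push_push]
        exact push_mem_B s hz.2
      have h2 : push (n + 1) (s.comp p) (a + b) ∈ B Y (n + 1) := by
        have := push_mem_B (s.comp p) hzab
        rw [map_sub] at this
        exact (Submodule.sub_mem_iff_right _ h1).1 this
      have h3 : a + b ∈ B Y (n + 1) := by
        have : bd (n + 1) (e + e') ∈ B Y (n + 1) := ⟨_, rfl⟩
        rw [hsum] at this
        exact (Submodule.sub_mem_iff_left _ h2).1 this
      exact (Submodule.sub_mem_iff_left _ h3).1 hzab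

lemma qrank_eq_zero {V : Type} [AddCommGroup V] [Module (ZMod 2) V] {P Q : Submodule (ZMod 2) V}
    (h : P ≤ Q) : qrank P Q = 0 := by
  rw [qrank, Submodule.submoduleOf, Submodule.comap_subtype_eq_top.2 h]
  exact rank_subsingleton' _ _

lemma sub_sup_eq_top {A A' : Set Y} {n : ℕ} (h : ∀ σ : Smp n Y, range σ ⊆ A ∨ range σ ⊆ A') :
    sub n A ⊔ sub n A' = ⊤ := by
  rw [eq_top_iff]
  intro c _
  refine map_mem_of_mem_spt (P := univ) LinearMap.id (fun σ _ ↦ ?_)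
    (by rw [spt, Finsupp.supported_univ]; trivial : c ∈ _)
  rcases h σ with h | h
  · exact Submodule.mem_sup_left (single_mem_sub h _)
  · exact Submodule.mem_sup_right (single_mem_sub h _)

/-- A 0-simplex is a point, so it lies in A or A' without subdivision. Both sets retract
homologically to the same section, so z is homologous to its image under s ∘ p, a boundary. -/
lemma rkK_zero_eq (p : C(Y, X)) (s : C(X, Y)) {A A' : Set Y} (hAA : A ∪ A' = univ)
    (hhA : HomologousIn A (s.comp p)) (hhA' : HomologousIn A' (s.comp p)) : rkK p 0 = 0 := by
  refine qrank_eq_zero fun z hz ↦ ?_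
  have htop : sub 0 A ⊔ sub 0 A' = ⊤ := by
    refine sub_sup_eq_top fun σ ↦ ?_
    have hσ : range σ ⊆ {σ (center 0)} := by
      rintro _ ⟨t, rfl⟩
      rw [Subsingleton.elim (α := stdSimplex ℝ (Fin 1)) t (center 0)]
      exact mem_singleton _
    rcases hAA ▸ mem_univ (σ (center 0)) with h | h
    · exact Or.inl (hσ.trans (singleton_subset_iff.2 h))
    · exact Or.inr (hσ.trans (singleton_subset_iff.2 h))
  obtain ⟨a, ha, b, hb, rfl⟩ := Submodule.mem_sup.1 (htop ▸ Submodule.mem_top : z ∈ _)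
  obtain ⟨e, -, he⟩ := hhA 0 a trivial ha
  obtain ⟨e', -, he'⟩ := hhA' 0 b trivial hb
  have h1 : push 0 (s.comp p) (a + b) ∈ B Y 0 := by
    rw [← push_push]
    exact push_mem_B s hz.2
  have h2 : (a + b) - push 0 (s.comp p) (a + b) ∈ B Y 0 :=
    ⟨e + e', by rw [map_add, he, he', map_add]; abel⟩
  exact (Submodule.sub_mem_iff_left _ h1).1 h2

/-- Homologically Y is two copies of X, and the kernel of p is the antidiagonal: it is identified
with the homology of X by projecting the A-component of a cycle. Simplices are connected, so the
decomposition is exact. -/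
lemma rkK_eq_of_disjoint (p : C(Y, X)) (s s' : C(X, Y)) (hps : p.comp s = ContinuousMap.id X)
    (hps' : p.comp s' = ContinuousMap.id X) {A A' : Set Y} (hA : IsOpen A) (hA' : IsOpen A')
    (hAA : A ∪ A' = univ) (hdisj : A ∩ A' = ∅) (hs : ∀ x, s x ∈ A) (hs' : ∀ x, s' x ∈ A')
    (hhA : HomologousIn A (s.comp p)) (hhA' : HomologousIn A' (s'.comp p)) (n : ℕ) :
    rkK p n = qrank (Z X n) (B X n) := by
  have htop (n : ℕ) : sub n A ⊔ sub n A' = ⊤ := by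
    refine sub_sup_eq_top fun σ ↦ ?_
    exact (isPreconnected_range σ.continuous).subset_or_subset hA hA'
      (disjoint_iff_inter_eq_empty.2 hdisj) (hAA ▸ subset_univ _)
  have hbot (n : ℕ) (u : Ch n Y) (h1 : u ∈ sub n A) (h2 : u ∈ sub n A') : u = 0 := by
    have : u ∈ sub n (A ∩ A') := by
      rw [sub_inter]
      exact ⟨h1, h2⟩
    obtain ⟨e, rfl⟩ := exists_push_incl this
    have : IsEmpty ↥(A ∩ A') := by rw [hdisj]; infer_instance
    have : IsEmpty (Smp n ↥(A ∩ A')) := ⟨fun σ ↦ isEmptyElim (σ (center n))⟩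
    rw [Subsingleton.elim e 0, map_zero]
  have hZ (n : ℕ) (a b : Ch n Y) (ha : a ∈ sub n A) (hb : b ∈ sub n A') (h : a + b ∈ Z Y n) :
      a ∈ Z Y n ∧ b ∈ Z Y n := by
    cases n with
    | zero => exact ⟨trivial, trivial⟩
    | succ n =>
      have h0 : bd n a = - bd n b := by
        rw [eq_neg_iff_add_eq_zero, ← map_add]
        exact h
      have ha0 : bd n a = 0 :=
        hbot n _ (bd_mem_sub ha) (h0 ▸ Submodule.neg_mem _ (bd_mem_sub hb))
      exact ⟨ha0, by rwa [ha0, eq_comm, neg_eq_zero] at h0⟩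
  let R : Submodule (ZMod 2) (Ch n Y × Ch n X) :=
    { carrier := {c | c.1 ∈ ZK p n ∧ ∃ a ∈ sub n A, ∃ b ∈ sub n A', c.1 = a + b ∧
          push n p a = c.2}
      zero_mem' := ⟨Submodule.zero_mem _, 0, Submodule.zero_mem _, 0,
        Submodule.zero_mem _, by simp, by simp⟩
      add_mem' := by
        rintro c c' ⟨h1, a, ha, b, hb, h3, h4⟩ ⟨h1', a', ha', b', hb', h3', h4'⟩
        refine ⟨Submodule.add_mem _ h1 h1', a + a',
          Submodule.add_mem _ ha ha', b + b', Submodule.add_mem _ hb hb', ?_, ?_⟩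
        · rw [Prod.fst_add, h3, h3']
          abel
        · rw [map_add, h4, h4', Prod.snd_add]
      smul_mem' := by
        rintro t c ⟨h1, a, ha, b, hb, h3, h4⟩
        refine ⟨Submodule.smul_mem _ t h1, t • a,
          Submodule.smul_mem _ t ha, t • b, Submodule.smul_mem _ t hb, ?_, ?_⟩
        · rw [Prod.smul_fst, h3, smul_add]
        · rw [map_smul, h4, Prod.smul_snd] }
  have hR (z w) : (z, w) ∈ R ↔ z ∈ ZK p n ∧ ∃ a ∈ sub n A, ∃ b ∈ sub n A', z = a + b ∧
      push n p a = w := Iff.rfl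
  refine qrank_eq_of_rel R (fun z w h ↦ ?_) (fun z hz ↦ ?_) (fun w hw ↦ ?_) fun z w h ↦ ?_
  · obtain ⟨hz, a, ha, b, hb, rfl, rfl⟩ := (hR z w).1 h
    exact ⟨hz, push_mem_Z p (hZ n a b ha hb hz.1).1⟩
  · obtain ⟨a, ha, b, hb, rfl⟩ := Submodule.mem_sup.1 (htop n ▸ Submodule.mem_top : z ∈ _)
    exact ⟨push n p a, (hR _ _).2 ⟨hz, a, ha, b, hb, rfl, rfl⟩⟩
  -- The antidiagonal lift of w.
  · refine ⟨push n s w + - push n s' w, (hR _ _).2 ⟨⟨?_, ?_⟩, push n s w, ?_, - push n s' w, ?_,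
      rfl, ?_⟩⟩
    · exact Submodule.add_mem _ (push_mem_Z s hw) (Submodule.neg_mem _ (push_mem_Z s' hw))
    · rw [SetLike.mem_coe, Submodule.mem_comap, map_add, map_neg, push_push, push_push, hps, hps', push_id,
        add_neg_cancel]
      exact Submodule.zero_mem _
    · exact push_mem_sub _ (by rintro _ ⟨x, rfl⟩; exact hs x) _
    · exact Submodule.neg_mem _ (push_mem_sub _ (by rintro _ ⟨x, rfl⟩; exact hs' x) _)
    · rw [push_push, hps, push_id]
  · obtain ⟨hz, a, ha, b, hb, rfl, rfl⟩ := (hR z w).1 h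
    obtain ⟨haZ, hbZ⟩ := hZ n a b ha hb hz.1
    constructor
    · rintro ⟨y, hy⟩
      obtain ⟨a', ha', b', hb', rfl⟩ :=
        Submodule.mem_sup.1 (htop (n + 1) ▸ Submodule.mem_top : y ∈ _)
      have h1 : a - bd n a' = -(b - bd n b') := by
        rw [eq_neg_iff_add_eq_zero, ← sub_eq_zero.2 hy.symm, map_add]
        abel
      have h2 : a - bd n a' = 0 :=
        hbot n _ (Submodule.sub_mem _ ha (bd_mem_sub ha'))
          (h1 ▸ Submodule.neg_mem _ (Submodule.sub_mem _ hb (bd_mem_sub hb')))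
      rw [sub_eq_zero.1 h2]
      exact push_mem_B p ⟨_, rfl⟩
    · intro hpa
      have hpb : push n p b ∈ B X n := by
        have := hz.2
        rw [SetLike.mem_coe, Submodule.mem_comap, map_add] at this
        exact (Submodule.add_mem_iff_right _ hpa).1 this
      obtain ⟨e, -, he⟩ := hhA.exists_bd_eq hs haZ ha hpa
      obtain ⟨e', -, he'⟩ := hhA'.exists_bd_eq hs' hbZ hb hpb
      exact ⟨e + e', by rw [map_add, he, he']⟩

end SingChain
end

noncomputable section

namespace SingChain

/-! ### Products with spheres -/

set_option linter.unusedSectionVars false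

/-- A vector space without its origin. -/
abbrev Punct (E : Type) [Zero E] : Type := {v : E // v ≠ 0}

section Punctured

variable (X : Type) [TopologicalSpace X] (E E' : Type) [NormedAddCommGroup E] [NormedSpace ℝ E]
  [NormedAddCommGroup E'] [NormedSpace ℝ E']

/-- The first projection of a product. -/
def prX (F : Type) [TopologicalSpace F] : C(X × F, X) := ⟨Prod.fst, continuous_fst⟩

/-- The section of the first projection with constant second component. -/
def secX {F : Type} [TopologicalSpace F] (v : F) : C(X, X × F) := ⟨fun x ↦ (x, v), by fun_prop⟩

/-- The half space (or slit space) of the points above (for `ε > 0`) or below (for `ε < 0`). -/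
def slit (ε : ℝ) : Set (X × Punct (E × ℝ)) := {y | y.2.1.1 ≠ 0 ∨ 0 < ε * y.2.1.2}

variable {E E'}

lemma isOpen_slit (ε : ℝ) : IsOpen (slit X E ε) := by
  refine IsOpen.union ?_ ?_
  · exact isOpen_ne.preimage
      (continuous_fst.comp (continuous_subtype_val.comp continuous_snd))
  · exact isOpen_lt continuous_const
      (by fun_prop : Continuous fun y : X × Punct (E × ℝ) ↦ ε * y.2.1.2)

lemma slit_union : slit X E 1 ∪ slit X E (-1) = univ := by
  rw [eq_univ_iff_forall]
  rintro ⟨x, ⟨⟨v, t⟩, h⟩⟩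
  by_cases hv : v = 0
  · have ht : t ≠ 0 := fun ht ↦ h (by rw [hv, ht]; rfl)
    rcases ht.lt_or_gt with h | h
    · exact Or.inr (Or.inr (by simpa using h))
    · exact Or.inl (Or.inr (by simpa using h))
  · exact Or.inl (Or.inl hv)

/-- The segment to the pole (0, ε), with ε = ±1, stays in the slit space: if the first coordinate
vanishes along the way, ε times the second one equals (1-τ)εt + τ > 0. -/
lemma slit_ne {ε τ : ℝ} (hε : ε * ε = 1) (h0 : 0 ≤ τ) (h1 : τ ≤ 1) {v : E} {t : ℝ}
    (h : v ≠ 0 ∨ 0 < ε * t) :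
    (1 - τ) • v ≠ 0 ∨ 0 < ε * ((1 - τ) * t + τ * ε) := by
  by_cases hv : (1 - τ) • v = 0
  · right
    have h3 : ε * ((1 - τ) * t + τ * ε) = (1 - τ) * (ε * t) + τ := by
      linear_combination τ * hε
    rw [h3]
    rcases smul_eq_zero.1 hv with h2 | h2
    · rw [h2, zero_mul, zero_add]
      linarith
    · have ht : 0 < ε * t := h.resolve_left (fun h ↦ h h2)
      rcases h0.eq_or_lt with rfl | h0
      · simpa using ht
      · nlinarith [mul_nonneg (sub_nonneg.2 h1) ht.le]
  · exact Or.inl hv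

lemma ne_zero_of_slit {ε : ℝ} {v : E} {t : ℝ} (h : v ≠ 0 ∨ 0 < ε * t) : (v, t) ≠ (0 : E × ℝ) := by
  rintro h2
  obtain ⟨rfl, rfl⟩ := Prod.mk.inj h2
  simp at h

/-- The slit space retracts to a point. -/
lemma id_homotopic_slit {ε : ℝ} (hε : ε * ε = 1) :
    (ContinuousMap.id (slit X E ε)).Homotopic
      ⟨fun y ↦ ⟨(y.1.1, ⟨((0 : E), ε), ne_zero_of_slit (ε := ε) (Or.inr (by simp [hε]))⟩),
        Or.inr (by simp [hε])⟩, by fun_prop⟩ := by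
  refine ⟨⟨⟨fun q ↦ ⟨(q.2.1.1, ⟨((1 - (q.1 : ℝ)) • q.2.1.2.1.1, (1 - (q.1 : ℝ)) * q.2.1.2.1.2 +
    (q.1 : ℝ) * ε), ne_zero_of_slit (slit_ne hε q.1.2.1 q.1.2.2 q.2.2)⟩),
    slit_ne hε q.1.2.1 q.1.2.2 q.2.2⟩, by fun_prop⟩, fun y ↦ ?_, fun y ↦ ?_⟩⟩
  · simp
  · simp

/-- The retraction of the slit space to one of its points. -/
lemma id_homotopic_slit_const {ε : ℝ} (hε : ε * ε = 1) (v : Punct (E × ℝ))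
    (hv : v.1.1 ≠ 0 ∨ 0 < ε * v.1.2) :
    (ContinuousMap.id (slit X E ε)).Homotopic ⟨fun y ↦ ⟨(y.1.1, v), hv⟩, by fun_prop⟩ := by
  have h := id_homotopic_slit X (E := E) hε
  refine h.trans (ContinuousMap.Homotopic.symm ?_)
  exact ContinuousMap.Homotopic.comp h (ContinuousMap.Homotopic.refl
    (⟨fun y ↦ ⟨(y.1.1, v), hv⟩, by fun_prop⟩ : C(slit X E ε, slit X E ε)))

lemma homologousIn_slit {ε : ℝ} (hε : ε * ε = 1) (v : Punct (E × ℝ))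
    (hv : v.1.1 ≠ 0 ∨ 0 < ε * v.1.2) :
    HomologousIn (slit X E ε) ((secX X v).comp (prX X _)) :=
  homologousIn_of_homotopic _ _ _ rfl (id_homotopic_slit_const X hε v hv)

lemma slit_inter : slit X E 1 ∩ slit X E (-1) = {y | y.2.1.1 ≠ 0} := by
  ext y
  constructor
  · rintro ⟨h | h, h' | h'⟩
    · exact h
    · exact h
    · exact h'
    · linarith
  · intro h
    exact ⟨Or.inl h, Or.inl h⟩

/-- The two slit spaces meet where the first coordinate is nonzero, and there the second coordinate
can be scaled away. Nontriviality of E supplies a point v common to both, hence one section for both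
retractions. -/
lemma rkK_punct_prod_succ [Nontrivial E] (n : ℕ) :
    rkK (prX X (Punct (E × ℝ))) (n + 1) = rkK (prX X (Punct E)) n := by
  obtain ⟨v₀, hv₀⟩ := exists_ne (0 : E)
  let v : Punct (E × ℝ) := ⟨(v₀, 0), fun h ↦ hv₀ (congrArg Prod.fst h)⟩
  rw [rkK_succ_eq (prX X (Punct (E × ℝ))) (secX X v) rfl (isOpen_slit X 1) (isOpen_slit X (-1))
    (slit_union X) (fun x ↦ ⟨Or.inl hv₀, Or.inl hv₀⟩) (homologousIn_slit X (by norm_num) v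
    (Or.inl hv₀)) (homologousIn_slit X (by norm_num) v (Or.inl hv₀)) n, slit_inter]
  let f : C({y : X × Punct (E × ℝ) | y.2.1.1 ≠ 0}, X × Punct E) :=
    ⟨fun y ↦ (y.1.1, ⟨y.1.2.1.1, y.2⟩), by fun_prop⟩
  let g : C(X × Punct E, {y : X × Punct (E × ℝ) | y.2.1.1 ≠ 0}) :=
    ⟨fun y ↦ ⟨(y.1, ⟨(y.2.1, 0), fun h ↦ y.2.2 (congrArg Prod.fst h)⟩), y.2.2⟩, by fun_prop⟩
  refine (?_ : (g.comp f).Homotopic (ContinuousMap.id _) → (f.comp g).Homotopic (ContinuousMap.id _) → _) ?_ ?_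
  · intro h1 h2
    exact rkK_eq_of_homotopyEquiv ((prX X (Punct (E × ℝ))).comp (incl _)) (prX X (Punct E))
      f g rfl rfl h1 h2 n
  · refine ⟨⟨⟨fun q ↦ ⟨(q.2.1.1, ⟨(q.2.1.2.1.1, (q.1 : ℝ) * q.2.1.2.1.2),
      fun h ↦ q.2.2 (congrArg Prod.fst h)⟩), q.2.2⟩, by fun_prop⟩, fun y ↦ ?_, fun y ↦ ?_⟩⟩
    · simp [f, g]
    · simp
  · exact ContinuousMap.Homotopic.refl _

lemma rkK_punct_prod_zero [Nontrivial E] : rkK (prX X (Punct (E × ℝ))) 0 = 0 := by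
  obtain ⟨v₀, hv₀⟩ := exists_ne (0 : E)
  let v : Punct (E × ℝ) := ⟨(v₀, 0), fun h ↦ hv₀ (congrArg Prod.fst h)⟩
  exact rkK_zero_eq (prX X (Punct (E × ℝ))) (secX X v)
    (slit_union X) (homologousIn_slit X (by norm_num) v
    (Or.inl hv₀)) (homologousIn_slit X (by norm_num) v (Or.inl hv₀))

lemma rkK_congr (e : E ≃L[ℝ] E') (n : ℕ) :
    rkK (prX X (Punct E)) n = rkK (prX X (Punct E')) n := by
  let f : C(X × Punct E, X × Punct E') :=
    ⟨fun y ↦ (y.1, ⟨e y.2.1, fun h ↦ y.2.2 (by simpa using h)⟩), by fun_prop⟩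
  let g : C(X × Punct E', X × Punct E) :=
    ⟨fun y ↦ (y.1, ⟨e.symm y.2.1, fun h ↦ y.2.2 (by simpa using h)⟩), by fun_prop⟩
  refine (?_ : (g.comp f).Homotopic (ContinuousMap.id _) → (f.comp g).Homotopic (ContinuousMap.id _) → _) ?_ ?_
  · intro h1 h2
    exact rkK_eq_of_homotopyEquiv (prX X (Punct E)) (prX X (Punct E'))
      f g rfl rfl h1 h2 n
  · rw [show g.comp f = ContinuousMap.id _ by ext y <;> simp [f, g]]
  · rw [show f.comp g = ContinuousMap.id _ by ext y <;> simp [f, g]]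

/-- Over the zero space the slits are the two open half-lines, which are disjoint. -/
lemma rkK_punct_line (n : ℕ) : rkK (prX X (Punct ((Fin 0 → ℝ) × ℝ))) n = qrank (Z X n) (B X n) := by
  let v (ε : ℝ) (h : ε ≠ 0) : Punct ((Fin 0 → ℝ) × ℝ) := ⟨(0, ε), fun h2 ↦ h (congrArg Prod.snd h2)⟩
  have hv (u : Fin 0 → ℝ) : ¬ u ≠ 0 := fun h ↦ h (Subsingleton.elim _ _)
  exact rkK_eq_of_disjoint (prX X _) (secX X (v 1 (by norm_num))) (secX X (v (-1) (by norm_num)))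
    rfl rfl (isOpen_slit X 1) (isOpen_slit X (-1)) (slit_union X)
    (by rw [slit_inter]; exact eq_empty_of_forall_notMem fun y hy ↦ hv _ hy)
    (fun x ↦ Or.inr (by simp [secX, v])) (fun x ↦ Or.inr (by simp [secX, v]))
    (homologousIn_slit X (by norm_num) _ (Or.inr (by simp [v])))
    (homologousIn_slit X (by norm_num) _ (Or.inr (by simp [v]))) n

lemma rkK_punct [FiniteDimensional ℝ E] (m : ℕ) (hm : Module.finrank ℝ E = m + 1) (n : ℕ) :
    rkK (prX X (Punct E)) n = if n < m then 0 else qrank (Z X (n - m)) (B X (n - m)) := by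
  have key (m n : ℕ) : rkK (prX X (Punct ((Fin m → ℝ) × ℝ))) n =
      if n < m then 0 else qrank (Z X (n - m)) (B X (n - m)) := by
    induction m generalizing n with
    | zero => simpa using rkK_punct_line X n
    | succ m ih =>
      cases n with
      | zero => simpa using rkK_punct_prod_zero X
      | succ n =>
        rw [rkK_punct_prod_succ, ← rkK_congr X (ContinuousLinearEquiv.ofFinrankEq
          (𝕜 := ℝ) (E := (Fin m → ℝ) × ℝ) (F := Fin (m + 1) → ℝ) (by simp)), ih, Nat.add_sub_add_right]
        simp
  rw [← key m n]
  exact rkK_congr X (ContinuousLinearEquiv.ofFinrankEq (by simp [hm])) n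

end Punctured

section Sphere

variable (X : Type) [TopologicalSpace X] {E : Type} [NormedAddCommGroup E] [InnerProductSpace ℝ E]
  [FiniteDimensional ℝ E]

lemma rkK_sphere (n : ℕ) : rkK (prX X (sphere (0 : E) 1)) n = rkK (prX X (Punct E)) n := by
  let f : C(X × sphere (0 : E) 1, X × Punct E) :=
    ⟨fun y ↦ (y.1, ⟨y.2.1, ne_zero_of_mem_unit_sphere y.2⟩), by fun_prop⟩
  let g : C(X × Punct E, X × sphere (0 : E) 1) :=
    ⟨fun y ↦ (y.1, ⟨‖y.2.1‖⁻¹ • y.2.1, by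
      rw [mem_sphere_zero_iff_norm, norm_smul, norm_inv, norm_norm,
        inv_mul_cancel₀ (norm_ne_zero_iff.2 y.2.2)]⟩),
      by
        have : ∀ y : X × Punct E, ‖y.2.1‖ ≠ 0 := fun y ↦ norm_ne_zero_iff.2 y.2.2
        fun_prop (disch := assumption)⟩
  refine (?_ : (g.comp f).Homotopic (ContinuousMap.id _) → (f.comp g).Homotopic (ContinuousMap.id _) → _) ?_ ?_
  · intro h1 h2
    exact rkK_eq_of_homotopyEquiv (prX X (sphere (0 : E) 1)) (prX X (Punct E))
      f g rfl rfl h1 h2 n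
  · have : g.comp f = ContinuousMap.id _ := by
      ext1 y
      refine Prod.ext rfl (Subtype.ext ?_)
      simp [f, g, norm_eq_of_mem_sphere y.2]
    rw [this]
  -- The factor of the radial homotopy from v/|v| to v never vanishes.
  · have hpos (q : unitInterval × (X × Punct E)) :
        0 < (1 - (q.1 : ℝ)) * ‖q.2.2.1‖⁻¹ + (q.1 : ℝ) := by
      have h0 : 0 < ‖q.2.2.1‖⁻¹ := inv_pos.2 (norm_pos_iff.2 q.2.2.2)
      rcases q.1.2.2.eq_or_lt with h | h
      · rw [h]; simp
      · have := mul_pos (sub_pos.2 h) h0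
        linarith [q.1.2.1]
    have hne : ∀ q : unitInterval × (X × Punct E), ‖q.2.2.1‖ ≠ 0 :=
      fun q ↦ norm_ne_zero_iff.2 q.2.2.2
    refine ⟨⟨⟨fun q ↦ (q.2.1, ⟨((1 - (q.1 : ℝ)) * ‖q.2.2.1‖⁻¹ + (q.1 : ℝ)) • q.2.2.1,
      smul_ne_zero (hpos q).ne' q.2.2.2⟩), by fun_prop (disch := assumption)⟩,
      fun y ↦ ?_, fun y ↦ ?_⟩⟩
    · simp [f, g]
    · simp

lemma rank_sphere (m : ℕ) (hm : Module.finrank ℝ E = m + 1) (n : ℕ) :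
    qrank (Z (X × sphere (0 : E) 1) n) (B (X × sphere (0 : E) 1) n) =
      qrank (Z X n) (B X n) + if n < m then 0 else qrank (Z X (n - m)) (B X (n - m)) := by
  have : Nontrivial E := Module.nontrivial_of_finrank_pos (R := ℝ) (by omega)
  obtain ⟨v, hv⟩ : (sphere (0 : E) 1).Nonempty := NormedSpace.sphere_nonempty.2 zero_le_one
  rw [rank_eq_add_rkK (prX X (sphere (0 : E) 1)) (secX X ⟨v, hv⟩) rfl, rkK_sphere, rkK_punct X m hm]

end Sphere

end SingChain

/-! ### Betti sums of products with spheres -/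

namespace HopfTaut

open SingChain

lemma betti_eq_qrank (k : ℕ) (X : Type) [TopologicalSpace X] :
    betti k X = Cardinal.toENat (qrank (Z X k) (B X k)) := by
  rw [betti, rank_H]

lemma bettiSum_congr {X Y : Type} [TopologicalSpace X] [TopologicalSpace Y] (e : X ≃ₜ Y) :
    bettiSum X = bettiSum Y := by
  have (k : ℕ) : betti k X = betti k Y := by
    rw [betti, betti]
    have i : TopCat.of X ≅ TopCat.of Y := TopCat.isoOfHomeo e
    exact congrArg _ (((AlgebraicTopology.singularHomologyFunctor (ModuleCat.{0} (ZMod 2)) k).obj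
      (ModuleCat.of (ZMod 2) (ZMod 2))).mapIso i).toLinearEquiv.rank_eq
  simp only [bettiSum, this]

/-- The Betti numbers of X appear twice, once shifted by m, and a shift does not change the supremum
of the partial sums. Infinite values are allowed throughout. -/
lemma bettiSum_prod_sphere (X : Type) [TopologicalSpace X] {E : Type} [NormedAddCommGroup E]
    [InnerProductSpace ℝ E] [FiniteDimensional ℝ E] (m : ℕ) (hm : Module.finrank ℝ E = m + 1) :
    bettiSum (X × sphere (0 : E) 1) = 2 * bettiSum X := by
  have hb (k : ℕ) : betti k (X × sphere (0 : E) 1) =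
      betti k X + if k < m then 0 else betti (k - m) X := by
    simp only [betti_eq_qrank]
    rw [rank_sphere X m hm, map_add]
    split_ifs <;> simp
  have hsum (n : ℕ) : ∑ k ∈ Finset.range n, (if k < m then 0 else betti (k - m) X) =
      ∑ k ∈ Finset.range (n - m), betti k X := by
    rcases le_total m n with h | h
    · obtain ⟨l, rfl⟩ := Nat.exists_eq_add_of_le h
      rw [Finset.sum_range_add, Finset.sum_eq_zero, zero_add, Nat.add_sub_cancel_left]
      · exact Finset.sum_congr rfl fun k _ ↦ by simp
      · intro k hk
        rw [if_pos (Finset.mem_range.1 hk)]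
    · rw [Nat.sub_eq_zero_of_le h, Finset.range_zero, Finset.sum_empty]
      exact Finset.sum_eq_zero fun k hk ↦ if_pos ((Finset.mem_range.1 hk).trans_le h)
  have hmono : Monotone fun n ↦ ∑ k ∈ Finset.range n, betti k X :=
    fun a b h ↦ Finset.sum_le_sum_of_subset (Finset.range_mono h)
  rw [two_mul, bettiSum]
  simp only [hb, Finset.sum_add_distrib, hsum]
  refine le_antisymm (iSup_le fun n ↦ ?_) ?_
  · exact add_le_add (le_iSup (fun n ↦ ∑ k ∈ Finset.range n, betti k X) n)
      (le_iSup (fun n ↦ ∑ k ∈ Finset.range n, betti k X) (n - m))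
  · rw [bettiSum, ENat.iSup_add_iSup_of_monotone hmono hmono]
    -- The partial sum of the product up to n + m dominates twice that of X up to n.
    refine iSup_le fun n ↦ (add_le_add (hmono (Nat.le_add_right n m)) ?_).trans
      (le_iSup (fun n ↦ ∑ k ∈ Finset.range n, betti k X + ∑ k ∈ Finset.range (n - m), betti k X)
        (n + m))
    rw [Nat.add_sub_cancel]

lemma bettiSum_punit : bettiSum PUnit = 1 := by
  have h0 : betti 0 PUnit = 1 := by
    rw [betti]
    have i := AlgebraicTopology.singularHomologyFunctorZeroOfTotallyDisconnectedSpace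
      (ModuleCat.{0} (ZMod 2)) (ModuleCat.of (ZMod 2) (ZMod 2)) (TopCat.of PUnit)
    have j := CategoryTheory.Limits.coproductUniqueIso
      (fun _ : (TopCat.of PUnit : TopCat.{0}) ↦ ModuleCat.of (ZMod 2) (ZMod 2))
    rw [(i ≪≫ j).toLinearEquiv.rank_eq]
    simp
  have hk (k : ℕ) : betti (k + 1) PUnit = 0 := by
    rw [betti]
    have := AlgebraicTopology.isZero_singularHomologyFunctor_of_totallyDisconnectedSpace
      (ModuleCat.{0} (ZMod 2)) (k + 1) (ModuleCat.of (ZMod 2) (ZMod 2)) (TopCat.of PUnit)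
      (Nat.succ_ne_zero k)
    have := ModuleCat.subsingleton_of_isZero this
    rw [rank_subsingleton' _ _, map_zero]
  rw [bettiSum]
  refine le_antisymm (iSup_le fun n ↦ ?_) (le_iSup_of_le 1 ?_)
  · cases n with
    | zero => simp
    | succ n => rw [Finset.sum_range_succ', h0]; simp [hk]
  · simp [h0]

lemma bettiSum_sphere {E : Type} [NormedAddCommGroup E]
    [InnerProductSpace ℝ E] [FiniteDimensional ℝ E] (m : ℕ) (hm : Module.finrank ℝ E = m + 1) :
    bettiSum (sphere (0 : E) 1) = 2 := by
  rw [← bettiSum_congr (Homeomorph.punitProd (sphere (0 : E) 1)), bettiSum_prod_sphere _ m hm,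
    bettiSum_punit, mul_one]

end HopfTaut
end

noncomputable section

namespace HopfTaut

open Filter Topology

set_option linter.unusedSectionVars false

/-! ### Critical points in local coordinates -/

section Calculus

variable {P Q : Type} [NormedAddCommGroup P] [NormedSpace ℝ P] [NormedAddCommGroup Q]
  [NormedSpace ℝ Q]

/-- The Hessian of `F` at `u` is nondegenerate. -/
def NondegAt (F : P → ℝ) (u : P) : Prop :=
  ∀ v, (∀ w, fderiv ℝ (fderiv ℝ F) u v w = 0) → v = 0

/-- At a critical point the second derivative of ψ is paired with dF = 0, so the Hessian transforms
as a bilinear form. -/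
lemma fderiv_fderiv_comp {F : Q → ℝ} {ψ : P → Q} {u : P} (hF : ContDiffAt ℝ 2 F (ψ u))
    (hψ : ContDiffAt ℝ 2 ψ u) (h0 : fderiv ℝ F (ψ u) = 0) (v w : P) :
    fderiv ℝ (fderiv ℝ (F ∘ ψ)) u v w =
      fderiv ℝ (fderiv ℝ F) (ψ u) (fderiv ℝ ψ u v) (fderiv ℝ ψ u w) := by
  have hev : fderiv ℝ (F ∘ ψ) =ᶠ[𝓝 u] fun y ↦ (fderiv ℝ F (ψ y)).comp (fderiv ℝ ψ y) := by
    filter_upwards [hψ.continuousAt.eventually (hF.eventually (by simp)),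
      hψ.eventually (by simp)] with y hy hy'
    exact fderiv_comp y (hy.differentiableAt (by simp)) (hy'.differentiableAt (by simp))
  have hd : HasFDerivAt ψ (fderiv ℝ ψ u) u := (hψ.differentiableAt (by simp)).hasFDerivAt
  have hF1 : ContDiffAt ℝ 1 (fderiv ℝ F) (ψ u) := hF.fderiv_right (by norm_num)
  have hψ1 : ContDiffAt ℝ 1 (fderiv ℝ ψ) u := hψ.fderiv_right (by norm_num)
  have h1 : HasFDerivAt (fun y ↦ fderiv ℝ F (ψ y))
      ((fderiv ℝ (fderiv ℝ F) (ψ u)).comp (fderiv ℝ ψ u)) u :=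
    ((hF1.differentiableAt (by simp)).hasFDerivAt).comp u hd
  have h2 : HasFDerivAt (fderiv ℝ ψ) (fderiv ℝ (fderiv ℝ ψ) u) u :=
    (hψ1.differentiableAt (by simp)).hasFDerivAt
  rw [hev.fderiv_eq, (h1.clm_comp h2).fderiv]
  simp [h0]

/-- The term with φ'' carries the factor dF = 0. This compares both arccos of a height with the
height, and heights upstairs with heights downstairs. -/
lemma fderiv_fderiv_real_comp {F : P → ℝ} {φ : ℝ → ℝ} {u : P} (hF : ContDiffAt ℝ 2 F u)
    (hφ : ContDiffAt ℝ 2 φ (F u)) (h0 : fderiv ℝ F u = 0) (v w : P) :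
    fderiv ℝ (fderiv ℝ (φ ∘ F)) u v w = deriv φ (F u) * fderiv ℝ (fderiv ℝ F) u v w := by
  have hev : fderiv ℝ (φ ∘ F) =ᶠ[𝓝 u] fun y ↦ deriv φ (F y) • fderiv ℝ F y := by
    filter_upwards [hF.continuousAt.eventually (hφ.eventually (by simp)),
      hF.eventually (by simp)] with y hy hy'
    exact ((hy.differentiableAt (by simp)).hasDerivAt.comp_hasFDerivAt y
      (hy'.differentiableAt (by simp)).hasFDerivAt).fderiv
  have hF1 : ContDiffAt ℝ 1 (fderiv ℝ F) u := hF.fderiv_right (by norm_num)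
  have hφ1 : ContDiffAt ℝ 1 (deriv φ) (F u) := by
    have : ContDiffAt ℝ 1 (fderiv ℝ φ) (F u) := hφ.fderiv_right (by norm_num)
    exact this.clm_apply contDiffAt_const
  have h1 : HasFDerivAt (fun y ↦ deriv φ (F y)) (deriv (deriv φ) (F u) • fderiv ℝ F u) u :=
    (hφ1.differentiableAt (by simp)).hasDerivAt.comp_hasFDerivAt u
      (hF.differentiableAt (by simp)).hasFDerivAt
  have h2 : HasFDerivAt (fderiv ℝ F) (fderiv ℝ (fderiv ℝ F) u) u :=
    (hF1.differentiableAt (by simp)).hasFDerivAt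
  rw [hev.fderiv_eq, (h1.fun_smul h2).fderiv]
  simp [h0]

lemma nondegAt_real_comp_iff {F : P → ℝ} {φ : ℝ → ℝ} {u : P} (hF : ContDiffAt ℝ 2 F u)
    (hφ : ContDiffAt ℝ 2 φ (F u)) (h0 : fderiv ℝ F u = 0) (hd : deriv φ (F u) ≠ 0) :
    NondegAt (φ ∘ F) u ↔ NondegAt F u := by
  simp only [NondegAt, fderiv_fderiv_real_comp hF hφ h0, mul_eq_zero, hd, false_or]

/-- The derivative of dF at u is injective, hence bounded below in finite dimension, so dF has no
zero near u other than possibly u. -/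
lemma NondegAt.eventually_ne [FiniteDimensional ℝ P] {F : P → ℝ} {u : P} (h : NondegAt F u)
    (hF : ContDiffAt ℝ 2 F u) : ∀ᶠ y in 𝓝[≠] u, fderiv ℝ F y ≠ 0 := by
  have hF1 : ContDiffAt ℝ 1 (fderiv ℝ F) u := hF.fderiv_right (by norm_num)
  refine (hF1.differentiableAt (by simp)).hasFDerivAt.eventually_ne ?_
  have hker : (fderiv ℝ (fderiv ℝ F) u).ker = ⊥ := by
    rw [LinearMap.ker_eq_bot']
    intro v hv
    exact h v fun w ↦ by rw [show fderiv ℝ (fderiv ℝ F) u v = 0 from hv]; rfl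
  obtain ⟨C, -, hC⟩ := LinearMap.exists_antilipschitzWith _ hker
  exact ⟨C, hC⟩

end Calculus

section Submanifold

variable {E : Type} [NormedAddCommGroup E] [InnerProductSpace ℝ E] {d : ℕ} {M : Set E}
  {U : Set (EuclideanSpace ℝ (Fin d))} {c : EuclideanSpace ℝ (Fin d) → E}

lemma IsLocalParam.contDiffAt (h : IsLocalParam d M U c) {u} (hu : u ∈ U) :
    ContDiffAt ℝ ∞ c u :=
  h.contDiffOn.contDiffAt (h.isOpen.mem_nhds hu)

lemma IsLocalParam.mem (h : IsLocalParam d M U c) {u} (hu : u ∈ U) : c u ∈ M :=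
  h.isOpenEmbedding.choose hu

lemma IsLocalParam.differentiableAt (h : IsLocalParam d M U c) {u} (hu : u ∈ U) :
    DifferentiableAt ℝ c u :=
  (h.contDiffAt hu).differentiableAt (by simp)

lemma IsLocalParam.map_nhds (h : IsLocalParam d M U c) {u} (hu : u ∈ U) :
    map c (𝓝 u) = 𝓝[M] (c u) := by
  obtain ⟨hm, he⟩ := h.isOpenEmbedding
  have h1 := he.map_nhds_eq ⟨u, hu⟩
  rw [← h.isOpen.nhdsWithin_eq hu, ← map_nhds_subtype_val (⟨u, hu⟩ : U), map_map,
    ← map_nhds_subtype_val (⟨c u, hm hu⟩ : M)]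
  change _ = map Subtype.val (𝓝 (hm.restrict c U M ⟨u, hu⟩))
  rw [← h1, map_map]
  rfl

/-- A linear left inverse b of the derivative of c' makes b ∘ c' a local diffeomorphism by the
inverse function theorem; the transition map is its inverse after b ∘ c, visibly smooth. -/
lemma IsLocalParam.exists_transition [FiniteDimensional ℝ E] (h : IsLocalParam d M U c)
    {U' : Set (EuclideanSpace ℝ (Fin d))} {c' : EuclideanSpace ℝ (Fin d) → E}
    (h' : IsLocalParam d M U' c') {u u'} (hu : u ∈ U) (hu' : u' ∈ U') (heq : c u = c' u') :
    ∃ φ : EuclideanSpace ℝ (Fin d) → EuclideanSpace ℝ (Fin d), φ u = u' ∧ ContDiffAt ℝ ∞ φ u ∧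
      c =ᶠ[𝓝 u] c' ∘ φ ∧ Function.Injective (fderiv ℝ φ u) := by
  obtain ⟨b, hb⟩ := LinearMap.exists_leftInverse_of_injective
    (fderiv ℝ c' u' : EuclideanSpace ℝ (Fin d) →ₗ[ℝ] E)
    (LinearMap.ker_eq_bot.2 (h'.immersion u' hu'))
  let b' : E →L[ℝ] EuclideanSpace ℝ (Fin d) := b.toContinuousLinearMap
  have hG : ContDiffAt ℝ ∞ (b' ∘ c') u' := b'.contDiff.contDiffAt.comp u' (h'.contDiffAt hu')
  have hG' : HasFDerivAt (b' ∘ c') ((ContinuousLinearEquiv.refl ℝ (EuclideanSpace ℝ (Fin d)) :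
      EuclideanSpace ℝ (Fin d) →L[ℝ] EuclideanSpace ℝ (Fin d))) u' := by
    have := b'.hasFDerivAt.comp u' (h'.differentiableAt hu').hasFDerivAt
    refine this.congr_fderiv ?_
    ext1 v
    exact LinearMap.congr_fun hb v
  have hne : (∞ : WithTop ℕ∞) ≠ 0 := by simp
  set e := hG.toOpenPartialHomeomorph (b' ∘ c') hG' hne with he
  have hesrc : u' ∈ e.source := hG.mem_toOpenPartialHomeomorph_source hG' hne
  have hecoe : (e : EuclideanSpace ℝ (Fin d) → _) = b' ∘ c' := rfl
  have hinv : ContDiffAt ℝ ∞ e.symm ((b' ∘ c') u') := hG.to_localInverse hG' hne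
  let φ := fun y ↦ e.symm (b' (c y))
  have hφu : φ u = u' := by
    change e.symm (b' (c u)) = u'
    rw [heq]
    exact e.left_inv hesrc
  have hφ : ContDiffAt ℝ ∞ φ u := by
    have h1 : ContDiffAt ℝ ∞ (fun y ↦ b' (c y)) u :=
      b'.contDiff.contDiffAt.comp u (h.contDiffAt hu)
    refine ContDiffAt.comp u ?_ h1
    change ContDiffAt ℝ ∞ e.symm (b' (c u))
    rw [heq]
    exact hinv
  -- Points of M near the common point come from parameters near u', where b ∘ c' is invertible;
  -- continuity of c alone puts c y among them.
  have hceq : c =ᶠ[𝓝 u] c' ∘ φ := by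
    have h1 : ∀ᶠ x in 𝓝[M] (c' u'), ∃ y, e.symm (e y) = y ∧ c' y = x := by
      rw [← h'.map_nhds hu', eventually_map]
      filter_upwards [e.open_source.mem_nhds hesrc] with y hy
      exact ⟨y, e.left_inv hy, rfl⟩
    rw [← heq, ← h.map_nhds hu, eventually_map] at h1
    filter_upwards [h1] with y hy
    obtain ⟨z, hz, hzy⟩ := hy
    have : φ y = z := by
      change e.symm (b' (c y)) = z
      rw [← hzy]
      exact hz
    rw [Function.comp_apply, this, hzy]
  refine ⟨φ, hφu, hφ, hceq, ?_⟩
  have h2 : fderiv ℝ c u = (fderiv ℝ c' u').comp (fderiv ℝ φ u) := by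
    rw [hceq.fderiv_eq, fderiv_comp u (by rw [hφu]; exact h'.differentiableAt hu')
      (hφ.differentiableAt (by simp)), hφu]
  have h3 := h.immersion u hu
  rw [h2, ContinuousLinearMap.coe_comp] at h3
  exact h3.of_comp

variable [FiniteDimensional ℝ E]

lemma IsLocalParam.isCriticalPt_iff (h : IsLocalParam d M U c) {u} (hu : u ∈ U) (g : E → ℝ) :
    IsCriticalPt d M g (c u) ↔
      HasFDerivAt (g ∘ c) (0 : EuclideanSpace ℝ (Fin d) →L[ℝ] ℝ) u := by
  constructor
  · rintro ⟨U', c', h', u', hu', heq, hd⟩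
    obtain ⟨φ, hφu, hφ, hc, -⟩ := h.exists_transition h' hu hu' heq.symm
    rw [← hφu] at hd
    have := hd.comp u (hφ.differentiableAt (by simp)).hasFDerivAt
    rw [ContinuousLinearMap.zero_comp] at this
    refine this.congr_of_eventuallyEq ?_
    filter_upwards [hc] with y hy
    simp [hy]
  · intro hd
    exact ⟨U, c, h, u, hu, rfl, hd⟩

lemma IsLocalParam.isNondegCriticalPt_iff (h : IsLocalParam d M U c) {u} (hu : u ∈ U) {g : E → ℝ}
    (hg : ContDiffAt ℝ 2 (g ∘ c) u)
    (h0 : HasFDerivAt (g ∘ c) (0 : EuclideanSpace ℝ (Fin d) →L[ℝ] ℝ) u) :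
    IsNondegCriticalPt d M g (c u) ↔ NondegAt (g ∘ c) u := by
  constructor
  · rintro ⟨U', c', h', u', hu', heq, hd, hn⟩
    obtain ⟨φ, rfl, hφ, hc, hinj⟩ := h'.exists_transition h hu' hu heq
    have hgc : g ∘ c' =ᶠ[𝓝 u'] (g ∘ c) ∘ φ := by
      filter_upwards [hc] with y hy
      simp [hy]
    have hφ2 : ContDiffAt ℝ 2 φ u' := hφ.of_le ENat.LEInfty.out
    intro a ha
    obtain ⟨v, rfl⟩ := (LinearMap.injective_iff_surjective (f := (fderiv ℝ φ u').toLinearMap)).1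
      hinj a
    have hv : v = 0 := by
      refine hn v fun w ↦ ?_
      rw [hgc.fderiv.fderiv_eq, fderiv_fderiv_comp hg hφ2 h0.fderiv]
      exact ha _
    rw [hv, map_zero]
  · intro hn
    exact ⟨U, c, h, u, hu, rfl, h0, hn⟩

lemma IsLocalParam.contDiffAt_height (h : IsLocalParam d M U c) {u} (hu : u ∈ U) (q : E) :
    ContDiffAt ℝ ∞ (height q ∘ c) u :=
  contDiffAt_const.inner ℝ (h.contDiffAt hu)

lemma IsLocalParam.contDiffAt_height_two (h : IsLocalParam d M U c) {u} (hu : u ∈ U) (q : E) :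
    ContDiffAt ℝ 2 (height q ∘ c) u :=
  (h.contDiffAt_height hu q).of_le ENat.LEInfty.out

lemma IsLocalParam.hasFDerivAt_height (h : IsLocalParam d M U c) {u} (hu : u ∈ U) (q : E) :
    HasFDerivAt (height q ∘ c) ((innerSL ℝ q).comp (fderiv ℝ c u)) u :=
  (innerSL ℝ q).hasFDerivAt.comp u (h.differentiableAt hu).hasFDerivAt

lemma IsLocalParam.isCriticalPt_height_iff (h : IsLocalParam d M U c) {u} (hu : u ∈ U) (q : E) :
    IsCriticalPt d M (height q) (c u) ↔ ∀ v, inner ℝ q (fderiv ℝ c u v) = 0 := by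
  rw [h.isCriticalPt_iff hu]
  constructor
  · intro h0 v
    exact congrArg (fun L ↦ L v) ((h.hasFDerivAt_height hu q).unique h0)
  · intro h0
    convert h.hasFDerivAt_height hu q using 1
    ext1 v
    exact (h0 v).symm

/-! ### Spherical distance functions and height functions -/

lemma inner_lt_one_of_ne {p x : E} (hp : p ∈ sphere (0 : E) 1) (hx : x ∈ sphere (0 : E) 1)
    (h1 : x ≠ p) (h2 : x ≠ -p) : inner ℝ p x ≠ 1 ∧ inner ℝ p x ≠ -1 := by
  rw [mem_sphere_zero_iff_norm] at hp hx
  constructor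
  · intro h
    exact h1 ((inner_eq_one_iff_of_norm_eq_one hp hx).1 h).symm
  · intro h
    refine h2 (neg_eq_iff_eq_neg.1 ((inner_eq_one_iff_of_norm_eq_one (𝕜 := ℝ) hp
      (by rwa [norm_neg] : ‖-x‖ = 1)).1 ?_).symm)
    rw [inner_neg_right, h, neg_neg]

lemma abs_inner_le_one_of_mem_sphere {p x : E} (hp : p ∈ sphere (0 : E) 1)
    (hx : x ∈ sphere (0 : E) 1) : -1 ≤ inner ℝ p x ∧ inner ℝ p x ≤ 1 := by
  rw [mem_sphere_zero_iff_norm] at hp hx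
  have := abs_real_inner_le_norm p x
  rw [hp, hx, one_mul] at this
  exact abs_le.1 this

section Sphere

variable (hM : M ⊆ sphere 0 1) {p : E} (hp : p ∈ sphere (0 : E) 1)
include hM hp

/-- Off the poles, arccos is differentiable at the height, and cos recovers the height from the
distance. -/
lemma IsLocalParam.hasFDerivAt_sphDist_iff (h : IsLocalParam d M U c) {u} (hu : u ∈ U)
    (h1 : c u ≠ p) (h2 : c u ≠ -p) :
    HasFDerivAt (sphDist p ∘ c) (0 : EuclideanSpace ℝ (Fin d) →L[ℝ] ℝ) u ↔
      HasFDerivAt (height p ∘ c) (0 : EuclideanSpace ℝ (Fin d) →L[ℝ] ℝ) u := by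
  obtain ⟨hn1, hn2⟩ := inner_lt_one_of_ne hp (hM (h.mem hu)) h1 h2
  constructor
  · intro hd
    have h3 := (Real.hasDerivAt_cos _).comp_hasFDerivAt u hd
    rw [smul_zero] at h3
    refine h3.congr_of_eventuallyEq ?_
    filter_upwards [h.isOpen.mem_nhds hu] with y hy
    have := abs_inner_le_one_of_mem_sphere hp (hM (h.mem hy))
    exact (Real.cos_arccos this.1 this.2).symm
  · intro hd
    have h3 := (Real.hasDerivAt_arccos hn2 hn1).comp_hasFDerivAt u hd
    rwa [smul_zero] at h3

lemma isCriticalPt_sphDist_iff (hsub : IsSubmanifold d M) {x : E} (hx : x ∈ M)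
    (h1 : x ≠ p) (h2 : x ≠ -p) :
    IsCriticalPt d M (sphDist p) x ↔ IsCriticalPt d M (height p) x := by
  obtain ⟨U, c, h, u, hu, rfl⟩ := hsub x hx
  rw [h.isCriticalPt_iff hu, h.isCriticalPt_iff hu, h.hasFDerivAt_sphDist_iff hM hp hu h1 h2]

/-- On the unit sphere the height attains its maximum 1 at p and its minimum -1 at -p. -/
lemma isCriticalPt_height_self (hsub : IsSubmanifold d M) {x : E} (hx : x ∈ M)
    (h1 : x = p ∨ x = -p) : IsCriticalPt d M (height p) x := by
  obtain ⟨U, c, h, u, hu, rfl⟩ := hsub x hx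
  rw [h.isCriticalPt_iff hu]
  have hd := h.hasFDerivAt_height hu p
  have hpp : inner ℝ p p = (1 : ℝ) := by
    rw [real_inner_self_eq_norm_sq, mem_sphere_zero_iff_norm.1 hp, one_pow]
  have hext : IsLocalExtr (height p ∘ c) u := by
    rcases h1 with h1 | h1
    · right
      filter_upwards [h.isOpen.mem_nhds hu] with y hy
      change inner ℝ p (c y) ≤ inner ℝ p (c u)
      rw [h1, hpp]
      exact (abs_inner_le_one_of_mem_sphere hp (hM (h.mem hy))).2
    · left
      filter_upwards [h.isOpen.mem_nhds hu] with y hy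
      change inner ℝ p (c u) ≤ inner ℝ p (c y)
      rw [h1, inner_neg_right, hpp]
      exact (abs_inner_le_one_of_mem_sphere hp (hM (h.mem hy))).1
  rw [hext.hasFDerivAt_eq_zero hd] at hd
  exact hd

/-- The poles, counted for d_p by convention, are honest critical points of the height; hence
tautness can be tested with linear functions. -/
lemma sphDistCriticalSet_eq (hsub : IsSubmanifold d M) :
    sphDistCriticalSet d M p = heightCriticalSet d M p := by
  ext x
  refine and_congr_right fun hx ↦ ?_
  constructor
  · intro h
    by_cases h1 : x = p ∨ x = -p
    · exact isCriticalPt_height_self hM hp hsub hx h1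
    · push Not at h1
      rw [← isCriticalPt_sphDist_iff hM hp hsub hx h1.1 h1.2]
      simpa [h1.1, h1.2] using h
  · intro h
    by_cases h1 : x = p ∨ x = -p
    · exact h1.imp_right Or.inl
    · push Not at h1
      exact Or.inr (Or.inr ((isCriticalPt_sphDist_iff hM hp hsub hx h1.1 h1.2).2 h))

lemma IsLocalParam.isNondegCriticalPt_sphDist_iff (h : IsLocalParam d M U c) {u} (hu : u ∈ U)
    (h1 : c u ≠ p) (h2 : c u ≠ -p)
    (h0 : HasFDerivAt (height p ∘ c) (0 : EuclideanSpace ℝ (Fin d) →L[ℝ] ℝ) u) :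
    IsNondegCriticalPt d M (sphDist p) (c u) ↔ NondegAt (height p ∘ c) u := by
  obtain ⟨hn1, hn2⟩ := inner_lt_one_of_ne hp (hM (h.mem hu)) h1 h2
  have hf := h.contDiffAt_height_two hu p
  have ha : ContDiffAt ℝ 2 Real.arccos ((height p ∘ c) u) := Real.contDiffAt_arccos hn2 hn1
  have hb := abs_inner_le_one_of_mem_sphere hp (hM (h.mem hu))
  have hcomp : sphDist p ∘ c = Real.arccos ∘ (height p ∘ c) := rfl
  rw [h.isNondegCriticalPt_iff hu (by rw [hcomp]; exact ha.comp u hf)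
    ((h.hasFDerivAt_sphDist_iff hM hp hu h1 h2).2 h0), hcomp]
  refine nondegAt_real_comp_iff hf ha h0.fderiv ?_
  change deriv Real.arccos (inner ℝ p (c u)) ≠ 0
  rw [Real.deriv_arccos, neg_ne_zero]
  refine one_div_ne_zero (Real.sqrt_ne_zero'.2 ?_)
  have h3 := lt_of_le_of_ne hb.1 hn2.symm
  have h4 := lt_of_le_of_ne hb.2 hn1
  nlinarith

/-- A spherical distance function is nondegenerate if and only if the height function is
nondegenerate at its critical points other than the poles. -/
lemma isNondegSphDist_iff (hsub : IsSubmanifold d M) :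
    IsNondegSphDist d M p ↔ ∀ U c, IsLocalParam d M U c → ∀ u ∈ U, c u ≠ p → c u ≠ -p →
      HasFDerivAt (height p ∘ c) (0 : EuclideanSpace ℝ (Fin d) →L[ℝ] ℝ) u →
      NondegAt (height p ∘ c) u := by
  constructor
  · intro hn U c h u hu h1 h2 h0
    refine (h.isNondegCriticalPt_sphDist_iff hM hp hu h1 h2 h0).1 (hn _ (h.mem hu) h1 h2 ?_)
    rw [h.isCriticalPt_iff hu, h.hasFDerivAt_sphDist_iff hM hp hu h1 h2]
    exact h0
  · intro hn x hx h1 h2 h3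
    obtain ⟨U, c, h, u, hu, rfl⟩ := hsub x hx
    rw [h.isCriticalPt_iff hu, h.hasFDerivAt_sphDist_iff hM hp hu h1 h2] at h3
    exact (h.isNondegCriticalPt_sphDist_iff hM hp hu h1 h2 h3).2 (hn U c h u hu h1 h2 h3)

end Sphere

lemma IsLocalParam.eventually_not_isCriticalPt (h : IsLocalParam d M U c) {u} (hu : u ∈ U) {p : E}
    (hn : NondegAt (height p ∘ c) u) :
    ∀ᶠ x in 𝓝[M] (c u), IsCriticalPt d M (height p) x → x = c u := by
  have h1 := hn.eventually_ne (h.contDiffAt_height_two hu p)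
  rw [eventually_nhdsWithin_iff] at h1
  rw [← h.map_nhds hu, eventually_map]
  filter_upwards [h1, h.isOpen.mem_nhds hu] with y hy hyU hcrit
  by_contra hne
  refine hy (fun hyu ↦ hne ?_) ((h.isCriticalPt_iff hyU _).1 hcrit).fderiv
  rw [mem_singleton_iff.1 hyu]

end Submanifold

end HopfTaut
end

noncomputable section

set_option linter.unusedSectionVars false

namespace HopfTaut

/-! ### The Clifford action of `ℝ⁵` on `ℍ²` and the right action of `ℍ` -/

lemma R8.ext' {x y : R8} (h1 : x.fst = y.fst) (h2 : x.snd = y.snd) : x = y :=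
  WithLp.ofLp_injective 2 (Prod.ext h1 h2)

/-- The Clifford action of `ℝ⁵ = ℍ × ℝ` on `ℍ²`. -/
def cl (y : R5) (x : R8) : R8 :=
  WithLp.toLp 2 (y.snd • x.fst + y.fst * x.snd, star y.fst * x.fst - y.snd • x.snd)

/-- The right action of `ℍ` on `ℍ²`. -/
def rmul (x : R8) (g : ℍ[ℝ]) : R8 := WithLp.toLp 2 (x.fst * g, x.snd * g)

/-- The quaternionic Hermitian product of `ℍ²`. -/
def qp (p x : R8) : ℍ[ℝ] := star p.fst * x.fst + star p.snd * x.snd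

@[simp] lemma cl_fst (y : R5) (x : R8) : (cl y x).fst = y.snd • x.fst + y.fst * x.snd := rfl
@[simp] lemma cl_snd (y : R5) (x : R8) : (cl y x).snd = star y.fst * x.fst - y.snd • x.snd := rfl
@[simp] lemma rmul_fst (x : R8) (g : ℍ[ℝ]) : (rmul x g).fst = x.fst * g := rfl
@[simp] lemma rmul_snd (x : R8) (g : ℍ[ℝ]) : (rmul x g).snd = x.snd * g := rfl
@[simp] lemma hopf_fst (x : R8) : (hopf x).fst = (2 : ℝ) • (x.fst * star x.snd) := rfl
@[simp] lemma hopf_snd (x : R8) : (hopf x).snd = ‖x.fst‖ ^ 2 - ‖x.snd‖ ^ 2 := rfl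

lemma norm_sq_quaternion (a : ℍ[ℝ]) :
    ‖a‖ ^ 2 = a.re ^ 2 + a.imI ^ 2 + a.imJ ^ 2 + a.imK ^ 2 := by
  rw [sq, ← Quaternion.normSq_eq_norm_mul_self, Quaternion.normSq_def']

lemma norm_sq_R8 (x : R8) : ‖x‖ ^ 2 = ‖x.fst‖ ^ 2 + ‖x.snd‖ ^ 2 :=
  WithLp.prod_norm_sq_eq_of_L2 x

lemma inner_cl_left (y : R5) (x x' : R8) : inner ℝ (cl y x) x' = inner ℝ x (cl y x') := by
  simp [Quaternion.inner_def]
  ring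

/-- The components of h are the quadratic forms of the Clifford operators; this is the link between
the Hopf map and linear algebra. -/
lemma inner_cl_self (y : R5) (x : R8) : inner ℝ (cl y x) x = inner ℝ y (hopf x) := by
  simp [Quaternion.inner_def, norm_sq_quaternion]
  ring

lemma cl_cl_add (y w : R5) (x : R8) :
    cl y (cl w x) + cl w (cl y x) = (2 * inner ℝ y w) • x := by
  refine R8.ext' ?_ ?_
  · ext <;> simp [Quaternion.inner_def] <;> ring
  · ext <;> simp [Quaternion.inner_def] <;> ring

lemma cl_cl (y : R5) (x : R8) : cl y (cl y x) = ‖y‖ ^ 2 • x := by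
  have := cl_cl_add y y x
  rw [real_inner_self_eq_norm_sq, ← two_smul ℝ, mul_smul] at this
  exact smul_right_injective _ two_ne_zero this

lemma cl_hopf_self (x : R8) : cl (hopf x) x = ‖x‖ ^ 2 • x := by
  rw [norm_sq_R8]
  refine R8.ext' ?_ ?_
  · ext <;> simp [norm_sq_quaternion] <;> ring
  · ext <;> simp [norm_sq_quaternion] <;> ring

lemma cl_rmul (y : R5) (x : R8) (g : ℍ[ℝ]) : cl y (rmul x g) = rmul (cl y x) g := by
  refine R8.ext' ?_ ?_
  · simp [add_mul, mul_assoc]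
  · simp [sub_mul, mul_assoc]

lemma rmul_one (x : R8) : rmul x 1 = x := R8.ext' (mul_one _) (mul_one _)

lemma rmul_coe (x : R8) (r : ℝ) : rmul x (r : ℍ[ℝ]) = r • x :=
  R8.ext' (Quaternion.mul_coe_eq_smul _ _) (Quaternion.mul_coe_eq_smul _ _)

lemma norm_rmul (x : R8) (g : ℍ[ℝ]) : ‖rmul x g‖ = ‖x‖ * ‖g‖ := by
  have : ‖rmul x g‖ ^ 2 = (‖x‖ * ‖g‖) ^ 2 := by
    rw [mul_pow, norm_sq_R8, norm_sq_R8, rmul_fst, rmul_snd, norm_mul, norm_mul]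
    ring
  exact (sq_eq_sq₀ (norm_nonneg _) (by positivity)).1 this

lemma hopf_rmul (x : R8) (g : ℍ[ℝ]) : hopf (rmul x g) = ‖g‖ ^ 2 • hopf x := by
  refine WithLp.ofLp_injective 2 (Prod.ext ?_ ?_)
  · change (2 : ℝ) • (x.fst * g * star (x.snd * g)) = ‖g‖ ^ 2 • ((2 : ℝ) • (x.fst * star x.snd))
    rw [star_mul, mul_assoc, ← mul_assoc g, Quaternion.self_mul_star,
      Quaternion.normSq_eq_norm_mul_self, ← mul_assoc, Quaternion.mul_coe_eq_smul, smul_mul_assoc,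
      smul_comm, sq]
  · change ‖x.fst * g‖ ^ 2 - ‖x.snd * g‖ ^ 2 = ‖g‖ ^ 2 * (‖x.fst‖ ^ 2 - ‖x.snd‖ ^ 2)
    rw [norm_mul, norm_mul]
    ring

lemma hopf_smul (r : ℝ) (x : R8) : hopf (r • x) = r ^ 2 • hopf x := by
  rw [← rmul_coe, hopf_rmul, Quaternion.norm_coe, Real.norm_eq_abs, sq_abs]

lemma hopf_neg (x : R8) : hopf (-x) = hopf x := by
  have := hopf_smul (-1) x
  simpa using this

lemma qp_rmul (p x : R8) (g : ℍ[ℝ]) : qp p (rmul x g) = qp p x * g := by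
  simp [qp, add_mul, mul_assoc]

lemma qp_self (p : R8) : qp p p = ((‖p‖ ^ 2 : ℝ) : ℍ[ℝ]) := by
  rw [qp, Quaternion.star_mul_self, Quaternion.star_mul_self, norm_sq_R8,
    Quaternion.normSq_eq_norm_mul_self, Quaternion.normSq_eq_norm_mul_self, ← sq, ← sq]
  simp

lemma qp_add (p x x' : R8) : qp p (x + x') = qp p x + qp p x' := by
  simp [qp, mul_add]
  abel

lemma qp_smul (p : R8) (r : ℝ) (x : R8) : qp p (r • x) = r • qp p x := by
  simp [qp]

/-- The product is real because `cl y` is quaternionic Hermitian. Hence the section through p has a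
real product with p, and p has no component along the fibre at points of the section. -/
lemma qp_cl_self (p : R8) (y : R5) : qp p (cl y p) = ((inner ℝ y (hopf p) : ℝ) : ℍ[ℝ]) := by
  ext
  · rw [Quaternion.re_coe]
    simp [qp, Quaternion.inner_def, norm_sq_quaternion]
    ring
  · rw [Quaternion.imI_coe]
    simp [qp]
    ring
  · rw [Quaternion.imJ_coe]
    simp [qp]
    ring
  · rw [Quaternion.imK_coe]
    simp [qp]
    ring

lemma re_qp (p x : R8) : (qp p x).re = inner ℝ p x := by
  simp [qp, Quaternion.inner_def]

/-- For a unit vector x, both sides are the orthogonal projection of x' to the quaternionic line of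
x, which is the 1-eigenspace of `cl (hopf x)`. -/
lemma rmul_qp (x x' : R8) :
    rmul x (qp x x') = (1 / 2 : ℝ) • (‖x‖ ^ 2 • x' + cl (hopf x) x') := by
  rw [norm_sq_R8]
  refine R8.ext' ?_ ?_
  · ext <;> simp [qp, norm_sq_quaternion] <;> ring
  · ext <;> simp [qp, norm_sq_quaternion] <;> ring

lemma norm_cl (y : R5) (x : R8) : ‖cl y x‖ = ‖y‖ * ‖x‖ := by
  have : ‖cl y x‖ ^ 2 = (‖y‖ * ‖x‖) ^ 2 := by
    rw [← real_inner_self_eq_norm_sq, inner_cl_left, cl_cl, inner_smul_right,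
      real_inner_self_eq_norm_sq, mul_pow]
  exact (sq_eq_sq₀ (norm_nonneg _) (by positivity)).1 this

/-- The Clifford action as a continuous bilinear map. -/
def clB : R5 →L[ℝ] R8 →L[ℝ] R8 :=
  LinearMap.toContinuousLinearMap
    ((LinearMap.toContinuousLinearMap : (R8 →ₗ[ℝ] R8) ≃ₗ[ℝ] R8 →L[ℝ] R8).toLinearMap ∘ₗ
      LinearMap.mk₂ ℝ cl
        (fun y y' x ↦ R8.ext' (by simp [add_smul, add_mul]; abel)
          (by simp [add_smul, add_mul]; abel))
        (fun r y x ↦ R8.ext' (by simp [mul_smul]) (by simp [mul_smul, smul_sub]))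
        (fun y x x' ↦ R8.ext' (by simp [mul_add]; abel) (by simp [mul_add]; abel))
        (fun r y x ↦ R8.ext' (by simp [smul_comm r]) (by simp [smul_comm r, smul_sub])))

/-- The right action of `ℍ` as a continuous bilinear map. -/
def rmulB : R8 →L[ℝ] ℍ[ℝ] →L[ℝ] R8 :=
  LinearMap.toContinuousLinearMap
    ((LinearMap.toContinuousLinearMap : (ℍ[ℝ] →ₗ[ℝ] R8) ≃ₗ[ℝ] ℍ[ℝ] →L[ℝ] R8).toLinearMap ∘ₗ
      LinearMap.mk₂ ℝ rmul
        (fun y y' x ↦ R8.ext' (by simp [add_mul]) (by simp [add_mul]))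
        (fun r y x ↦ R8.ext' (by simp) (by simp))
        (fun y x x' ↦ R8.ext' (by simp [mul_add]) (by simp [mul_add]))
        (fun r y x ↦ R8.ext' (by simp) (by simp)))

lemma clB_apply (y : R5) (x : R8) : clB y x = cl y x := rfl
lemma rmulB_apply (x : R8) (g : ℍ[ℝ]) : rmulB x g = rmul x g := rfl

/-- The Hermitian product with a fixed vector as a continuous linear map. -/
def qpL (p : R8) : R8 →L[ℝ] ℍ[ℝ] :=
  LinearMap.toContinuousLinearMap
    { toFun := qp p, map_add' := qp_add p, map_smul' := fun r x ↦ qp_smul p r x }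

lemma contDiff_hopf : ContDiff ℝ ∞ hopf := by
  have h1 : ContDiff ℝ ∞ fun x : R8 ↦ x.fst := (WithLp.fstL 2 ℝ ℍ[ℝ] ℍ[ℝ]).contDiff
  have h2 : ContDiff ℝ ∞ fun x : R8 ↦ x.snd := (WithLp.sndL 2 ℝ ℍ[ℝ] ℍ[ℝ]).contDiff
  let S : ℍ[ℝ] →ₗ[ℝ] ℍ[ℝ] :=
    { toFun := star, map_add' := star_add, map_smul' := fun r a ↦ Quaternion.star_smul r a }
  have h3 : ContDiff ℝ ∞ fun x : R8 ↦ star x.snd := S.toContinuousLinearMap.contDiff.comp h2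
  exact (WithLp.prodContinuousLinearEquiv 2 ℝ ℍ[ℝ] ℝ).symm.contDiff.comp
    (((h1.mul h3).const_smul (2 : ℝ)).prodMk ((h1.norm_sq ℝ).sub (h2.norm_sq ℝ)))

lemma finrank_R8 : Module.finrank ℝ R8 = 8 := by
  rw [(WithLp.linearEquiv 2 ℝ (ℍ[ℝ] × ℍ[ℝ])).finrank_eq]
  simp [Quaternion.finrank_eq_four]

lemma finrank_R5 : Module.finrank ℝ R5 = 5 := by
  rw [(WithLp.linearEquiv 2 ℝ (ℍ[ℝ] × ℝ)).finrank_eq]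
  simp [Quaternion.finrank_eq_four]

/-! ### The fibres of the Hopf map and local sections -/

lemma norm_eq_one_of_mem {E : Type} [NormedAddCommGroup E] {x : E} (hx : x ∈ sphere (0 : E) 1) :
    ‖x‖ = 1 := mem_sphere_zero_iff_norm.1 hx

/-- The fibre over `y` is the unit sphere of the eigenspace of the Clifford action. -/
lemma hopf_eq_iff {x : R8} {y : R5} (hx : x ∈ sphere (0 : R8) 1) (hy : y ∈ sphere (0 : R5) 1) :
    hopf x = y ↔ cl y x = x := by
  constructor
  · rintro rfl
    rw [cl_hopf_self, norm_eq_one_of_mem hx, one_pow, one_smul]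
  · intro h
    have h1 := inner_cl_self y x
    rw [h, real_inner_self_eq_norm_sq, norm_eq_one_of_mem hx, one_pow] at h1
    exact ((inner_eq_one_iff_of_norm_eq_one (𝕜 := ℝ) (norm_eq_one_of_mem hy)
      (norm_eq_one_of_mem (hopf_mem_sphere hx))).1 h1.symm).symm

/-- The unnormalized local section of the Hopf map through `p`. -/
def pre (p : R8) (y : R5) : R8 := p + cl y p

/-- The local section of the Hopf map through `p`. -/
def sec (p : R8) (y : R5) : R8 := ‖pre p y‖⁻¹ • pre p y

lemma cl_smul (y : R5) (r : ℝ) (x : R8) : cl y (r • x) = r • cl y x := (clB y).map_smul r x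

lemma cl_add (y : R5) (x x' : R8) : cl y (x + x') = cl y x + cl y x' := (clB y).map_add x x'

section Section

variable {p : R8} {y : R5} (hp : p ∈ sphere (0 : R8) 1) (hy : y ∈ sphere (0 : R5) 1)
include hp hy

lemma norm_pre_sq : ‖pre p y‖ ^ 2 = 2 * (1 + inner ℝ y (hopf p)) := by
  rw [pre, norm_add_sq_real, norm_cl, norm_eq_one_of_mem hp, norm_eq_one_of_mem hy,
    real_inner_comm, inner_cl_self]
  ring

lemma one_add_inner_pos (h : y ≠ -hopf p) : 0 < 1 + inner ℝ y (hopf p) := by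
  have hh := norm_eq_one_of_mem (hopf_mem_sphere hp)
  have hy' := norm_eq_one_of_mem hy
  have h1 := abs_le.1 (abs_real_inner_le_norm y (hopf p))
  rw [hy', hh, one_mul] at h1
  rcases h1.1.eq_or_lt with h2 | h2
  · refine absurd ((inner_eq_one_iff_of_norm_eq_one (𝕜 := ℝ) hy'
      (by rwa [norm_neg] : ‖-hopf p‖ = 1)).1 ?_) h
    rw [inner_neg_right, ← h2, neg_neg]
  · linarith

lemma norm_pre_pos (h : y ≠ -hopf p) : 0 < ‖pre p y‖ := by
  have h1 := one_add_inner_pos hp hy h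
  have h2 := norm_pre_sq hp hy
  refine lt_of_le_of_ne (norm_nonneg _) fun h3 ↦ ?_
  rw [← h3] at h2
  linarith

lemma cl_pre : cl y (pre p y) = pre p y := by
  rw [pre, cl_add, cl_cl, norm_eq_one_of_mem hy, one_pow, one_smul, add_comm]

lemma sec_mem_sphere (h : y ≠ -hopf p) : sec p y ∈ sphere (0 : R8) 1 := by
  rw [mem_sphere_zero_iff_norm, sec, norm_smul, norm_inv, norm_norm,
    inv_mul_cancel₀ (norm_pre_pos hp hy h).ne']

lemma cl_sec : cl y (sec p y) = sec p y := by
  rw [sec, cl_smul, cl_pre hp hy]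

lemma hopf_sec (h : y ≠ -hopf p) : hopf (sec p y) = y :=
  (hopf_eq_iff (sec_mem_sphere hp hy h) hy).2 (cl_sec hp hy)

lemma qp_pre : qp p (pre p y) = ((1 + inner ℝ y (hopf p) : ℝ) : ℍ[ℝ]) := by
  rw [pre, qp_add, qp_self, qp_cl_self, norm_eq_one_of_mem hp, one_pow]
  simp

lemma qp_sec (h : y ≠ -hopf p) : qp p (sec p y) = ((‖pre p y‖ / 2 : ℝ) : ℍ[ℝ]) := by
  have h1 := norm_pre_pos hp hy h
  rw [sec, qp_smul, qp_pre hp hy, ← Quaternion.coe_smul]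
  congr 1
  rw [smul_eq_mul, inv_mul_eq_div, div_eq_div_iff h1.ne' two_ne_zero]
  linarith [norm_pre_sq hp hy, sq ‖pre p y‖]

omit hy in
/-- Every point of the fibre is obtained from the local section by the right action. -/
lemma rmul_sec_qp {x : R8} (hx : x ∈ sphere (0 : R8) 1) (h : hopf x ≠ -hopf p) :
    rmul (sec p (hopf x)) (qp (sec p (hopf x)) x) = x := by
  have hy := hopf_mem_sphere hx
  rw [rmul_qp, norm_eq_one_of_mem (sec_mem_sphere hp hy h), hopf_sec hp hy h,
    (hopf_eq_iff hx hy).1 rfl, one_pow, one_smul, ← two_smul ℝ x, smul_smul]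
  norm_num

lemma qp_sec_sec (h : y ≠ -hopf p) (g : ℍ[ℝ]) : qp (sec p y) (rmul (sec p y) g) = g := by
  rw [qp_rmul, qp_self, norm_eq_one_of_mem (sec_mem_sphere hp hy h)]
  simp

end Section

/-- The section through p reaches every y except -h(p). The points (1,0) and (0,1) have different
images, so one of them works. -/
lemma exists_hopf_eq {y : R5} (hy : y ∈ sphere (0 : R5) 1) :
    ∃ p ∈ sphere (0 : R8) 1, hopf p = y := by
  by_contra! hne
  have key (p : R8) (hp : p ∈ sphere (0 : R8) 1) : y = -hopf p := by
    by_contra h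
    exact hne _ (sec_mem_sphere hp hy h) (hopf_sec hp hy h)
  have h1 := key (WithLp.toLp 2 (1, 0)) (by simp)
  have h2 := key (WithLp.toLp 2 (0, 1)) (by simp)
  have h3 := congrArg (fun z : R5 ↦ z.snd) (h1.symm.trans h2)
  simp [hopf] at h3
  norm_num at h3

/-- The Hopf fibration is trivial over subsets which miss a point. -/
def trivialization (M : Set R5) (hM : M ⊆ sphere 0 1) (p : R8) (hp : p ∈ sphere (0 : R8) 1)
    (h : -hopf p ∉ M) : (M × sphere (0 : ℍ[ℝ]) 1) ≃ₜ hopfPreimage M where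
  toFun q := ⟨rmul (sec p q.1.1) q.2.1, by
    have hy := hM q.1.2
    have hne : q.1.1 ≠ -hopf p := fun h' ↦ h (h' ▸ q.1.2)
    have hg := norm_eq_one_of_mem q.2.2
    refine ⟨?_, ?_⟩
    · rw [mem_sphere_zero_iff_norm, norm_rmul, hg,
        norm_eq_one_of_mem (sec_mem_sphere hp hy hne), one_mul]
    · rw [hopf_rmul, hopf_sec hp hy hne, hg, one_pow, one_smul]
      exact q.1.2⟩
  invFun x := (⟨hopf x.1, x.2.2⟩, ⟨qp (sec p (hopf x.1)) x.1, by
    have hne : hopf x.1 ≠ -hopf p := fun h' ↦ h (h' ▸ x.2.2)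
    have h1 := congrArg norm (rmul_sec_qp hp x.2.1 hne)
    rwa [norm_rmul, norm_eq_one_of_mem (sec_mem_sphere hp (hopf_mem_sphere x.2.1) hne), one_mul,
      norm_eq_one_of_mem x.2.1, ← mem_sphere_zero_iff_norm] at h1⟩)
  left_inv q := by
    have hy := hM q.1.2
    have hne : q.1.1 ≠ -hopf p := fun h' ↦ h (h' ▸ q.1.2)
    have hg := norm_eq_one_of_mem q.2.2
    have h1 : hopf (rmul (sec p q.1.1) q.2.1) = q.1.1 := by
      rw [hopf_rmul, hopf_sec hp hy hne, hg, one_pow, one_smul]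
    refine Prod.ext (Subtype.ext h1) (Subtype.ext ?_)
    change qp (sec p (hopf (rmul (sec p q.1.1) q.2.1))) (rmul (sec p q.1.1) q.2.1) = q.2.1
    rw [h1, qp_sec_sec hp hy hne]
  right_inv x := by
    have hne : hopf x.1 ≠ -hopf p := fun h' ↦ h (h' ▸ x.2.2)
    exact Subtype.ext (rmul_sec_qp hp x.2.1 hne)
  continuous_toFun := by
    have hpre : Continuous (pre p) := continuous_const.add (clB.flip p).continuous
    have h1 : Continuous fun q : M × sphere (0 : ℍ[ℝ]) 1 ↦ sec p q.1.1 := by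
      have h2 : Continuous fun q : M × sphere (0 : ℍ[ℝ]) 1 ↦ pre p q.1.1 :=
        hpre.comp (continuous_subtype_val.comp continuous_fst)
      refine (h2.norm.inv₀ fun q ↦ ?_).smul h2
      exact (norm_pre_pos hp (hM q.1.2) (fun h' ↦ h (h' ▸ q.1.2))).ne'
    refine Continuous.subtype_mk ?_ _
    exact (rmulB.continuous.comp h1).clm_apply (continuous_subtype_val.comp continuous_snd)
  continuous_invFun := by
    have hpre : Continuous (pre p) := continuous_const.add (clB.flip p).continuous
    have hh : Continuous fun x : hopfPreimage M ↦ hopf x.1 :=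
      contDiff_hopf.continuous.comp continuous_subtype_val
    have h1 : Continuous fun x : hopfPreimage M ↦ sec p (hopf x.1) := by
      have h2 : Continuous fun x : hopfPreimage M ↦ pre p (hopf x.1) := hpre.comp hh
      refine (h2.norm.inv₀ fun x ↦ ?_).smul h2
      exact (norm_pre_pos hp (hopf_mem_sphere x.2.1) (fun h' ↦ h (h' ▸ x.2.2))).ne'
    refine Continuous.prodMk (hh.subtype_mk _) (Continuous.subtype_mk ?_ _)
    have hf : Continuous fun x : R8 ↦ x.fst := (WithLp.fstL 2 ℝ ℍ[ℝ] ℍ[ℝ]).continuous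
    have hs : Continuous fun x : R8 ↦ x.snd := (WithLp.sndL 2 ℝ ℍ[ℝ] ℍ[ℝ]).continuous
    exact (((hf.comp h1).star).mul (hf.comp continuous_subtype_val)).add
      (((hs.comp h1).star).mul (hs.comp continuous_subtype_val))

end HopfTaut
end

noncomputable section

namespace HopfTaut

open Filter Topology

/-! ### Local parametrizations of the preimage under the Hopf map -/

section Inverse

variable {E : Type} [NormedAddCommGroup E] [InnerProductSpace ℝ E] {d : ℕ} {M : Set E}
  {U : Set (EuclideanSpace ℝ (Fin d))} {c : EuclideanSpace ℝ (Fin d) → E}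

lemma IsLocalParam.injOn (h : IsLocalParam d M U c) : InjOn c U := by
  obtain ⟨hm, he⟩ := h.isOpenEmbedding
  intro u hu u' hu' heq
  have := @he.injective ⟨u, hu⟩ ⟨u', hu'⟩ (Subtype.ext heq)
  exact congrArg Subtype.val this

/-- Trades the open embedding for a continuous inverse on a relatively open piece of M, a form that
can be written down for explicit charts; `IsLocalParam.of_inverse` goes back. -/
lemma IsLocalParam.exists_inverse (h : IsLocalParam d M U c) :
    ∃ (W : Set E) (s : E → EuclideanSpace ℝ (Fin d)), IsOpen W ∧ (∀ u ∈ U, c u ∈ W) ∧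
      ContinuousOn s (M ∩ W) ∧ ∀ x ∈ M ∩ W, s x ∈ U ∧ c (s x) = x := by
  obtain ⟨hm, he⟩ := h.isOpenEmbedding
  obtain ⟨W, hW, hWe⟩ := isOpen_induced_iff.1 he.isOpen_range
  have hmem {x : E} (hx : x ∈ M ∩ W) : ∃ u ∈ U, c u = x := by
    have : (⟨x, hx.1⟩ : M) ∈ Subtype.val ⁻¹' W := hx.2
    rw [hWe] at this
    obtain ⟨u, hu⟩ := this
    exact ⟨u.1, u.2, congrArg Subtype.val hu⟩
  choose! s hs using fun (x : E) (hx : x ∈ M ∩ W) ↦ hmem hx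
  refine ⟨W, s, hW, fun u hu ↦ ?_, fun x hx ↦ ?_, fun x hx ↦ hs x hx⟩
  · have : hm.restrict c U M ⟨u, hu⟩ ∈ Set.range (hm.restrict c U M) := ⟨_, rfl⟩
    rw [← hWe] at this
    exact this
  · rw [ContinuousWithinAt, nhdsWithin_inter_of_mem' (mem_nhdsWithin_of_mem_nhds (hW.mem_nhds hx.2))]
    have h1 := h.map_nhds (hs x hx).1
    rw [(hs x hx).2] at h1
    rw [← h1, tendsto_map'_iff]
    refine tendsto_id.congr' ?_
    filter_upwards [h.isOpen.mem_nhds (hs x hx).1,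
      (h.contDiffAt (hs x hx).1).continuousAt.preimage_mem_nhds
        (hW.mem_nhds (by rw [(hs x hx).2]; exact hx.2))] with u hu hu'
    have h2 := hs (c u) ⟨h.mem hu, hu'⟩
    exact (h.injOn h2.1 hu h2.2).symm

lemma IsLocalParam.of_inverse {W : Set E} {s : E → EuclideanSpace ℝ (Fin d)} (hU : IsOpen U)
    (hc : ContDiffOn ℝ ∞ c U) (himm : ∀ u ∈ U, Function.Injective (fderiv ℝ c u))
    (hW : IsOpen W) (hm : ∀ u ∈ U, c u ∈ M ∩ W) (hs : ContinuousOn s (M ∩ W))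
    (hsc : ∀ u ∈ U, s (c u) = u) (hcs : ∀ x ∈ M ∩ W, s x ∈ U ∧ c (s x) = x) :
    IsLocalParam d M U c := by
  have hm' : MapsTo c U M := fun u hu ↦ (hm u hu).1
  refine ⟨hU, hc, himm, hm', .of_continuous_injective_isOpenMap ?_ ?_ ?_⟩
  · exact hc.continuousOn.mapsToRestrict hm'
  · intro u u' h
    have : c u = c u' := congrArg Subtype.val h
    rw [Subtype.ext_iff, ← hsc u u.2, this, hsc u' u'.2]
  · intro O hO
    obtain ⟨O', hO', rfl⟩ := isOpen_induced_iff.1 hO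
    obtain ⟨T, hT, hTe⟩ := continuousOn_iff'.1 hs O' hO'
    refine isOpen_induced_iff.2 ⟨T ∩ W, hT.inter hW, ?_⟩
    ext ⟨x, hx⟩
    constructor
    · rintro ⟨h1, h2⟩
      have h3 : x ∈ s ⁻¹' O' ∩ (M ∩ W) := hTe ▸ ⟨h1, hx, h2⟩
      obtain ⟨h4, h5⟩ := hcs x h3.2
      exact ⟨⟨s x, h4⟩, h3.1, Subtype.ext h5⟩
    · rintro ⟨⟨u, hu⟩, h1, h2⟩
      have h3 : c u = x := congrArg Subtype.val h2
      subst h3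
      refine ⟨?_, (hm u hu).2⟩
      have : c u ∈ s ⁻¹' O' ∩ (M ∩ W) := by
        refine ⟨?_, hm u hu⟩
        rw [mem_preimage, hsc u hu]
        exact h1
      rw [hTe] at this
      exact this.1

end Inverse

/-! ### The central chart of the unit quaternions -/

/-- The imaginary quaternions. -/
def imag : ℝ × ℝ × ℝ →L[ℝ] ℍ[ℝ] :=
  LinearMap.toContinuousLinearMap
    { toFun := fun η ↦ ⟨0, η.1, η.2.1, η.2.2⟩
      map_add' := fun _ _ ↦ QuaternionAlgebra.ext (add_zero 0).symm rfl rfl rfl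
      map_smul' := fun r _ ↦ QuaternionAlgebra.ext (mul_zero r).symm rfl rfl rfl }

/-- The coordinates of the imaginary part. -/
def imCoord : ℍ[ℝ] →L[ℝ] ℝ × ℝ × ℝ :=
  LinearMap.toContinuousLinearMap
    { toFun := fun a ↦ (a.imI, a.imJ, a.imK)
      map_add' := fun a b ↦ by simp
      map_smul' := fun r a ↦ by simp }

/-- The real part. -/
def reL : ℍ[ℝ] →L[ℝ] ℝ :=
  LinearMap.toContinuousLinearMap
    { toFun := fun a ↦ a.re
      map_add' := fun a b ↦ by simp
      map_smul' := fun r a ↦ by simp }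

@[simp] lemma reL_apply (a : ℍ[ℝ]) : reL a = a.re := rfl
@[simp] lemma imCoord_imag (η : ℝ × ℝ × ℝ) : imCoord (imag η) = η := rfl
@[simp] lemma imCoord_one : imCoord 1 = 0 := rfl
@[simp] lemma re_imag (η : ℝ × ℝ × ℝ) : (imag η).re = 0 := rfl

lemma re_add_imag (a : ℍ[ℝ]) : (a.re : ℍ[ℝ]) + imag (imCoord a) = a :=
  QuaternionAlgebra.ext (add_zero _) (zero_add _) (zero_add _) (zero_add _)

lemma one_le_norm_one_add_imag (η : ℝ × ℝ × ℝ) : 1 ≤ ‖1 + imag η‖ := by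
  have h : 1 ≤ ‖1 + imag η‖ ^ 2 := by
    rw [norm_sq_quaternion]
    simp only [Quaternion.re_add, Quaternion.re_one, re_imag, add_zero]
    nlinarith [sq_nonneg (1 + imag η).imI, sq_nonneg (1 + imag η).imJ, sq_nonneg (1 + imag η).imK]
  nlinarith [norm_nonneg (1 + imag η)]

/-- The central projection of the tangent space at `1` to the unit quaternions. -/
def unitChart (η : ℝ × ℝ × ℝ) : ℍ[ℝ] := ‖1 + imag η‖⁻¹ • (1 + imag η)

lemma unitChart_zero : unitChart 0 = 1 := by simp [unitChart]

lemma norm_unitChart (η : ℝ × ℝ × ℝ) : ‖unitChart η‖ = 1 := by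
  have := one_le_norm_one_add_imag η
  rw [unitChart, norm_smul, norm_inv, norm_norm, inv_mul_cancel₀ (by linarith)]

lemma contDiff_unitChart : ContDiff ℝ ∞ unitChart := by
  rw [contDiff_iff_contDiffAt]
  intro η
  have h := one_le_norm_one_add_imag η
  have h0 : 1 + imag η ≠ 0 := norm_pos_iff.1 (by linarith)
  have h1 : ContDiffAt ℝ ∞ (fun η ↦ 1 + imag η) η := contDiffAt_const.add imag.contDiff.contDiffAt
  exact ((h1.norm ℝ h0).inv (by linarith)).smul h1

lemma hasFDerivAt_unitChart : HasFDerivAt unitChart imag 0 := by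
  have h1 : HasFDerivAt (fun η ↦ 1 + imag η) imag 0 := imag.hasFDerivAt.const_add 1
  have h2 : DifferentiableAt ℝ (fun η ↦ ‖1 + imag η‖) 0 :=
    (h1.differentiableAt).norm ℝ (by simp)
  -- The norm is minimal at 0, so the normalizing factor has zero derivative there.
  have h3 : IsLocalMin (fun η ↦ ‖1 + imag η‖) 0 := .of_forall fun η ↦ by
    simpa using one_le_norm_one_add_imag η
  have h4 := h2.hasFDerivAt
  rw [h3.fderiv_eq_zero] at h4
  have hn : ‖(1 : ℍ[ℝ]) + imag 0‖ ≠ 0 := by simp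
  have h5 := ((hasDerivAt_inv hn).comp_hasFDerivAt (0 : ℝ × ℝ × ℝ) h4).smul h1
  refine (h5.congr_fderiv ?_)
  refine ContinuousLinearMap.ext fun v ↦ ?_
  simp

/-- Splitting off three coordinates. -/
def splitCoord (d : ℕ) :
    EuclideanSpace ℝ (Fin (d + 3)) ≃L[ℝ] EuclideanSpace ℝ (Fin d) × (ℝ × ℝ × ℝ) :=
  ContinuousLinearEquiv.ofFinrankEq (by simp)

/-- Local coordinates on the preimage under the Hopf map: coordinates on the base and central
projection of the fibre. -/
def hopfChart {d : ℕ} (q : R8) (c : EuclideanSpace ℝ (Fin d) → R5)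
    (w : EuclideanSpace ℝ (Fin (d + 3))) : R8 :=
  rmul (sec q (c (splitCoord d w).1)) (unitChart (splitCoord d w).2)

lemma contDiff_pre (p : R8) : ContDiff ℝ ∞ (pre p) :=
  contDiff_const.add (clB.flip p).contDiff

lemma contDiffAt_sec {p : R8} (hp : p ∈ sphere (0 : R8) 1) {y : R5} (hy : y ∈ sphere (0 : R5) 1)
    (h : y ≠ -hopf p) : ContDiffAt ℝ ∞ (sec p) y := by
  have h1 := norm_pre_pos hp hy h
  have h2 : ContDiffAt ℝ ∞ (pre p) y := (contDiff_pre p).contDiffAt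
  exact ((h2.norm ℝ (norm_pos_iff.1 h1)).inv h1.ne').smul h2

/-! ### Product charts on the preimage -/

section Chart

variable {d : ℕ} {M : Set R5} {U : Set (EuclideanSpace ℝ (Fin d))}
  {c : EuclideanSpace ℝ (Fin d) → R5} {q : R8}

lemma hopfChart_mem (hM : M ⊆ sphere 0 1) (hq : q ∈ sphere (0 : R8) 1)
    {w : EuclideanSpace ℝ (Fin (d + 3))} (h1 : c (splitCoord d w).1 ∈ M)
    (h2 : c (splitCoord d w).1 ≠ -hopf q) :
    hopfChart q c w ∈ hopfPreimage M ∧ hopf (hopfChart q c w) = c (splitCoord d w).1 := by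
  have h3 : hopf (hopfChart q c w) = c (splitCoord d w).1 := by
    rw [hopfChart, hopf_rmul, norm_unitChart, hopf_sec hq (hM h1) h2, one_pow, one_smul]
  refine ⟨⟨?_, h3 ▸ h1⟩, h3⟩
  rw [mem_sphere_zero_iff_norm, hopfChart, norm_rmul, norm_unitChart, mul_one,
    norm_eq_one_of_mem (sec_mem_sphere hq (hM h1) h2)]

/-- The product of q with the section is a positive real, so the product with a chart point
remembers the direction of 1 + η; dividing by the real part recovers η. -/
lemma qp_hopfChart (hM : M ⊆ sphere 0 1) (hq : q ∈ sphere (0 : R8) 1)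
    {w : EuclideanSpace ℝ (Fin (d + 3))} (h1 : c (splitCoord d w).1 ∈ M)
    (h2 : c (splitCoord d w).1 ≠ -hopf q) :
    ∃ r : ℝ, 0 < r ∧ qp q (hopfChart q c w) = r • (1 + imag (splitCoord d w).2) := by
  have h3 := norm_pre_pos hq (hM h1) h2
  have h4 := one_le_norm_one_add_imag (splitCoord d w).2
  refine ⟨‖pre q (c (splitCoord d w).1)‖ / 2 * ‖1 + imag (splitCoord d w).2‖⁻¹, by positivity, ?_⟩
  rw [hopfChart, qp_rmul, qp_sec hq (hM h1) h2, unitChart, Quaternion.coe_mul_eq_smul, smul_smul]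

lemma hopfChart_leftInverse (hM : M ⊆ sphere 0 1) (hq : q ∈ sphere (0 : R8) 1)
    {w : EuclideanSpace ℝ (Fin (d + 3))} (h1 : c (splitCoord d w).1 ∈ M)
    (h2 : c (splitCoord d w).1 ≠ -hopf q) :
    0 < (qp q (hopfChart q c w)).re ∧ (qp q (hopfChart q c w)).re⁻¹ •
      imCoord (qp q (hopfChart q c w)) = (splitCoord d w).2 := by
  obtain ⟨r, hr, hr'⟩ := qp_hopfChart hM hq h1 h2
  have h : (qp q (hopfChart q c w)).re = r := by rw [hr']; simp
  rw [h, hr', map_smul, map_add, imCoord_one, imCoord_imag, zero_add, smul_smul,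
    inv_mul_cancel₀ hr.ne', one_smul]
  exact ⟨hr, rfl⟩

/-- The domain of the coordinates on the preimage. -/
def chartDomain (U : Set (EuclideanSpace ℝ (Fin d))) (c : EuclideanSpace ℝ (Fin d) → R5) (q : R8) :
    Set (EuclideanSpace ℝ (Fin (d + 3))) :=
  {w | (splitCoord d w).1 ∈ U ∧ c (splitCoord d w).1 ≠ -hopf q}

lemma IsLocalParam.hopfChart (h : IsLocalParam d M U c) (hM : M ⊆ sphere 0 1)
    (hq : q ∈ sphere (0 : R8) 1) :
    IsLocalParam (d + 3) (hopfPreimage M) (chartDomain U c q) (hopfChart q c) := by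
  obtain ⟨W, s, hW, hUW, hs, hcs⟩ := h.exists_inverse
  have hsc {u} (hu : u ∈ U) : s (c u) = u := by
    have h2 := hcs (c u) ⟨h.mem hu, hUW u hu⟩
    exact h.injOn h2.1 hu h2.2
  have hopen : IsOpen (chartDomain U c q) := by
    have h1 : IsOpen (U ∩ c ⁻¹' {-hopf q}ᶜ) :=
      h.contDiffOn.continuousOn.isOpen_inter_preimage h.isOpen isOpen_compl_singleton
    exact h1.preimage (continuous_fst.comp (splitCoord d).continuous)
  have hsmooth : ContDiffOn ℝ ∞ (HopfTaut.hopfChart q c) (chartDomain U c q) := by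
    intro w hw
    refine ContDiffAt.contDiffWithinAt ?_
    have h1 : ContDiffAt ℝ ∞ (fun w ↦ c (splitCoord d w).1) w :=
      (h.contDiffAt hw.1).comp w (contDiff_fst.comp (splitCoord d).contDiff).contDiffAt
    have h2 : ContDiffAt ℝ ∞ (fun w ↦ sec q (c (splitCoord d w).1)) w :=
      ContDiffAt.comp (g := sec q) w (contDiffAt_sec hq (hM (h.mem hw.1)) hw.2) h1
    have h3 : ContDiffAt ℝ ∞ (fun w ↦ unitChart (splitCoord d w).2) w :=
      (contDiff_unitChart.comp (contDiff_snd.comp (splitCoord d).contDiff)).contDiffAt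
    exact (rmulB.contDiff.contDiffAt.comp w h2).clm_apply h3
  have hcre : Continuous fun x ↦ (qp q x).re := (reL.comp (qpL q)).continuous
  -- The chart covers the half of each fibre where the product with q has positive real part; h
  -- gives the base coordinate and the quotient of imaginary by real part the fibre coordinate.
  refine IsLocalParam.of_inverse
    (W := {x | hopf x ∈ W ∧ hopf x ≠ -hopf q ∧ 0 < (qp q x).re})
    (s := fun x ↦ (splitCoord d).symm (s (hopf x), (qp q x).re⁻¹ • imCoord (qp q x)))
    hopen hsmooth ?_ ?_ ?_ ?_ ?_ ?_
  · intro w hw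
    have h1 : DifferentiableAt ℝ (HopfTaut.hopfChart q c) w :=
      (hsmooth.contDiffAt (hopen.mem_nhds hw)).differentiableAt (by simp)
    have hpos := (hopfChart_leftInverse hM hq (h.mem hw.1) hw.2).1
    -- A differentiable map whose composite with the chart is c × id in the split coordinates; that
    -- composite is an immersion, hence so is the chart.
    let G : R8 → R5 × (ℝ × ℝ × ℝ) := fun x ↦ (hopf x, (qp q x).re⁻¹ • imCoord (qp q x))
    have h2 : DifferentiableAt ℝ G (HopfTaut.hopfChart q c w) := by
      have h3 : DifferentiableAt ℝ (fun x ↦ (qp q x).re) (HopfTaut.hopfChart q c w) :=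
        (reL.comp (qpL q)).differentiableAt
      exact (contDiff_hopf.differentiable (by simp)).differentiableAt.prodMk
        ((h3.inv hpos.ne').smul (imCoord.comp (qpL q)).differentiableAt)
    have h4 : HasFDerivAt (fun w ↦ (c (splitCoord d w).1, (splitCoord d w).2))
        (((fderiv ℝ c (splitCoord d w).1).prodMap (.id ℝ _)).comp
          (splitCoord d : _ →L[ℝ] _)) w := by
      have h5 : HasFDerivAt (Prod.map c id) _ (splitCoord d w) :=
        HasFDerivAt.prodMap _ (h.differentiableAt hw.1).hasFDerivAt (hasFDerivAt_id _)
      exact h5.comp w (splitCoord d).hasFDerivAt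
    have h6 : G ∘ HopfTaut.hopfChart q c =ᶠ[𝓝 w]
        fun w ↦ (c (splitCoord d w).1, (splitCoord d w).2) := by
      filter_upwards [hopen.mem_nhds hw] with w' hw'
      exact Prod.ext (hopfChart_mem hM hq (h.mem hw'.1) hw'.2).2
        (hopfChart_leftInverse hM hq (h.mem hw'.1) hw'.2).2
    have h7 := (h2.hasFDerivAt.comp w h1.hasFDerivAt).unique (h4.congr_of_eventuallyEq h6)
    refine Function.Injective.of_comp (f := fderiv ℝ G (HopfTaut.hopfChart q c w)) ?_
    rw [← ContinuousLinearMap.coe_comp, h7, ContinuousLinearMap.coe_comp]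
    exact (Function.Injective.prodMap (h.immersion _ hw.1) Function.injective_id).comp
      (splitCoord d).injective
  · exact (hW.preimage contDiff_hopf.continuous).inter
      ((isOpen_compl_singleton.preimage contDiff_hopf.continuous).inter
        (isOpen_lt continuous_const hcre))
  · intro w hw
    obtain ⟨h1, h2⟩ := hopfChart_mem hM hq (h.mem hw.1) hw.2
    refine ⟨h1, ?_, ?_, (hopfChart_leftInverse hM hq (h.mem hw.1) hw.2).1⟩
    · rw [h2]
      exact hUW _ hw.1
    · rw [h2]
      exact hw.2
  · refine (splitCoord d).symm.continuous.comp_continuousOn (ContinuousOn.prodMk ?_ ?_)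
    · exact hs.comp contDiff_hopf.continuous.continuousOn fun x hx ↦ ⟨hx.1.2, hx.2.1⟩
    · exact (hcre.continuousOn.inv₀ fun x hx ↦ hx.2.2.2.ne').smul
        (imCoord.comp (qpL q)).continuous.continuousOn
  · intro w hw
    rw [ContinuousLinearEquiv.symm_apply_eq]
    refine Prod.ext ?_ (hopfChart_leftInverse hM hq (h.mem hw.1) hw.2).2
    rw [(hopfChart_mem hM hq (h.mem hw.1) hw.2).2, hsc hw.1]
  · rintro x ⟨hx, hx1, hx2, hx3⟩
    obtain ⟨h1, h2⟩ := hcs (hopf x) ⟨hx.2, hx1⟩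
    have hw1 : c (splitCoord d ((splitCoord d).symm
        (s (hopf x), (qp q x).re⁻¹ • imCoord (qp q x)))).1 = hopf x := by simpa using h2
    refine ⟨⟨by simpa using h1, by rw [hw1]; exact hx2⟩, ?_⟩
    have hnorm := norm_eq_one_of_mem hx.1
    rw [HopfTaut.hopfChart, hw1, ContinuousLinearEquiv.apply_symm_apply]
    have h3 : qp q x = ((‖pre q (hopf x)‖ / 2 : ℝ) : ℍ[ℝ]) * qp (sec q (hopf x)) x := by
      conv_lhs => rw [← rmul_sec_qp hq hx.1 hx2]
      rw [qp_rmul, qp_sec hq (hM hx.2) hx2]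
    have hpre := norm_pre_pos hq (hM hx.2) hx2
    have h4 : (1 : ℍ[ℝ]) + imag ((qp q x).re⁻¹ • imCoord (qp q x)) = (qp q x).re⁻¹ • qp q x := by
      conv_rhs => arg 2; rw [← re_add_imag (qp q x)]
      rw [smul_add, map_smul, ← Quaternion.coe_smul, smul_eq_mul, inv_mul_cancel₀ hx3.ne',
        Quaternion.coe_one]
    have hg : ‖qp (sec q (hopf x)) x‖ = 1 := by
      have h5 := congrArg norm (rmul_sec_qp hq hx.1 hx2)
      rwa [norm_rmul, norm_eq_one_of_mem (sec_mem_sphere hq (hM hx.2) hx2), one_mul,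
        hnorm] at h5
    have h5 : unitChart ((qp q x).re⁻¹ • imCoord (qp q x)) = qp (sec q (hopf x)) x := by
      rw [unitChart, h4, norm_smul, norm_inv, Real.norm_of_nonneg hx3.le, mul_inv, inv_inv,
        smul_smul, mul_right_comm, mul_inv_cancel₀ hx3.ne', one_mul, h3, norm_mul, hg, mul_one,
        Quaternion.norm_coe, Real.norm_of_nonneg (by positivity), Quaternion.coe_mul_eq_smul,
        smul_smul, inv_mul_cancel₀ (by positivity), one_smul]
    rw [h5, rmul_sec_qp hq hx.1 hx2]

lemma sec_self {x : R8} (hx : x ∈ sphere (0 : R8) 1) : sec x (hopf x) = x := by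
  have h : pre x (hopf x) = (2 : ℝ) • x := by
    rw [pre, cl_hopf_self, norm_eq_one_of_mem hx, one_pow, one_smul, two_smul]
  rw [sec, h, norm_smul, norm_eq_one_of_mem hx, smul_smul]
  norm_num

lemma hopf_ne_neg_self {x : R8} (hx : x ∈ sphere (0 : R8) 1) : hopf x ≠ -hopf x := by
  intro h
  have h1 := norm_eq_one_of_mem (hopf_mem_sphere hx)
  have h2 : (2 : ℝ) • hopf x = 0 := by rw [two_smul, eq_neg_iff_add_eq_zero.1 h]
  rw [(smul_eq_zero.1 h2).resolve_left two_ne_zero, norm_zero] at h1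
  exact zero_ne_one h1

lemma IsSubmanifold.hopfPreimage (h : IsSubmanifold d M) (hM : M ⊆ sphere 0 1) :
    IsSubmanifold (d + 3) (hopfPreimage M) := by
  intro x hx
  obtain ⟨U, c, hc, u, hu, hux⟩ := h _ hx.2
  -- The section is taken through x itself, so that x is the point over u with fibre coordinate 0.
  refine ⟨_, _, hc.hopfChart hM hx.1, (splitCoord d).symm (u, 0), ?_, ?_⟩
  · simp only [chartDomain, mem_ofPred_eq, ContinuousLinearEquiv.apply_symm_apply, hux]
    exact ⟨hu, hopf_ne_neg_self hx.1⟩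
  · simp only [HopfTaut.hopfChart, ContinuousLinearEquiv.apply_symm_apply, hux, sec_self hx.1,
      unitChart_zero, rmul_one]

lemma hasFDerivAt_hopfChart (h : IsLocalParam d M U c) (hM : M ⊆ sphere 0 1)
    (hq : q ∈ sphere (0 : R8) 1) {u} (hu : u ∈ U) (hne : c u ≠ -hopf q) :
    HasFDerivAt (hopfChart q c)
      ((((fderiv ℝ (sec q) (c u)).comp (fderiv ℝ c u)).coprod
        ((rmulB (sec q (c u))).comp imag)).comp (splitCoord d : _ →L[ℝ] _))
      ((splitCoord d).symm (u, 0)) := by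
  have h1 : HasFDerivAt (fun z : EuclideanSpace ℝ (Fin d) × (ℝ × ℝ × ℝ) ↦ sec q (c z.1))
      (((fderiv ℝ (sec q) (c u)).comp (fderiv ℝ c u)).comp (.fst ℝ _ _)) (u, 0) := by
    have h2 := ((contDiffAt_sec hq (hM (h.mem hu)) hne).differentiableAt (by simp)).hasFDerivAt
    have h0 : HasFDerivAt (Prod.fst : EuclideanSpace ℝ (Fin d) × (ℝ × ℝ × ℝ) → _)
      (.fst ℝ _ _) (u, 0) := hasFDerivAt_fst
    exact HasFDerivAt.comp (g := sec q ∘ c) (u, 0)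
      (h2.comp u (h.differentiableAt hu).hasFDerivAt) h0
  have h3 : HasFDerivAt (fun z : EuclideanSpace ℝ (Fin d) × (ℝ × ℝ × ℝ) ↦ unitChart z.2)
      (imag.comp (.snd ℝ _ _)) (u, 0) := by
    have h0 : HasFDerivAt (Prod.snd : EuclideanSpace ℝ (Fin d) × (ℝ × ℝ × ℝ) → _)
      (.snd ℝ _ _) (u, 0) := hasFDerivAt_snd
    exact HasFDerivAt.comp (g := unitChart) (u, 0) hasFDerivAt_unitChart h0
  have h2 : HasFDerivAt (fun z : EuclideanSpace ℝ (Fin d) × (ℝ × ℝ × ℝ) ↦ rmulB (sec q (c z.1)))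
      (rmulB.comp (((fderiv ℝ (sec q) (c u)).comp (fderiv ℝ c u)).comp (.fst ℝ _ _))) (u, 0) :=
    HasFDerivAt.comp (g := rmulB) (u, 0) rmulB.hasFDerivAt h1
  have h4 := h2.clm_apply h3
  have h5 : HasFDerivAt (fun z : EuclideanSpace ℝ (Fin d) × (ℝ × ℝ × ℝ) ↦
      rmul (sec q (c z.1)) (unitChart z.2)) (((fderiv ℝ (sec q) (c u)).comp
        (fderiv ℝ c u)).coprod ((rmulB (sec q (c u))).comp imag))
      (splitCoord d ((splitCoord d).symm (u, 0))) := by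
    rw [ContinuousLinearEquiv.apply_symm_apply]
    refine h4.congr_fderiv ?_
    refine ContinuousLinearMap.ext fun z ↦ ?_
    simp [unitChart_zero, rmulB_apply, rmul_one, add_comm]
  exact h5.comp _ (splitCoord d).hasFDerivAt

end Chart

end HopfTaut
end

noncomputable section

namespace HopfTaut

open Filter Topology

/-! ### Critical points of height functions on the preimage under the Hopf map -/

lemma neg_mem_sphere {E : Type} [NormedAddCommGroup E] {p : E} (hp : p ∈ sphere (0 : E) 1) :
    -p ∈ sphere (0 : E) 1 := by
  rwa [mem_sphere_zero_iff_norm, norm_neg, ← mem_sphere_zero_iff_norm]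

lemma sec_neg (p : R8) (y : R5) : sec (-p) y = -sec p y := by
  have h : pre (-p) y = -pre p y := by
    rw [pre, pre, ← neg_one_smul ℝ p, cl_smul]
    module
  rw [sec, sec, h, norm_neg, smul_neg]

lemma inner_rmul (p x : R8) (g : ℍ[ℝ]) : inner ℝ p (rmul x g) = (qp p x * g).re := by
  rw [← re_qp, qp_rmul]

lemma inner_sec {p : R8} {y : R5} (hp : p ∈ sphere (0 : R8) 1) (hy : y ∈ sphere (0 : R5) 1)
    (h : y ≠ -hopf p) : inner ℝ p (sec p y) = √(2 * (1 + inner ℝ (hopf p) y)) / 2 := by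
  rw [← re_qp, qp_sec hp hy h, Quaternion.re_coe, real_inner_comm, ← norm_pre_sq hp hy,
    Real.sqrt_sq (norm_nonneg _)]

section Chart

variable {d : ℕ} {M : Set R5} {U : Set (EuclideanSpace ℝ (Fin d))}
  {c : EuclideanSpace ℝ (Fin d) → R5} {p q x : R8} (hM : M ⊆ sphere 0 1)
include hM

omit hM in
lemma hopfChart_symm (u : EuclideanSpace ℝ (Fin d)) :
    hopfChart q c ((splitCoord d).symm (u, 0)) = sec q (c u) := by
  rw [hopfChart, ContinuousLinearEquiv.apply_symm_apply, unitChart_zero, rmul_one]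

/-- The tangent space at a section point splits into the directions along the section and the fibre
directions. The direction p of the height and the base point q of the section are independent: q = p
and q = x are both needed. -/
lemma IsLocalParam.isCriticalPt_sec_iff (h : IsLocalParam d M U c) (hq : q ∈ sphere (0 : R8) 1)
    {u} (hu : u ∈ U) (hne : c u ≠ -hopf q) :
    IsCriticalPt (d + 3) (hopfPreimage M) (height p) (sec q (c u)) ↔
      (∀ v, inner ℝ p (fderiv ℝ (sec q) (c u) (fderiv ℝ c u v)) = 0) ∧
        ∀ ζ, inner ℝ p (rmul (sec q (c u)) (imag ζ)) = 0 := by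
  have hmem : (splitCoord d).symm (u, 0) ∈ chartDomain U c q := by
    simp only [chartDomain, mem_ofPred_eq, ContinuousLinearEquiv.apply_symm_apply]
    exact ⟨hu, hne⟩
  rw [← hopfChart_symm, (h.hopfChart hM hq).isCriticalPt_height_iff hmem,
    (hasFDerivAt_hopfChart h hM hq hu hne).fderiv]
  constructor
  · intro h0
    refine ⟨fun v ↦ ?_, fun ζ ↦ ?_⟩
    · simpa using h0 ((splitCoord d).symm (v, 0))
    · simpa [hopfChart_symm, rmulB_apply] using h0 ((splitCoord d).symm (0, ζ))
  · rintro ⟨h1, h2⟩ z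
    rw [hopfChart_symm] at h2
    simp [inner_add_right, h1, h2, rmulB_apply]

lemma IsLocalParam.eventually_inner_sec (h : IsLocalParam d M U c) (hp : p ∈ sphere (0 : R8) 1)
    {u} (hu : u ∈ U) (hne : c u ≠ -hopf p) :
    height p ∘ (sec p ∘ c) =ᶠ[𝓝 u]
      (fun t ↦ √(2 * (1 + t)) / 2) ∘ (height (hopf p) ∘ c) := by
  filter_upwards [h.isOpen.mem_nhds hu, (h.contDiffAt hu).continuousAt.eventually_ne hne]
    with u' hu' hne'
  exact inner_sec hp (hM (h.mem hu')) hne'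

lemma IsLocalParam.hasFDerivAt_inner_sec (h : IsLocalParam d M U c) (hp : p ∈ sphere (0 : R8) 1)
    {u} (hu : u ∈ U) (hne : c u ≠ -hopf p) :
    HasFDerivAt (height p ∘ (sec p ∘ c))
      ((innerSL ℝ p).comp ((fderiv ℝ (sec p) (c u)).comp (fderiv ℝ c u))) u := by
  have h2 := ((contDiffAt_sec hp (hM (h.mem hu)) hne).differentiableAt (by simp)).hasFDerivAt
  exact (innerSL ℝ p).hasFDerivAt.comp u (h2.comp u (h.differentiableAt hu).hasFDerivAt)

omit hM in
lemma contDiffAt_half_sqrt {t : ℝ} (ht : 0 < 1 + t) :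
    ContDiffAt ℝ ∞ (fun t ↦ √(2 * (1 + t)) / 2) t ∧
      deriv (fun t ↦ √(2 * (1 + t)) / 2) t ≠ 0 := by
  have h1 : 2 * (1 + t) ≠ 0 := by positivity
  have h2 : HasDerivAt (fun t : ℝ ↦ 2 * (1 + t)) (2 * 1) t :=
    ((hasDerivAt_id t).const_add 1).const_mul 2
  refine ⟨((contDiffAt_const.mul (contDiffAt_const.add contDiffAt_id)).sqrt h1).div_const 2, ?_⟩
  rw [((h2.sqrt h1).div_const 2).deriv]
  positivity

/-- At a point of the local section, criticality of the height functions upstairs and downstairs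
is equivalent. -/
lemma IsLocalParam.isCriticalPt_sec_self_iff (h : IsLocalParam d M U c)
    (hp : p ∈ sphere (0 : R8) 1) {u} (hu : u ∈ U) (hne : c u ≠ -hopf p) :
    IsCriticalPt (d + 3) (hopfPreimage M) (height p) (sec p (c u)) ↔
      IsCriticalPt d M (height (hopf p)) (c u) := by
  have hpos : 0 < 1 + inner ℝ (hopf p) (c u) := by
    rw [real_inner_comm]
    exact one_add_inner_pos hp (hM (h.mem hu)) hne
  obtain ⟨hφ, hd⟩ := contDiffAt_half_sqrt hpos
  have h1 := h.hasFDerivAt_inner_sec hM hp hu hne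
  have h2 := ((hφ.differentiableAt (by simp)).hasDerivAt.comp_hasFDerivAt u
    (h.hasFDerivAt_height hu (hopf p))).congr_of_eventuallyEq (h.eventually_inner_sec hM hp hu hne)
  have h3 (v) := congrArg (fun L ↦ L v) (h1.unique h2)
  rw [h.isCriticalPt_sec_iff hM hp hu hne, h.isCriticalPt_height_iff hu]
  have h4 (ζ) : inner ℝ p (rmul (sec p (c u)) (imag ζ)) = 0 := by
    rw [inner_rmul, qp_sec hp (hM (h.mem hu)) hne, Quaternion.coe_mul_eq_smul]
    simp
  refine ⟨fun h5 v ↦ ?_, fun h5 ↦ ⟨fun v ↦ ?_, h4⟩⟩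
  · have h6 := (h3 v).symm.trans (h5.1 v)
    exact (mul_eq_zero.1 h6).resolve_left hd
  · refine (h3 v).trans ?_
    change _ * inner ℝ (hopf p) (fderiv ℝ c u v) = 0
    rw [h5, mul_zero]

omit hM in
lemma eq_one_or_neg_one_of_imCoord {g : ℍ[ℝ]} (hg : ‖g‖ = 1) (h : imCoord g = 0) :
    g = 1 ∨ g = -1 := by
  have h1 := re_add_imag g
  rw [h, map_zero, add_zero] at h1
  rw [← h1, Quaternion.norm_coe, Real.norm_eq_abs, abs_eq zero_le_one] at hg
  rcases hg with hg | hg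
  · left; rw [← h1, hg]; simp
  · right; rw [← h1, hg]; simp

omit hM in
lemma imCoord_eq_zero {a : ℍ[ℝ]} (h : ∀ ζ, (a * imag ζ).re = 0) : imCoord a = 0 := by
  have h1 := h (1, 0, 0)
  have h2 := h (0, 1, 0)
  have h3 := h (0, 0, 1)
  have e (ζ : ℝ × ℝ × ℝ) : imag ζ = (⟨0, ζ.1, ζ.2.1, ζ.2.2⟩ : ℍ[ℝ]) := rfl
  rw [Quaternion.re_mul] at h1 h2 h3
  simp only [e, mul_zero, mul_one, zero_sub, sub_zero, neg_eq_zero] at h1 h2 h3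
  exact Prod.ext h1 (Prod.ext h2 h3)

omit hM in
lemma isCriticalPt_height_neg_iff {E : Type} [NormedAddCommGroup E] [InnerProductSpace ℝ E]
    [FiniteDimensional ℝ E] {d : ℕ} {M : Set E} (hsub : IsSubmanifold d M) (p : E) {x : E}
    (hx : x ∈ M) : IsCriticalPt d M (height (-p)) x ↔ IsCriticalPt d M (height p) x := by
  obtain ⟨U, c, h, u, hu, rfl⟩ := hsub x hx
  simp only [h.isCriticalPt_height_iff hu, inner_neg_left, neg_eq_zero]

omit hM in
lemma qp_eq_mul (hp : p ∈ sphere (0 : R8) 1) (hx : x ∈ sphere (0 : R8) 1)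
    (hne : hopf x ≠ -hopf p) :
    qp p x = ((‖pre p (hopf x)‖ / 2 : ℝ) : ℍ[ℝ]) * qp (sec p (hopf x)) x := by
  conv_lhs => rw [← rmul_sec_qp hp hx hne]
  rw [qp_rmul, qp_sec hp (hopf_mem_sphere hx) hne]

/-- Away from the fibre over `-h p`, the critical points upstairs are the points `±sec p y`, where
`y` is a critical point downstairs. -/
lemma isCriticalPt_hopfPreimage_iff (hsub : IsSubmanifold d M) (hp : p ∈ sphere (0 : R8) 1)
    (hx : x ∈ hopfPreimage M) (hne : hopf x ≠ -hopf p) :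
    IsCriticalPt (d + 3) (hopfPreimage M) (height p) x ↔
      (x = sec p (hopf x) ∨ x = -sec p (hopf x)) ∧
        IsCriticalPt d M (height (hopf p)) (hopf x) := by
  obtain ⟨U, c, h, u, hu, hux⟩ := hsub _ hx.2
  have hV := hsub.hopfPreimage hM
  have hpos := norm_pre_pos hp (hM hx.2) hne
  -- The negative case is the section through -p, whose height function has the same critical
  -- points.
  have key : x = sec p (hopf x) ∨ x = -sec p (hopf x) →
      (IsCriticalPt (d + 3) (hopfPreimage M) (height p) x ↔
        IsCriticalPt d M (height (hopf p)) (hopf x)) := by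
    rintro (h1 | h1)
    · have h2 := h.isCriticalPt_sec_self_iff hM hp hu (hux.trans_ne hne)
      rwa [hux, ← h1] at h2
    · rw [← sec_neg] at h1
      have h2 := h.isCriticalPt_sec_self_iff hM (neg_mem_sphere hp) hu
        (by rw [hopf_neg, hux]; exact hne)
      rwa [hux, ← h1, hopf_neg, isCriticalPt_height_neg_iff hV p hx] at h2
  refine ⟨fun h0 ↦ ?_, fun h0 ↦ (key h0.1).2 h0.2⟩
  suffices h1 : x = sec p (hopf x) ∨ x = -sec p (hopf x) from ⟨h1, (key h1).1 h0⟩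
  -- In the chart through x, the fibre directions force the imaginary part of `qp p x` to vanish.
  -- This product is a positive multiple of the unit quaternion carrying the section point to x,
  -- which must then be ±1.
  have h2 := h.isCriticalPt_sec_iff hM hx.1 (p := p) hu (hux ▸ hopf_ne_neg_self hx.1)
  rw [hux, sec_self hx.1] at h2
  have h3 := (h2.1 h0).2
  simp only [inner_rmul] at h3
  have h4 := imCoord_eq_zero h3
  rw [qp_eq_mul hp hx.1 hne, Quaternion.coe_mul_eq_smul, map_smul] at h4
  have h5 := (smul_eq_zero.1 h4).resolve_left (by positivity)
  have h6 := rmul_sec_qp hp hx.1 hne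
  have hg : ‖qp (sec p (hopf x)) x‖ = 1 := by
    have h7 := congrArg norm h6
    rwa [norm_rmul, norm_eq_one_of_mem (sec_mem_sphere hp (hM hx.2) hne), one_mul,
      norm_eq_one_of_mem hx.1] at h7
  rcases eq_one_or_neg_one_of_imCoord hg h5 with h7 | h7
  · left
    rw [h7, rmul_one] at h6
    exact h6.symm
  · right
    rw [h7, show (-1 : ℍ[ℝ]) = ((-1 : ℝ) : ℍ[ℝ]) by simp, rmul_coe, neg_one_smul] at h6
    exact h6.symm

omit hM in
/-- The part of the critical set away from the fibre over `-h p` doubles. -/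
lemma encard_image_sec (hp : p ∈ sphere (0 : R8) 1) {T : Set R5} (hT : T ⊆ sphere 0 1)
    (hne : -hopf p ∉ T) :
    {x ∈ sphere (0 : R8) 1 | hopf x ∈ T ∧ (x = sec p (hopf x) ∨ x = -sec p (hopf x))}.encard =
      2 * T.encard := by
  have hne' {y} (hy : y ∈ T) : y ≠ -hopf p := fun h ↦ hne (h ▸ hy)
  have hinj : InjOn (sec p) T := fun y hy y' hy' h ↦ by
    rw [← hopf_sec hp (hT hy) (hne' hy), h, hopf_sec hp (hT hy') (hne' hy')]
  have hset : {x ∈ sphere (0 : R8) 1 | hopf x ∈ T ∧ (x = sec p (hopf x) ∨ x = -sec p (hopf x))} =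
      sec p '' T ∪ (fun y ↦ -sec p y) '' T := by
    ext x
    constructor
    · rintro ⟨-, h1, h2 | h2⟩
      · exact Or.inl ⟨_, h1, h2.symm⟩
      · exact Or.inr ⟨_, h1, h2.symm⟩
    · rintro (⟨y, hy, rfl⟩ | ⟨y, hy, rfl⟩)
      · refine ⟨sec_mem_sphere hp (hT hy) (hne' hy), ?_⟩
        rw [hopf_sec hp (hT hy) (hne' hy)]
        exact ⟨hy, Or.inl rfl⟩
      · refine ⟨neg_mem_sphere (sec_mem_sphere hp (hT hy) (hne' hy)), ?_⟩
        rw [hopf_neg, hopf_sec hp (hT hy) (hne' hy)]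
        exact ⟨hy, Or.inr rfl⟩
  have hdisj : Disjoint (sec p '' T) ((fun y ↦ -sec p y) '' T) := by
    rw [Set.disjoint_left]
    rintro _ ⟨y, hy, rfl⟩ ⟨y', hy', h⟩
    have h1 := congrArg hopf h
    simp only [hopf_neg] at h1
    rw [hopf_sec hp (hT hy) (hne' hy), hopf_sec hp (hT hy') (hne' hy')] at h1
    subst h1
    have h2 := norm_eq_one_of_mem (sec_mem_sphere hp (hT hy) (hne' hy))
    have h3 : (2 : ℝ) • sec p y' = 0 := by
      rw [two_smul]
      nth_rewrite 1 [← h]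
      exact neg_add_cancel _
    rw [(smul_eq_zero.1 h3).resolve_left two_ne_zero, norm_zero] at h2
    exact zero_ne_one h2
  rw [hset, encard_union_eq hdisj, hinj.encard_image,
    (show InjOn (fun y ↦ -sec p y) T from fun y hy y' hy' h ↦
      hinj hy hy' (neg_injective h)).encard_image, two_mul]

theorem encard_heightCriticalSet (hsub : IsSubmanifold d M) (hp : p ∈ sphere (0 : R8) 1)
    (hne : -hopf p ∉ M) :
    (heightCriticalSet (d + 3) (hopfPreimage M) p).encard =
      2 * (heightCriticalSet d M (hopf p)).encard := by
  rw [← encard_image_sec hp (fun y hy ↦ hM hy.1) (fun h ↦ hne h.1)]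
  congr 1
  ext x
  constructor
  · rintro ⟨hx, h⟩
    have h1 := (isCriticalPt_hopfPreimage_iff hM hsub hp hx (fun h' ↦ hne (h' ▸ hx.2))).1 h
    exact ⟨hx.1, ⟨hx.2, h1.2⟩, h1.1⟩
  · rintro ⟨hx, ⟨h1, h2⟩, h3⟩
    have hx' : x ∈ hopfPreimage M := ⟨hx, h1⟩
    exact ⟨hx', (isCriticalPt_hopfPreimage_iff hM hsub hp hx'
      (fun h' ↦ hne (h' ▸ hx'.2))).2 ⟨h3, h2⟩⟩

/-- Nondegeneracy upstairs implies nondegeneracy downstairs. -/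
lemma IsLocalParam.nondegAt_of_hopfChart (h : IsLocalParam d M U c) (hp : p ∈ sphere (0 : R8) 1)
    {u} (hu : u ∈ U) (hne : c u ≠ -hopf p)
    (h0 : HasFDerivAt (height (hopf p) ∘ c) (0 : EuclideanSpace ℝ (Fin d) →L[ℝ] ℝ) u)
    (hn : NondegAt (height p ∘ HopfTaut.hopfChart p c) ((splitCoord d).symm (u, 0))) :
    NondegAt (height (hopf p) ∘ c) u := by
  have hpos : 0 < 1 + inner ℝ (hopf p) (c u) := by
    rw [real_inner_comm]
    exact one_add_inner_pos hp (hM (h.mem hu)) hne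
  obtain ⟨hφ, hd⟩ := contDiffAt_half_sqrt hpos
  have hev := h.eventually_inner_sec hM hp hu hne
  rw [← nondegAt_real_comp_iff (h.contDiffAt_height_two hu _)
    (hφ.of_le ENat.LEInfty.out) h0.fderiv hd]
  suffices hA : NondegAt (height p ∘ (sec p ∘ c)) u by
    intro v hv
    refine hA v fun w ↦ ?_
    rw [hev.fderiv.fderiv_eq]
    exact hv w
  set A := height p ∘ (sec p ∘ c)
  set F := height p ∘ HopfTaut.hopfChart p c
  let ι : EuclideanSpace ℝ (Fin d) →L[ℝ] EuclideanSpace ℝ (Fin (d + 3)) :=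
    ((splitCoord d).symm : _ →L[ℝ] _).comp (.inl ℝ _ (ℝ × ℝ × ℝ))
  let π : EuclideanSpace ℝ (Fin (d + 3)) →L[ℝ] EuclideanSpace ℝ (Fin d) :=
    (ContinuousLinearMap.fst ℝ _ (ℝ × ℝ × ℝ)).comp (splitCoord d : _ →L[ℝ] _)
  have hmem : ι u ∈ chartDomain U c p := by
    simp only [ι, chartDomain, mem_ofPred_eq, ContinuousLinearMap.comp_apply,
      ContinuousLinearMap.inl_apply, ContinuousLinearEquiv.coe_coe,
      ContinuousLinearEquiv.apply_symm_apply]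
    exact ⟨hu, hne⟩
  -- Along the whole section the fibre derivative of the height vanishes. Differentiating this
  -- identity shows that the Hessian upstairs has no mixed terms, so a null vector of the Hessian of
  -- A gives one of F.
  have h1 : (fun u' ↦ fderiv ℝ F (ι u')) =ᶠ[𝓝 u] fun u' ↦ (fderiv ℝ A u').comp π := by
    filter_upwards [h.isOpen.mem_nhds hu, (h.contDiffAt hu).continuousAt.eventually_ne hne]
      with u' hu' hne'
    have h3 : HasFDerivAt F _ (ι u') := (innerSL ℝ p).hasFDerivAt.comp (ι u')
      (hasFDerivAt_hopfChart h hM hp hu' hne')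
    rw [(h.hasFDerivAt_inner_sec hM hp hu' hne').fderiv, h3.fderiv]
    refine ContinuousLinearMap.ext fun z ↦ ?_
    have h4 (ζ) : inner ℝ p (rmul (sec p (c u')) (imag ζ)) = 0 := by
      rw [inner_rmul, qp_sec hp (hM (h.mem hu')) hne', Quaternion.coe_mul_eq_smul]
      simp
    simp [π, inner_add_right, rmulB_apply, h4]
  have hF : DifferentiableAt ℝ (fderiv ℝ F) (ι u) :=
    (((h.hopfChart hM hp).contDiffAt_height_two hmem p).fderiv_right (m := 1)
      (by norm_num)).differentiableAt (by simp)
  have hA : DifferentiableAt ℝ (fderiv ℝ A) u := by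
    have h2 : ContDiffAt ℝ 2 A u :=
      (ContDiffAt.comp (f := height (hopf p) ∘ c) u (hφ.of_le ENat.LEInfty.out)
        (h.contDiffAt_height_two hu _)).congr_of_eventuallyEq hev
    exact (h2.fderiv_right (m := 1) (by norm_num)).differentiableAt (by simp)
  intro v hv
  have h2 := (hF.hasFDerivAt.comp u ι.hasFDerivAt).unique
    ((HasFDerivAt.clm_comp hA.hasFDerivAt (hasFDerivAt_const π u)).congr_of_eventuallyEq h1)
  have h3 : ι v = 0 := hn _ fun w ↦ by
    have h5 := congrArg (fun L ↦ L v w) h2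
    have h6 : fderiv ℝ (fderiv ℝ F) (ι u) (ι v) w = 0 := by simpa [hv] using h5
    exact h6
  have h4 := congrArg π h3
  simpa [π, ι] using h4

/-- Critical points in the fibre over `-h p`. -/
lemma IsLocalParam.isCriticalPt_fibre_iff (h : IsLocalParam d M U c) (hp : p ∈ sphere (0 : R8) 1)
    (hx : x ∈ sphere (0 : R8) 1) {u} (hu : u ∈ U) (hux : c u = hopf x)
    (hxp : hopf x = -hopf p) :
    IsCriticalPt (d + 3) (hopfPreimage M) (height p) x ↔
      ∀ v, inner ℝ p (cl (fderiv ℝ c u v) x) = 0 := by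
  have h1 := h.isCriticalPt_sec_iff hM hx (p := p) hu (hux ▸ hopf_ne_neg_self hx)
  rw [hux, sec_self hx] at h1
  rw [h1]
  -- Over the antipode, x lies in the (-1)-eigenspace of `cl (hopf p)` while p lies in the
  -- (+1)-eigenspace.
  have hqp : qp p x = 0 := by
    have h2 := rmul_qp p x
    have h3 : cl (hopf p) x = -x := by
      rw [← neg_eq_iff_eq_neg.2 hxp, ← neg_one_smul ℝ (hopf x), ← clB_apply, map_smul,
        smul_apply, clB_apply, cl_hopf_self, norm_eq_one_of_mem hx, one_pow,
        one_smul, neg_one_smul]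
    rw [h3, norm_eq_one_of_mem hp, one_pow, one_smul, add_neg_cancel, smul_zero] at h2
    have h4 := congrArg norm h2
    rw [norm_rmul, norm_eq_one_of_mem hp, one_mul, norm_zero] at h4
    exact norm_eq_zero.1 h4
  have hpx : inner ℝ p x = 0 := by rw [← re_qp, hqp]; rfl
  have hpre : pre x (hopf x) = (2 : ℝ) • x := by
    rw [pre, cl_hopf_self, norm_eq_one_of_mem hx, one_pow, one_smul, two_smul]
  have hnorm : ‖pre x (hopf x)‖ = 2 := by
    rw [hpre, norm_smul, norm_eq_one_of_mem hx]
    norm_num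
  have hd1 : HasFDerivAt (pre x) (clB.flip x) (hopf x) := (clB.flip x).hasFDerivAt.const_add x
  have hd2 : DifferentiableAt ℝ (fun y ↦ ‖pre x y‖⁻¹) (hopf x) :=
    (hd1.differentiableAt.norm ℝ (norm_pos_iff.1 (by rw [hnorm]; norm_num))).inv
      (by rw [hnorm]; norm_num)
  have hd3 : fderiv ℝ (sec x) (hopf x) = _ := (hd2.hasFDerivAt.smul hd1).fderiv
  -- Differentiating the normalizing factor only gives multiples of x, which are orthogonal to p;
  -- the remaining factor is 1/|2x|.
  have key (v) : inner ℝ p (fderiv ℝ (sec x) (hopf x) (fderiv ℝ c u v)) =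
      2⁻¹ * inner ℝ p (cl (fderiv ℝ c u v) x) := by
    rw [hd3, hnorm, hpre]
    simp [inner_add_right, inner_smul_right, hpx, clB_apply, -WithLp.prod_inner_apply]
  simp only [key, inner_rmul, hqp, zero_mul, Quaternion.re_zero, implies_true, and_true,
    mul_eq_zero, inv_eq_zero, OfNat.ofNat_ne_zero, false_or]

end Chart

end HopfTaut
end

noncomputable section

namespace HopfTaut

open Filter Topology Module
open scoped Pointwise

/-! ### Dimension and measure of submanifolds of spheres -/

section Dimension

variable {E : Type} [NormedAddCommGroup E] [InnerProductSpace ℝ E] [FiniteDimensional ℝ E]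
  {d n : ℕ} {M : Set E} {U : Set (EuclideanSpace ℝ (Fin d))} {c : EuclideanSpace ℝ (Fin d) → E}

/-- The point c u is the maximum of its own height function. -/
lemma IsLocalParam.inner_fderiv (h : IsLocalParam d M U c) (hM : M ⊆ sphere 0 1)
    (hsub : IsSubmanifold d M) {u} (hu : u ∈ U) (v) : inner ℝ (c u) (fderiv ℝ c u v) = 0 :=
  (h.isCriticalPt_height_iff hu _).1
    (isCriticalPt_height_self hM (hM (h.mem hu)) hsub (h.mem hu) (Or.inl rfl)) v

omit [FiniteDimensional ℝ E] in
lemma IsLocalParam.finrank_range (h : IsLocalParam d M U c) {u} (hu : u ∈ U) :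
    finrank ℝ (fderiv ℝ c u).range = d := by
  rw [LinearMap.finrank_range_of_inj (h.immersion u hu)]
  simp

lemma IsSubmanifold.dim_le (hsub : IsSubmanifold d M) (hM : M ⊆ sphere 0 1)
    (hne : M.Nonempty) (hn : finrank ℝ E = n + 1) : d ≤ n := by
  obtain ⟨x, hx⟩ := hne
  obtain ⟨U, c, h, u, hu, rfl⟩ := hsub x hx
  have : Fact (finrank ℝ E = n + 1) := ⟨hn⟩
  have h0 : c u ≠ 0 := fun h0 ↦ by
    have := norm_eq_one_of_mem (hM (h.mem hu))
    rw [h0, norm_zero] at this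
    exact zero_ne_one this
  rw [← h.finrank_range hu,
    ← Submodule.finrank_orthogonal_span_singleton (𝕜 := ℝ) (n := n) h0]
  refine Submodule.finrank_mono ?_
  rintro _ ⟨v, rfl⟩
  exact Submodule.mem_orthogonal_singleton_iff_inner_right.2 (h.inner_fderiv hM hsub hu v)

/-- In top dimension a vector which is orthogonal to the tangent space is radial. -/
lemma IsLocalParam.exists_smul_eq (h : IsLocalParam d M U c) (hM : M ⊆ sphere 0 1)
    (hsub : IsSubmanifold d M) (hd : finrank ℝ E = d + 1) {u} (hu : u ∈ U) {p : E}
    (hp : ∀ v, inner ℝ p (fderiv ℝ c u v) = 0) : ∃ r : ℝ, r • c u = p := by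
  have h0 : c u ≠ 0 := fun h0 ↦ by
    have := norm_eq_one_of_mem (hM (h.mem hu))
    rw [h0, norm_zero] at this
    exact zero_ne_one this
  have hmem {p : E} (hp : ∀ v, inner ℝ p (fderiv ℝ c u v) = 0) :
      p ∈ ((fderiv ℝ c u).range)ᗮ := by
    rw [Submodule.mem_orthogonal']
    rintro _ ⟨v, rfl⟩
    exact hp v
  have h1 : finrank ℝ ((fderiv ℝ c u).range)ᗮ = 1 := by
    have := ((fderiv ℝ c u).range).finrank_add_finrank_orthogonal
    rw [h.finrank_range hu] at this
    omega
  obtain ⟨r, hr⟩ := (finrank_eq_one_iff_of_nonzero'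
    (⟨c u, hmem (h.inner_fderiv hM hsub hu)⟩ : ((fderiv ℝ c u).range)ᗮ)
    (fun h ↦ h0 (congrArg Subtype.val h))).1 h1 ⟨p, hmem hp⟩
  exact ⟨r, congrArg Subtype.val hr⟩

omit [FiniteDimensional ℝ E] in
/-- The radial extension of a parametrization. -/
lemma IsLocalParam.contDiffOn_cone (h : IsLocalParam d M U c) :
    ContDiffOn ℝ ∞ (fun z : ℝ × EuclideanSpace ℝ (Fin d) ↦ z.1 • c z.2) (univ ×ˢ U) :=
  contDiff_fst.contDiffOn.smul (h.contDiffOn.comp contDiff_snd.contDiffOn fun _ hz ↦ hz.2)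

/-- In top dimension the cone map (r, u) ↦ r c(u) is a submersion at r = 1, hence open there; a
point of its image with r > 0 and norm 1 has r = 1 and lies in M. -/
lemma IsLocalParam.mem_nhdsWithin_sphere (h : IsLocalParam d M U c) (hM : M ⊆ sphere 0 1)
    (hsub : IsSubmanifold d M) (hd : finrank ℝ E = d + 1) {u} (hu : u ∈ U) :
    M ∈ 𝓝[sphere 0 1] (c u) := by
  set g : ℝ × EuclideanSpace ℝ (Fin d) → E := fun z ↦ z.1 • c z.2
  have hO : IsOpen ((univ : Set ℝ) ×ˢ U) := isOpen_univ.prod h.isOpen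
  have hg : ContDiffAt ℝ ∞ g (1, u) :=
    h.contDiffOn_cone.contDiffAt (hO.mem_nhds ⟨mem_univ _, hu⟩)
  have hd1 : HasFDerivAt g ((1 : ℝ) • (fderiv ℝ c u).comp (.snd ℝ _ _) +
      (ContinuousLinearMap.fst ℝ ℝ _).smulRight (c u)) (1, u) := by
    have h1 : HasFDerivAt (fun z : ℝ × EuclideanSpace ℝ (Fin d) ↦ z.1)
      (ContinuousLinearMap.fst ℝ _ _) (1, u) := hasFDerivAt_fst
    have h2 : HasFDerivAt (fun z : ℝ × EuclideanSpace ℝ (Fin d) ↦ c z.2)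
      ((fderiv ℝ c u).comp (ContinuousLinearMap.snd ℝ _ _)) (1, u) :=
      HasFDerivAt.comp (g := c) (1, u) (h.differentiableAt hu).hasFDerivAt hasFDerivAt_snd
    exact h1.smul h2
  have hs := hg.hasStrictFDerivAt' hd1 (by simp)
  have hrange : ((1 : ℝ) • (fderiv ℝ c u).comp (.snd ℝ _ _) +
      (ContinuousLinearMap.fst ℝ ℝ (EuclideanSpace ℝ (Fin d))).smulRight (c u)).range = ⊤ := by
    rw [← Submodule.orthogonal_eq_bot_iff, Submodule.eq_bot_iff]
    intro p hp
    rw [Submodule.mem_orthogonal'] at hp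
    obtain ⟨r, rfl⟩ := h.exists_smul_eq hM hsub hd hu (p := p) fun v ↦ by
      simpa using hp _ ⟨(0, v), rfl⟩
    have h1 := hp _ ⟨(1, 0), rfl⟩
    simp only [ContinuousLinearMap.coe_coe, add_apply,
      ContinuousLinearMap.comp_apply, ContinuousLinearMap.coe_snd', map_zero, zero_add,
      ContinuousLinearMap.smulRight_apply, ContinuousLinearMap.coe_fst', one_smul,
      inner_smul_left, real_inner_self_eq_norm_sq, norm_eq_one_of_mem (hM (h.mem hu))] at h1
    have h2 : r = 0 := by simpa using h1
    rw [h2, zero_smul]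
  have hmap := hs.map_nhds_eq_of_surj hrange
  have hpre : (Ioi (0 : ℝ)) ×ˢ U ∈ 𝓝 ((1 : ℝ), u) :=
    (isOpen_Ioi.prod h.isOpen).mem_nhds ⟨by norm_num, hu⟩
  have h2 := image_mem_map (m := g) hpre
  rw [hmap, show g (1, u) = c u from one_smul ℝ _] at h2
  refine mem_nhdsWithin_iff_exists_mem_nhds_inter.2 ⟨_, h2, ?_⟩
  rintro _ ⟨⟨⟨r, u'⟩, ⟨hr, hu'⟩, rfl⟩, hz⟩
  have h3 := norm_eq_one_of_mem hz
  simp only [g, norm_smul, norm_eq_one_of_mem (hM (h.mem hu')), mul_one, Real.norm_eq_abs,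
    abs_of_pos (mem_Ioi.1 hr)] at h3
  simp only [g, h3, one_smul]
  exact h.mem hu'

/-- A compact submanifold of full dimension is the whole sphere. -/
lemma IsSubmanifold.eq_sphere (hsub : IsSubmanifold d M) (hM : M ⊆ sphere 0 1)
    (hne : M.Nonempty) (hcompact : IsCompact M) (hd : finrank ℝ E = d + 1) (hd0 : d ≠ 0) :
    M = sphere 0 1 := by
  have hrank : 1 < Module.rank ℝ E := by
    rw [← finrank_eq_rank, hd]
    exact_mod_cast (by omega : 1 < d + 1)
  have : PreconnectedSpace (sphere (0 : E) 1) :=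
    isPreconnected_iff_preconnectedSpace.1 (isConnected_sphere hrank 0 zero_le_one).isPreconnected
  have hclopen : IsClopen (Subtype.val ⁻¹' M : Set (sphere (0 : E) 1)) := by
    refine ⟨hcompact.isClosed.preimage continuous_subtype_val, isOpen_iff_mem_nhds.2 ?_⟩
    rintro ⟨x, hx⟩ hxM
    obtain ⟨U, c, h, u, hu, rfl⟩ := hsub x hxM
    exact preimage_coe_mem_nhds_subtype.2 (h.mem_nhdsWithin_sphere hM hsub hd hu)
  obtain ⟨x, hx⟩ := hne
  have := hclopen.eq_univ ⟨⟨x, hM hx⟩, hx⟩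
  refine hM.antisymm fun y hy ↦ ?_
  have h1 : (⟨y, hy⟩ : sphere (0 : E) 1) ∈ (univ : Set (sphere (0 : E) 1)) := mem_univ _
  rwa [← this] at h1

/-- The cone over a submanifold of positive codimension in the sphere is a null set. -/
lemma IsSubmanifold.measure_cone_eq_zero [MeasurableSpace E] [BorelSpace E] (μ : Measure E)
    [μ.IsAddHaarMeasure] (hsub : IsSubmanifold d M) (hM : M ⊆ sphere 0 1)
    (hd : d + 1 < finrank ℝ E) : μ (Ioo (0 : ℝ) 1 • M) = 0 := by
  refine measure_null_of_locally_null _ ?_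
  rintro _ ⟨r, hr, x, hx, rfl⟩
  obtain ⟨U, c, h, u, hu, rfl⟩ := hsub x hx
  obtain ⟨ε, hε, hball⟩ := Metric.isOpen_iff.1 h.isOpen u hu
  have hnorm {r : ℝ} (hr : r ∈ Ioo (0 : ℝ) 1) {x : E} (hx : x ∈ M) : ‖r • x‖⁻¹ • (r • x) = x := by
    rw [norm_smul, norm_eq_one_of_mem (hM hx), mul_one, Real.norm_of_nonneg hr.1.le, smul_smul,
      inv_mul_cancel₀ hr.1.ne', one_smul]
  have hnhds : c '' ball u ε ∈ 𝓝[M] (c u) := by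
    rw [← h.map_nhds hu]
    exact image_mem_map (ball_mem_nhds u hε)
  have hne : r • c u ≠ 0 := by
    rw [← norm_pos_iff, norm_smul, norm_eq_one_of_mem (hM hx), mul_one,
      Real.norm_of_nonneg hr.1.le]
    exact hr.1
  -- Radial projection is continuous, so near this point the cone lies over a single chart of M.
  have htend : Tendsto (fun z : E ↦ ‖z‖⁻¹ • z) (𝓝[Ioo (0 : ℝ) 1 • M] (r • c u)) (𝓝[M] (c u)) := by
    refine tendsto_nhdsWithin_iff.2 ⟨?_, ?_⟩
    · have h1 : ContinuousAt (fun z : E ↦ ‖z‖⁻¹ • z) (r • c u) :=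
        (continuousAt_id.norm.inv₀ (norm_ne_zero_iff.2 hne)).smul continuousAt_id
      have h2 := h1.tendsto
      rw [hnorm hr hx] at h2
      exact h2.mono_left nhdsWithin_le_nhds
    · filter_upwards [self_mem_nhdsWithin]
      rintro _ ⟨s, hs, y, hy, rfl⟩
      simp only [hnorm hs hy]
      exact hy
  refine ⟨_, htend hnhds, ?_⟩
  refine measure_mono_null
    (t := (fun z : ℝ × EuclideanSpace ℝ (Fin d) ↦ z.1 • c z.2) '' (univ ×ˢ ball u ε)) ?_ ?_
  · rintro z ⟨u', hu', hz⟩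
    simp only at hz
    refine ⟨(‖z‖, u'), ⟨mem_univ _, hu'⟩, ?_⟩
    simp only [hz]
    by_cases h0 : ‖z‖ = 0
    · rw [norm_eq_zero.1 h0]; simp
    · rw [smul_smul, mul_inv_cancel₀ h0, one_smul]
  -- A C¹ map on a convex set does not raise Hausdorff dimension, so the piece has dimension at most
  -- d + 1 < dim E. The ball is used because it is convex.
  · have hle : dimH ((fun z : ℝ × EuclideanSpace ℝ (Fin d) ↦ z.1 • c z.2) ''
        (univ ×ˢ ball u ε)) ≤ dimH ((univ : Set ℝ) ×ˢ ball u ε) :=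
      ((h.contDiffOn_cone.mono (prod_mono_right hball)).of_le
        (by exact_mod_cast le_top)).dimH_image_le (convex_univ.prod (convex_ball u ε)) subset_rfl
    have hle2 : dimH ((univ : Set ℝ) ×ˢ ball u ε) ≤ (d + 1 : ℕ) := by
      refine (dimH_mono (subset_univ _)).trans ?_
      rw [Real.dimH_univ_eq_finrank]
      simp [add_comm]
    have := isAddHaarMeasure_hausdorffMeasure (E := E)
    refine measure_zero_of_dimH_lt (d := (finrank ℝ E : NNReal)) ?_ ?_
    · exact_mod_cast Measure.absolutelyContinuous_isAddHaarMeasure μ (μH[(finrank ℝ E : ℝ)])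
    · refine (hle.trans hle2).trans_lt ?_
      exact_mod_cast hd

end Dimension

section Neg

lemma IsSubmanifold.neg {E : Type} [NormedAddCommGroup E] [InnerProductSpace ℝ E] {d : ℕ}
    {M : Set E} (hsub : IsSubmanifold d M) : IsSubmanifold d {x | -x ∈ M} := by
  intro x hx
  obtain ⟨U, c, h, u, hu, hux⟩ := hsub _ hx
  obtain ⟨W, s, hW, hUW, hs, hcs⟩ := h.exists_inverse
  refine ⟨U, fun u ↦ -c u, .of_inverse (W := {x | -x ∈ W}) (s := fun x ↦ s (-x)) h.isOpen
    h.contDiffOn.neg ?_ (hW.preimage continuous_neg) ?_ ?_ ?_ ?_, u, hu, by simp [hux]⟩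
  · intro u hu
    rw [fderiv_fun_neg]
    exact neg_injective.comp (h.immersion u hu)
  · intro u hu
    simpa using ⟨h.mem hu, hUW u hu⟩
  · exact hs.comp continuous_neg.continuousOn fun x hx ↦ hx
  · intro u hu
    have h2 := hcs (c u) ⟨h.mem hu, hUW u hu⟩
    simpa using h.injOn h2.1 hu h2.2
  · intro x hx
    obtain ⟨h1, h2⟩ := hcs (-x) hx
    exact ⟨h1, by rw [h2, neg_neg]⟩

end Neg

lemma sphereMeasure_eq_zero {d : ℕ} {V : Set R8} (hV : IsSubmanifold d V) (hS : V ⊆ sphere 0 1)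
    (hd : d < 7) (hcl : IsClosed V) :
    sphereMeasure (Subtype.val ⁻¹' V) = 0 := by
  have h1 : Subtype.val '' (Subtype.val ⁻¹' V : Set (sphere (0 : R8) 1)) = V := by
    rw [Subtype.image_preimage_coe, inter_eq_right]
    exact hS
  rw [sphereMeasure, Measure.toSphere_apply' _
    (hcl.preimage continuous_subtype_val).measurableSet, h1,
    hV.measure_cone_eq_zero volume hS (by rw [finrank_R8]; omega), mul_zero]

lemma isClosed_hopfPreimage {M : Set R5} (hM : IsClosed M) : IsClosed (hopfPreimage M) :=
  isClosed_sphere.inter (hM.preimage contDiff_hopf.continuous)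

/-! ### Dimension of the base and the exceptional directions -/

section Base

variable {d : ℕ} {M : Set R5} (hM : M ⊆ sphere 0 1) (hsub : IsSubmanifold d M)
  (hne : M.Nonempty) (hcompact : IsCompact M)
include hM hsub hne hcompact

lemma dim_lt_of_ne_sphere (h : M ≠ sphere 0 1) : d < 4 := by
  have h1 := hsub.dim_le hM hne (n := 4) finrank_R5
  refine lt_of_le_of_ne h1 fun h2 ↦ h ?_
  subst h2
  exact hsub.eq_sphere hM hne hcompact finrank_R5 (by norm_num)

/-- The exceptional directions form h⁻¹(-M), of dimension d + 3 < 7. -/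
theorem ae_neg_hopf_notMem (h : M ≠ sphere 0 1) :
    ∀ᵐ q : sphere (0 : R8) 1 ∂sphereMeasure, -hopf (q : R8) ∉ M := by
  have hd := dim_lt_of_ne_sphere hM hsub hne hcompact h
  have hM' : {y | -y ∈ M} ⊆ sphere (0 : R5) 1 := fun y hy ↦ by
    simpa using neg_mem_sphere (hM hy)
  have h1 := sphereMeasure_eq_zero (hsub.neg.hopfPreimage hM') (fun x hx ↦ hx.1) (by omega)
    (isClosed_hopfPreimage (hcompact.isClosed.preimage continuous_neg))
  rw [ae_iff]
  refine measure_mono_null (fun q hq ↦ ?_) h1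
  exact ⟨q.2, not_not.1 hq⟩

omit hne hcompact in
-- If d were smaller, the preimage, which is all of S⁷, would be a null set.
lemma dim_eq_of_eq_sphere (h : M = sphere 0 1) : d = 4 := by
  have hne : (sphere (0 : R5) 1).Nonempty :=
    have : Nontrivial R5 := nontrivial_of_finrank_pos (R := ℝ) (by rw [finrank_R5]; norm_num)
    NormedSpace.sphere_nonempty.2 zero_le_one
  have h1 := hsub.dim_le hM (h ▸ hne) (n := 4) finrank_R5
  by_contra h2
  have h3 := sphereMeasure_eq_zero (hsub.hopfPreimage hM) (fun x hx ↦ hx.1) (by omega)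
    (isClosed_hopfPreimage (h ▸ isClosed_sphere))
  have h4 : (Subtype.val ⁻¹' hopfPreimage M : Set (sphere (0 : R8) 1)) = univ :=
    eq_univ_of_forall fun q ↦ ⟨q.2, h ▸ hopf_mem_sphere q.2⟩
  rw [h4, Measure.measure_univ_eq_zero, sphereMeasure,
    Measure.toSphere_eq_zero_iff_finrank, finrank_R8] at h3
  norm_num at h3

end Base

end HopfTaut
end

noncomputable section

namespace HopfTaut

open Filter Topology Module

/-! ### Critical points in the antipodal fibre -/

/-- The eigenspace of the Clifford action whose unit sphere is the fibre over `y`. -/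
def fibreSpace (y : R5) : Submodule ℝ R8 := (clB y - ContinuousLinearMap.id ℝ R8).ker

lemma mem_fibreSpace {y : R5} {x : R8} : x ∈ fibreSpace y ↔ cl y x = x := by
  rw [fibreSpace, LinearMap.mem_ker]
  exact sub_eq_zero

/-- The eigenspace is the quaternionic line through any point of the fibre. -/
lemma finrank_fibreSpace {y : R5} (hy : y ∈ sphere (0 : R5) 1) : finrank ℝ (fibreSpace y) = 4 := by
  obtain ⟨x, hx, rfl⟩ := exists_hopf_eq hy
  have hinj : Function.Injective (rmulB x) := by
    refine (injective_iff_map_eq_zero _).2 fun g hg ↦ ?_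
    have h1 := congrArg norm hg
    rw [rmulB_apply, norm_rmul, norm_eq_one_of_mem hx, one_mul, norm_zero] at h1
    exact norm_eq_zero.1 h1
  have hrange : fibreSpace (hopf x) = (rmulB x : ℍ[ℝ] →ₗ[ℝ] R8).range := by
    ext z
    rw [mem_fibreSpace]
    constructor
    · intro h
      refine ⟨qp x z, ?_⟩
      change rmul x (qp x z) = z
      rw [rmul_qp, h, norm_eq_one_of_mem hx, one_pow, one_smul, ← two_smul ℝ z, smul_smul]
      norm_num
    · rintro ⟨g, rfl⟩
      change cl (hopf x) (rmul x g) = rmul x g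
      rw [cl_rmul, cl_hopf_self, norm_eq_one_of_mem hx, one_pow, one_smul]
  rw [hrange, LinearMap.finrank_range_of_inj hinj, Quaternion.finrank_eq_four]

lemma encard_unit_of_finrank_eq_one {E : Type} [NormedAddCommGroup E] [InnerProductSpace ℝ E]
    {K : Submodule ℝ E} (hK : finrank ℝ K = 1) : {x ∈ sphere (0 : E) 1 | x ∈ K}.encard = 2 := by
  obtain ⟨⟨v, hvK⟩, hv0, hv⟩ := finrank_eq_one_iff'.1 hK
  have hv0 : v ≠ 0 := fun h ↦ hv0 (Subtype.ext h)
  set x := ‖v‖⁻¹ • v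
  have hx : ‖x‖ = 1 := norm_smul_inv_norm (𝕜 := ℝ) hv0
  have hxK : x ∈ K := K.smul_mem _ hvK
  have hne : x ≠ -x := fun h ↦ by
    have h2 : (2 : ℝ) • x = 0 := by rw [two_smul, eq_neg_iff_add_eq_zero.1 h]
    rw [(smul_eq_zero.1 h2).resolve_left two_ne_zero, norm_zero] at hx
    exact zero_ne_one hx
  rw [← encard_pair hne]
  congr 1
  ext w
  constructor
  · rintro ⟨hw, hwK⟩
    obtain ⟨r, hr⟩ := hv ⟨w, hwK⟩
    have hr : r • v = w := congrArg Subtype.val hr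
    have hw' : w = (r * ‖v‖) • x := by
      rw [← hr, smul_smul, mul_assoc, mul_inv_cancel₀ (norm_ne_zero_iff.2 hv0), mul_one]
    have h1 := norm_eq_one_of_mem hw
    rw [hw', norm_smul, hx, mul_one, Real.norm_eq_abs, abs_eq zero_le_one] at h1
    rcases h1 with h1 | h1
    · left; rw [hw', h1, one_smul]
    · right; rw [mem_singleton_iff, hw', h1, neg_one_smul]
  · rintro (rfl | rfl)
    · exact ⟨mem_sphere_zero_iff_norm.2 hx, hxK⟩
    · exact ⟨mem_sphere_zero_iff_norm.2 (by rwa [norm_neg]), K.neg_mem hxK⟩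

/-- The unit sphere of a space of dimension at least two has no isolated points. -/
lemma frequently_ne_of_two_le_finrank {E : Type} [NormedAddCommGroup E] [InnerProductSpace ℝ E]
    {K : Submodule ℝ E} (hK : 2 ≤ finrank ℝ K) :
    ∃ x ∈ sphere (0 : E) 1, x ∈ K ∧ ∃ᶠ z in 𝓝 x, z ∈ sphere (0 : E) 1 ∧ z ∈ K ∧ z ≠ x := by
  have : FiniteDimensional ℝ K :=
    Module.finite_of_finrank_pos (by omega)
  let b := stdOrthonormalBasis ℝ K
  let x : K := b ⟨0, by omega⟩
  let x' : K := b ⟨1, by omega⟩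
  have hx : ‖(x : E)‖ = 1 := b.orthonormal.1 _
  have hx' : ‖(x' : E)‖ = 1 := b.orthonormal.1 _
  have hort : inner ℝ (x : E) (x' : E) = 0 := b.orthonormal.2 (by simp)
  refine ⟨x, mem_sphere_zero_iff_norm.2 hx, x.2, ?_⟩
  -- A great circle in K through x; it leaves x for small θ > 0.
  let γ : ℝ → E := fun θ ↦ Real.cos θ • (x : E) + Real.sin θ • (x' : E)
  have hγ : Tendsto γ (𝓝[>] 0) (𝓝 (x : E)) := by
    have h1 : Continuous γ := by fun_prop
    have h2 := h1.tendsto 0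
    simp only [γ, Real.cos_zero, Real.sin_zero, one_smul, zero_smul, add_zero] at h2
    exact h2.mono_left nhdsWithin_le_nhds
  refine hγ.frequently (Eventually.frequently ?_)
  filter_upwards [Ioo_mem_nhdsGT Real.pi_pos] with θ hθ
  have hs := Real.sin_pos_of_mem_Ioo hθ
  refine ⟨?_, K.add_mem (K.smul_mem _ x.2) (K.smul_mem _ x'.2), fun h ↦ ?_⟩
  · have h1 : ‖γ θ‖ ^ 2 = 1 := by
      rw [norm_add_sq_real, norm_smul, norm_smul, hx, hx', inner_smul_left, inner_smul_right, hort]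
      simp
    rw [mem_sphere_zero_iff_norm]
    exact (sq_eq_sq₀ (norm_nonneg _) zero_le_one).1 (by rw [h1, one_pow])
  · have h1 := congrArg (fun z ↦ inner ℝ (x' : E) z) h
    simp only [γ, inner_add_right, inner_smul_right, real_inner_comm (x : E) (x' : E), hort,
      real_inner_self_eq_norm_sq, hx'] at h1
    simp at h1
    exact hs.ne' h1

section Fibre

variable {d : ℕ} {M : Set R5} (hM : M ⊆ sphere 0 1) (hsub : IsSubmanifold d M)
  {p : R8} (hp : p ∈ sphere (0 : R8) 1)
include hM hsub hp

/-- The critical points in the fibre over `-h p` form the unit sphere of a linear subspace. -/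
lemma exists_fibre_criticalSet (hy : -hopf p ∈ M) :
    ∃ K : Submodule ℝ R8, d + finrank ℝ K = 4 ∧ ∀ x ∈ sphere (0 : R8) 1,
      x ∈ K ↔ hopf x = -hopf p ∧ IsCriticalPt (d + 3) (hopfPreimage M) (height p) x := by
  obtain ⟨U, c, h, u, hu, hux⟩ := hsub _ hy
  have hpn := norm_eq_one_of_mem hp
  let T : EuclideanSpace ℝ (Fin d) →L[ℝ] R8 := (clB.flip p).comp (fderiv ℝ c u)
  have hT (v) : T v = cl (fderiv ℝ c u v) p := rfl
  have hinj : Function.Injective T := by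
    refine (injective_iff_map_eq_zero _).2 fun v hv ↦ ?_
    have h1 := congrArg norm hv
    rw [hT, norm_cl, hpn, mul_one, norm_zero, norm_eq_zero] at h1
    exact (injective_iff_map_eq_zero _).1 (h.immersion u hu) v h1
  have hclp : cl (-hopf p) p = -p := by
    rw [← neg_one_smul ℝ (hopf p), ← clB_apply, map_smul, smul_apply, clB_apply,
      cl_hopf_self, hpn, one_pow, one_smul, neg_one_smul]
  -- A tangent vector w at -h(p) is orthogonal to it, so the two Clifford operators anticommute;
  -- since `cl (-hopf p)` is -1 on p, it is +1 on `cl w p`.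
  have hle : T.range ≤ fibreSpace (-hopf p) := by
    rintro _ ⟨v, rfl⟩
    rw [mem_fibreSpace]
    have h1 := cl_cl_add (-hopf p) (fderiv ℝ c u v) p
    have h2 := h.inner_fderiv hM hsub hu v
    rw [hux] at h2
    rw [h2, mul_zero, zero_smul, hclp, ← neg_one_smul ℝ p, cl_smul, neg_one_smul,
      ← sub_eq_add_neg, sub_eq_zero] at h1
    exact h1
  refine ⟨T.rangeᗮ ⊓ fibreSpace (-hopf p), ?_, fun x hx ↦ ?_⟩
  · have h1 := Submodule.finrank_add_inf_finrank_orthogonal hle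
    rw [LinearMap.finrank_range_of_inj hinj, finrank_fibreSpace (hM hy)] at h1
    simpa using h1
  · rw [Submodule.mem_inf, mem_fibreSpace, ← hopf_eq_iff hx (hM hy), and_comm]
    refine and_congr_right fun hxp ↦ ?_
    rw [h.isCriticalPt_fibre_iff hM hp hx hu (hux.trans hxp.symm) hxp, Submodule.mem_orthogonal]
    constructor
    · intro h1 v
      rw [← inner_cl_left]
      exact h1 _ ⟨v, rfl⟩
    · rintro h1 _ ⟨v, rfl⟩
      have h2 := h1 v
      rw [← inner_cl_left] at h2
      exact h2

/-- A critical point y of M other than ±h(p) lifts to `sec p y`, which is not ±p because it lies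
over y; nondegeneracy there descends. -/
lemma isNondegSphDist_hopf (hn : IsNondegSphDist (d + 3) (hopfPreimage M) p) :
    IsNondegSphDist d M (hopf p) := by
  rw [isNondegSphDist_iff hM (hopf_mem_sphere hp) hsub]
  rw [isNondegSphDist_iff (fun x hx ↦ hx.1) hp (hsub.hopfPreimage hM)] at hn
  intro U c h u hu h1 h2 h0
  have hmem : (splitCoord d).symm (u, 0) ∈ chartDomain U c p := by
    simp only [chartDomain, mem_ofPred_eq, ContinuousLinearEquiv.apply_symm_apply]
    exact ⟨hu, h2⟩
  have hsec := hopf_sec hp (hM (h.mem hu)) h2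
  refine h.nondegAt_of_hopfChart hM hp hu h2 h0
    (hn _ _ (h.hopfChart hM hp) _ hmem ?_ ?_ ?_)
  · rw [hopfChart_symm]
    exact fun h' ↦ h1 (by rw [← hsec, h'])
  · rw [hopfChart_symm]
    exact fun h' ↦ h1 (by rw [← hsec, h', hopf_neg])
  · rw [← (h.hopfChart hM hp).isCriticalPt_iff hmem, hopfChart_symm,
      h.isCriticalPt_sec_self_iff hM hp hu h2, h.isCriticalPt_iff hu]
    exact h0

lemma encard_heightCriticalSet_of_nondeg (hd : d < 4)
    (hn : IsNondegSphDist (d + 3) (hopfPreimage M) p) :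
    (heightCriticalSet (d + 3) (hopfPreimage M) p).encard =
      2 * (heightCriticalSet d M (hopf p)).encard := by
  by_cases hy : -hopf p ∈ M
  swap
  · exact encard_heightCriticalSet hM hsub hp hy
  have hV := hsub.hopfPreimage hM
  obtain ⟨K, hK, hcrit⟩ := exists_fibre_criticalSet hM hsub hp hy
  set T := heightCriticalSet d M (hopf p)
  have hyT : -hopf p ∈ T :=
    ⟨hy, isCriticalPt_height_self hM (hopf_mem_sphere hp) hsub hy (Or.inr rfl)⟩
  -- The dimension is 4 - d ≥ 1. If it were at least 2, some critical point over -h(p) would not be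
  -- isolated; such points are not ±p, so they are nondegenerate, a contradiction.
  have hK1 : finrank ℝ K = 1 := by
    by_contra hK1
    obtain ⟨x, hx, hxK, hfreq⟩ := frequently_ne_of_two_le_finrank (K := K) (by omega)
    obtain ⟨h1, h2⟩ := (hcrit x hx).1 hxK
    have hxV : x ∈ hopfPreimage M := ⟨hx, h1 ▸ hy⟩
    have hne := (hopf_ne_neg_self hp).symm
    rw [isNondegSphDist_iff (fun x hx ↦ hx.1) hp hV] at hn
    obtain ⟨U, c, h, u, hu, rfl⟩ := hV x hxV
    have h3 := h.eventually_not_isCriticalPt hu (hn U c h u hu (fun h' ↦ hne (by rw [← h1, h']))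
      (fun h' ↦ hne (by rw [← h1, h', hopf_neg])) ((h.isCriticalPt_iff hu _).1 h2))
    rw [eventually_nhdsWithin_iff] at h3
    obtain ⟨z, ⟨hz, hzK, hzne⟩, hz'⟩ := (hfreq.and_eventually h3).exists
    obtain ⟨h4, h5⟩ := (hcrit z hz).1 hzK
    exact hzne (hz' ⟨hz, h4 ▸ hy⟩ h5)
  have hset : heightCriticalSet (d + 3) (hopfPreimage M) p =
      {x ∈ sphere (0 : R8) 1 | hopf x ∈ T \ {-hopf p} ∧
        (x = sec p (hopf x) ∨ x = -sec p (hopf x))} ∪ {x ∈ sphere (0 : R8) 1 | x ∈ K} := by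
    ext x
    constructor
    · rintro ⟨hx, h1⟩
      by_cases h2 : hopf x = -hopf p
      · exact Or.inr ⟨hx.1, (hcrit x hx.1).2 ⟨h2, h1⟩⟩
      · have h3 := (isCriticalPt_hopfPreimage_iff hM hsub hp hx h2).1 h1
        exact Or.inl ⟨hx.1, ⟨⟨hx.2, h3.2⟩, h2⟩, h3.1⟩
    · rintro (⟨hx, ⟨h1, h2⟩, h3⟩ | ⟨hx, hxK⟩)
      · exact ⟨⟨hx, h1.1⟩,
          (isCriticalPt_hopfPreimage_iff hM hsub hp ⟨hx, h1.1⟩ h2).2 ⟨h3, h1.2⟩⟩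
      · obtain ⟨h1, h2⟩ := (hcrit x hx).1 hxK
        exact ⟨⟨hx, h1 ▸ hy⟩, h2⟩
  have hdisj : Disjoint {x ∈ sphere (0 : R8) 1 | hopf x ∈ T \ {-hopf p} ∧
      (x = sec p (hopf x) ∨ x = -sec p (hopf x))} {x ∈ sphere (0 : R8) 1 | x ∈ K} := by
    rw [Set.disjoint_left]
    rintro x ⟨hx, ⟨-, h1⟩, -⟩ ⟨-, h2⟩
    exact h1 ((hcrit x hx).1 h2).1
  -- The two points over -h(p) account for twice the one critical point removed from T.
  rw [hset, encard_union_eq hdisj, encard_image_sec hp (fun y hy ↦ hM hy.1.1) (fun h ↦ h.2 rfl),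
    encard_unit_of_finrank_eq_one hK1, ← encard_sdiff_singleton_add_one hyT, mul_add, mul_one]

end Fibre

/-! ### Tautness -/

/-- Spheres are taut. -/
lemma isTaut_sphere {E : Type} [NormedAddCommGroup E] [InnerProductSpace ℝ E]
    [FiniteDimensional ℝ E] {d : ℕ} (hd : finrank ℝ E = d + 1) (hd0 : d ≠ 0)
    (hsub : IsSubmanifold d (sphere (0 : E) 1)) : IsTaut d (sphere (0 : E) 1) where
  subset_sphere := subset_rfl
  isCompact := isCompact_sphere 0 1
  isConnected := isConnected_sphere (by
    rw [← finrank_eq_rank, hd]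
    exact_mod_cast (by omega : 1 < d + 1)) 0 zero_le_one
  isSubmanifold := hsub
  perfect p hp _ := by
    have hne : p ≠ -p := fun h ↦ by
      have h1 := norm_eq_one_of_mem hp
      have h2 : (2 : ℝ) • p = 0 := by rw [two_smul, eq_neg_iff_add_eq_zero.1 h]
      rw [(smul_eq_zero.1 h2).resolve_left two_ne_zero, norm_zero] at h1
      exact zero_ne_one h1
    rw [bettiSum_sphere d hd, sphDistCriticalSet_eq subset_rfl hp hsub, ← encard_pair hne]
    congr 1
    ext x
    constructor
    · rintro ⟨hx, h⟩
      obtain ⟨U, c, hc, u, hu, rfl⟩ := hsub x hx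
      rw [hc.isCriticalPt_height_iff hu] at h
      -- At a critical point p is normal to the sphere, hence a multiple of x, and the multiple is
      -- ±1.
      obtain ⟨r, hr⟩ := hc.exists_smul_eq subset_rfl hsub hd hu h
      have h1 := norm_eq_one_of_mem hp
      rw [← hr, norm_smul, norm_eq_one_of_mem hx, mul_one, Real.norm_eq_abs,
        abs_eq zero_le_one] at h1
      rcases h1 with h1 | h1
      · left
        rw [← hr, h1, one_smul]
      · right
        rw [mem_singleton_iff, ← hr, h1, neg_one_smul, neg_neg]
    · intro h
      have hx : x ∈ sphere (0 : E) 1 := by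
        rcases h with rfl | rfl
        · exact hp
        · exact neg_mem_sphere hp
      exact ⟨hx, isCriticalPt_height_self subset_rfl hp hsub hx h⟩

lemma finrank_quaternion : finrank ℝ ℍ[ℝ] = 3 + 1 := Quaternion.finrank_eq_four

/-- The inverse image of a taut submanifold under the Hopf map is taut. -/
theorem IsTaut.hopfPreimage {d : ℕ} {M : Set R5} (h : IsTaut d M) :
    IsTaut (d + 3) (hopfPreimage M) := by
  have hM := h.subset_sphere
  have hsub := h.isSubmanifold
  have hV := hsub.hopfPreimage hM
  -- The whole sphere is separate: h is trivialized only over sets missing a point, and the doubling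
  -- argument needs d < 4.
  by_cases hMS : M = sphere 0 1
  · have hd := dim_eq_of_eq_sphere hM hsub hMS
    have hVS : HopfTaut.hopfPreimage M = sphere 0 1 := by
      ext x
      exact ⟨fun hx ↦ hx.1, fun hx ↦ ⟨hx, hMS ▸ hopf_mem_sphere hx⟩⟩
    rw [hVS] at hV ⊢
    exact isTaut_sphere (by rw [finrank_R8, hd]) (by omega) hV
  have hd := dim_lt_of_ne_sphere hM hsub h.isConnected.nonempty h.isCompact hMS
  obtain ⟨y, hy, hyM⟩ : ∃ y ∈ sphere (0 : R5) 1, y ∉ M := by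
    by_contra! hall
    exact hMS (hM.antisymm hall)
  -- The section through p is defined off -h(p), so p is taken over the antipode of the missed point
  -- y.
  obtain ⟨p, hp, hpy⟩ := exists_hopf_eq (neg_mem_sphere hy)
  have hpM : -hopf p ∉ M := by rwa [hpy, neg_neg]
  let e := trivialization M hM p hp hpM
  refine ⟨fun x hx ↦ hx.1, ?_, ?_, hV, fun q hq hn ↦ ?_⟩
  · exact (isCompact_sphere 0 1).of_isClosed_subset (isClosed_hopfPreimage h.isCompact.isClosed)
      fun x hx ↦ hx.1
  · have h1 : ConnectedSpace M := isConnected_iff_connectedSpace.1 h.isConnected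
    have h2 : ConnectedSpace (sphere (0 : ℍ[ℝ]) 1) := by
      refine isConnected_iff_connectedSpace.1 (isConnected_sphere ?_ 0 zero_le_one)
      rw [← finrank_eq_rank, finrank_quaternion]
      norm_num
    exact isConnected_iff_connectedSpace.2 (e.surjective.connectedSpace e.continuous)
  · rw [sphDistCriticalSet_eq (fun x hx ↦ hx.1) hq hV,
      encard_heightCriticalSet_of_nondeg hM hsub hq hd hn, ← bettiSum_congr e,
      bettiSum_prod_sphere M 3 finrank_quaternion,
      ← sphDistCriticalSet_eq hM (hopf_mem_sphere hq) hsub,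
      h.perfect _ (hopf_mem_sphere hq) (isNondegSphDist_hopf hM hsub hq hn)]

end HopfTaut
end

theorem theorem3p7p1 (d : ℕ) (M : Set HopfTaut.R5) (hM : M ⊆ Metric.sphere 0 1)
    (hcompact : IsCompact M) (hconn : IsConnected M) (hsub : HopfTaut.IsSubmanifold d M) :
    -- if `M` is taut in `S⁴`, then `h⁻¹(M)` is taut in `S⁷`
    (HopfTaut.IsTaut d M → HopfTaut.IsTaut (d + 3) (HopfTaut.hopfPreimage M)) ∧
    -- the height function in the direction `q` on `h⁻¹(M)` has twice as many critical points as
    -- the height function in the direction `h q` on `M`, unless `-h q` lies on `M`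
    (∀ q ∈ Metric.sphere (0 : HopfTaut.R8) 1, -HopfTaut.hopf q ∉ M →
      (HopfTaut.heightCriticalSet (d + 3) (HopfTaut.hopfPreimage M) q).encard =
        2 * (HopfTaut.heightCriticalSet d M (HopfTaut.hopf q)).encard) ∧
    -- which holds for almost every `q` in `S⁷`
    (M ≠ Metric.sphere 0 1 →
      ∀ᵐ q : Metric.sphere (0 : HopfTaut.R8) 1 ∂HopfTaut.sphereMeasure,
        -HopfTaut.hopf (q : HopfTaut.R8) ∉ M) ∧
    -- the `ℤ/2`-Betti sum of `M × S³` is twice that of `M`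
    HopfTaut.bettiSum (M × Metric.sphere (0 : Quaternion ℝ) 1) = 2 * HopfTaut.bettiSum M :=
  ⟨HopfTaut.IsTaut.hopfPreimage,
    fun _ hq hne ↦ HopfTaut.encard_heightCriticalSet hM hsub hq hne,
    HopfTaut.ae_neg_hopf_notMem hM hsub hconn.nonempty hcompact,
    HopfTaut.bettiSum_prod_sphere M 3 HopfTaut.finrank_quaternion⟩
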